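/- Let $A\in\mathbb{R}^{m\times n}$ with $m\ge 1$ and $\operatorname{rk}(A)=m$, $b\in\mathbb{R}^m$, $c\in\mathbb{R}^n$, and let $x^{(0)}$ be a given feasible solution of the linear program $$\min\ \langle c,x\rangle\quad\text{s.t.}\quad Ax=b,\ x\ge 0. \qquad (\mathrm{LP})$$ An elementary vector of $A$ is a nonzero vector of $\ker(A)$ whose support is inclusion-wise minimal among the supports of nonzero vectors of $\ker(A)$. The circuit imbalance $\kappa_A$ is the maximum of $|g_i|/|g_j|$ over all elementary vectors $g$ and $i,j\in\operatorname{supp}(g)$ (with $\kappa_A=1$ if $\ker(A)=\{0\}$). A circuit augmentation algorithm moves through feasible solutions of (LP), starting at $x^{(0)}$; in each augmentation step it replaces the current solution $x$ by $x+\alpha g$, where $g$ is an elementary vector and $\alpha>0$ is the largest step size for which $x+\alpha g$ is feasible. The directions $g$ are provided by two oracles, which may be called for the submatrix $A_F$ of any set $F\subseteq[n]$ of columns (directions are extended by zeros) and for any arguments: * Ratio-Circuit$(A_F,c',w)$, with $w_j\in\mathbb{R}_{\ge0}\cup\{\infty\}$: it returns an optimal solution $z$ of $\min\{\langle c',z\rangle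 : A_Fz=0,\ \langle w,z^-\rangle\le 1\}$ that is an elementary vector or $0$, and a pair $(y,s)$ which, with a suitable $\lambda$, is an optimal solution of the dual $\max\{-\lambda : s=c'+A_F^\top y,\ 0\le s\le\lambda w,\ \lambda\ge 0\}$ (no upper bound on $s_j$ where $w_j=\infty$), or it reports that the first problem is unbounded. Here $(z^-)_j=\max\{0,-z_j\}$ and $\infty\cdot0=0$. * Support-Circuit$(A_F,c',x',S)$: it returns an elementary vector $z$ of $A_F$ with $\operatorname{supp}(z)\subseteq\operatorname{supp}(x')$, $\operatorname{supp}(z)\cap S\ne\emptyset$ and $\langle c',z\rangle\le 0$, or reports that there is none. There exist a circuit augmentation algorithm (one program for a real random access machine with these two oracles, with input $A,b,c,x^{(0)}$ and without knowledge of $\kappa_A$) and absolute constants $C,d$ such that, for all such inputs and all correct oracles, the algorithm halts and either its current solution is an optimal solution of (LP), or it correctly concludes that (LP) is unbounded. It makes at most $C\,mn^2\log(n+\kappa_A)$ calls to Ratio-Circuit (whether or not an augmentation step follows, with at most one such step per call), performs at most $(m+1)n^2$ augmentation steps along directions returned by Support-Circuit, and executes at most $C\,n^d\log(n+\kappa_A)$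 machine instructions (arithmetic operations, comparisons, oracle calls, augmentation steps). -/

import Mathlib

open scoped ENNReal Matrix

noncomputable section

namespace CircuitAug

/-! ### Linear programs in standard form -/

/-- The data of the linear program `min ⟨c, x⟩` subject to `A x = b`, `x ≥ 0`. -/
structure LP (m n : ℕ) where
  A : Matrix (Fin m) (Fin n) ℝ
  b : Fin m → ℝ
  c : Fin n → ℝ

/-- `x` lies in the polyhedron `{x : A x = b, x ≥ 0}`. -/
def LP.Feasible {m n : ℕ} (P : LP m n) (x : Fin n → ℝ) : Prop :=
  P.A *ᵥ x = P.b ∧ ∀ j, 0 ≤ x j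

/-- `x` is an optimal solution. -/
def LP.Optimal {m n : ℕ} (P : LP m n) (x : Fin n → ℝ) : Prop :=
  P.Feasible x ∧ ∀ x', P.Feasible x' → P.c ⬝ᵥ x ≤ P.c ⬝ᵥ x'

/-- The objective is unbounded from below on the feasible region. -/
def LP.Unbounded {m n : ℕ} (P : LP m n) : Prop :=
  ∀ B : ℝ, ∃ x, P.Feasible x ∧ P.c ⬝ᵥ x < B

/-! ### Elementary vectors and the circuit imbalance measure -/

/-- Elementary vectors of `ker A`: nonzero vectors of the kernel of minimal support. -/
def IsElementary {m n : ℕ} (A : Matrix (Fin m) (Fin n) ℝ) (g : Fin n → ℝ) : Prop :=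
  A *ᵥ g = 0 ∧ g ≠ 0 ∧
    ∀ h : Fin n → ℝ, A *ᵥ h = 0 → h ≠ 0 → ¬ Function.support h ⊂ Function.support g

/-- The circuit imbalance measure: the maximum of `|g_i| / |g_j|` over elementary vectors `g` and
`i, j ∈ supp g`. The set is finite, and contains `1` as soon as `ker A ≠ 0`; inserting `1` only
gives the trivial kernel the usual value `1`. -/
def circuitImbalance {m n : ℕ} (A : Matrix (Fin m) (Fin n) ℝ) : ℝ :=
  sSup (insert 1 {r : ℝ | ∃ g : Fin n → ℝ, IsElementary A g ∧
    ∃ i ∈ Function.support g, ∃ j ∈ Function.support g, r = |g i| / |g j|})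

/-- `α` is the maximal step size at `x` in direction `g`, and it is positive. -/
def LP.IsMaxStep {m n : ℕ} (P : LP m n) (x g : Fin n → ℝ) (α : ℝ) : Prop :=
  0 < α ∧ P.Feasible (x + α • g) ∧ ∀ α', α < α' → ¬ P.Feasible (x + α' • g)

/-! ### The two circuit oracles

Both are called for a submatrix `A_F` formed by a set `F` of columns of `A`. Vectors indexed by `F`
are represented by vectors indexed by all columns; a vector of `ker A_F` is extended by zeros, and
the elementary vectors of `A_F` become the elementary vectors of `A` supported in `F`. -/

/-- Feasibility for the minimum-ratio system: `A_F z = 0`, `⟨w, z⁻⟩ ≤ 1`. In `ℝ≥0∞` one has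
`∞ * 0 = 0`, so `w j = ∞` just forces `z j ≥ 0`. -/
def RatioFeasible {m n : ℕ} (A : Matrix (Fin m) (Fin n) ℝ) (F : Set (Fin n)) (w : Fin n → ℝ≥0∞)
    (z : Fin n → ℝ) : Prop :=
  A *ᵥ z = 0 ∧ (∀ j, j ∉ F → z j = 0) ∧ ∑ j, w j * ENNReal.ofReal (max 0 (-z j)) ≤ 1

/-- Feasibility for the dual system: `s = c + A_Fᵀ y`, `0 ≤ s ≤ lam • w`; an infinite weight imposes
no upper bound on `s j`. The objective is to maximize `-lam`. -/
def RatioDualFeasible {m n : ℕ} (A : Matrix (Fin m) (Fin n) ℝ) (F : Set (Fin n)) (c : Fin n → ℝ)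
    (w : Fin n → ℝ≥0∞) (y : Fin m → ℝ) (s : Fin n → ℝ) (lam : ℝ) : Prop :=
  0 ≤ lam ∧ ∀ j ∈ F, s j = c j + (Aᵀ *ᵥ y) j ∧ 0 ≤ s j ∧ (w j ≠ ∞ → s j ≤ lam * (w j).toReal)

/-- A primal vector `z` together with a dual solution `(y, s)`. -/
structure RatioAnswer (m n : ℕ) where
  z : Fin n → ℝ
  y : Fin m → ℝ
  s : Fin n → ℝ

/-- A solver for minimum-ratio systems: it maps `F`, a cost and weights to an answer, or to `none`
if the system is unbounded. -/
abbrev RatioOracle (m n : ℕ) : Type :=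
  Set (Fin n) → (Fin n → ℝ) → (Fin n → ℝ≥0∞) → Option (RatioAnswer m n)

/-- The oracle is correct for the matrix `A`. It returns an optimal primal solution that is an
elementary vector or zero (every basic optimal solution is of this form, and zero can occur only if
the optimal value is zero), and an optimal dual solution. It reports `none` exactly
if the system is unbounded. -/
def IsRatioOracle {m n : ℕ} (A : Matrix (Fin m) (Fin n) ℝ) (R : RatioOracle m n) : Prop :=
  ∀ F c w,
    (R F c w = none → ∀ B : ℝ, ∃ z, RatioFeasible A F w z ∧ c ⬝ᵥ z < B) ∧
    ∀ r, R F c w = some r →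
      (RatioFeasible A F w r.z ∧ ∀ z', RatioFeasible A F w z' → c ⬝ᵥ r.z ≤ c ⬝ᵥ z') ∧
      (r.z = 0 ∨ IsElementary A r.z) ∧
      ∃ lam, RatioDualFeasible A F c w r.y r.s lam ∧
        ∀ y' s' lam', RatioDualFeasible A F c w y' s' lam' → lam ≤ lam'

/-- A finder for support circuits: it maps `F`, a cost `c`, a vector `x` and a set `S` to an
elementary vector, or to `none`. -/
abbrev SupportOracle (n : ℕ) : Type :=
  Set (Fin n) → (Fin n → ℝ) → (Fin n → ℝ) → Set (Fin n) → Option (Fin n → ℝ)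

/-- `z` is an elementary vector of `A_F` with `supp z ⊆ supp x`, `supp z ∩ S ≠ ∅`, `⟨c, z⟩ ≤ 0`. -/
def IsSupportCircuit {m n : ℕ} (A : Matrix (Fin m) (Fin n) ℝ) (F : Set (Fin n))
    (c x : Fin n → ℝ) (S : Set (Fin n)) (z : Fin n → ℝ) : Prop :=
  IsElementary A z ∧ Function.support z ⊆ F ∧ Function.support z ⊆ Function.support x ∧
    (Function.support z ∩ S).Nonempty ∧ c ⬝ᵥ z ≤ 0

/-- The oracle is correct for `A`: it returns such a vector, or `none` if there is none. -/
def IsSupportOracle {m n : ℕ} (A : Matrix (Fin m) (Fin n) ℝ) (O : SupportOracle n) : Prop :=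
  ∀ F c x S,
    (O F c x S = none → ∀ z, ¬ IsSupportCircuit A F c x S z) ∧
    ∀ z, O F c x S = some z → IsSupportCircuit A F c x S z

/-! ### Circuit augmentation programs

A real random access machine with integer variables and two-dimensional arrays of real
numbers, programmed in a while language. The current solution is not under
the direct control of the program: it changes only by a maximal augmentation along the direction
that an oracle has returned. -/

/-- Integer expressions (subtraction is truncated). -/
inductive NExpr where
  | const (k : ℕ)
  | var (v : ℕ)
  | add (e f : NExpr)
  | sub (e f : NExpr)
  | mul (e f : NExpr)

/-- Real expressions: rational constants, array entries, conversion of integers, and exact field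
operations (division by zero gives zero). -/
inductive RExpr where
  | const (q : ℚ)
  | read (a : ℕ) (i j : NExpr)
  | ofNat (e : NExpr)
  | add (e f : RExpr)
  | sub (e f : RExpr)
  | mul (e f : RExpr)
  | div (e f : RExpr)

/-- Tests. -/
inductive BExpr where
  | natLT (e f : NExpr)
  | realLT (e f : RExpr)
  | not (t : BExpr)
  | and (t u : BExpr)

/-- Programs. The array arguments of the oracle calls refer to row `0` of the named array.

* `ratio cost weight free z y s v`: call the minimum-ratio oracle on the columns where the array
  `free` is nonzero, write the answer to the arrays `z`, `y`, `s` and set the variable `v` to `1`;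
  if the oracle reports unboundedness, set `v` to `0`.
* `support cost vec set free z v`: call the support-circuit oracle in the same way, with the set `S`
  of indices where the array `set` is nonzero; write the vector to `z` and set `v` to `1`; if there
  is none, set `v` to `0`.
* `augment a`: replace the current solution by the maximal augmentation along the direction
  returned by the last oracle call, and write it to the array `a`. -/
inductive Program where
  | skip
  | setNat (v : ℕ) (e : NExpr)
  | setReal (a : ℕ) (i j : NExpr) (e : RExpr)
  | seq (p q : Program)
  | branch (t : BExpr) (p q : Program)
  | loop (t : BExpr) (p : Program)
  | ratio (cost weight free z y s v : ℕ)
  | support (cost vec set free z v : ℕ)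
  | augment (a : ℕ)

/-- The direction that is available for an augmentation, with the oracle it comes from. -/
inductive Direction (n : ℕ) where
  | none
  | fromRatio (g : Fin n → ℝ)
  | fromSupport (g : Fin n → ℝ)

/-- Machine states: memory, current solution `x`, available direction, and three counters:
executed instructions, calls of the ratio oracle, and augmentations along support circuits. -/
structure State (n : ℕ) where
  nat : ℕ → ℕ
  real : ℕ → ℕ → ℕ → ℝ
  x : Fin n → ℝ
  dir : Direction n
  time : ℕ
  ratioCalls : ℕ
  supportSteps : ℕ

def NExpr.eval {n : ℕ} (σ : State n) : NExpr → ℕ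
  | .const k => k
  | .var v => σ.nat v
  | .add e f => e.eval σ + f.eval σ
  | .sub e f => e.eval σ - f.eval σ
  | .mul e f => e.eval σ * f.eval σ

def RExpr.eval {n : ℕ} (σ : State n) : RExpr → ℝ
  | .const q => (q : ℝ)
  | .read a i j => σ.real a (i.eval σ) (j.eval σ)
  | .ofNat e => (e.eval σ : ℝ)
  | .add e f => e.eval σ + f.eval σ
  | .sub e f => e.eval σ - f.eval σ
  | .mul e f => e.eval σ * f.eval σ
  | .div e f => e.eval σ / f.eval σ

def BExpr.Holds {n : ℕ} (σ : State n) : BExpr → Prop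
  | .natLT e f => e.eval σ < f.eval σ
  | .realLT e f => e.eval σ < f.eval σ
  | .not t => ¬ t.Holds σ
  | .and t u => t.Holds σ ∧ u.Holds σ

/-- One more executed instruction. -/
def State.tick {n : ℕ} (σ : State n) : State n := { σ with time := σ.time + 1 }

def State.setNat {n : ℕ} (σ : State n) (v k : ℕ) : State n :=
  { σ with nat := fun u => if u = v then k else σ.nat u }

def State.setReal {n : ℕ} (σ : State n) (a i j : ℕ) (r : ℝ) : State n :=
  { σ with real := fun a' i' j' => if a' = a ∧ i' = i ∧ j' = j then r else σ.real a' i' j' }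

/-- The vector in row `0` of the array `a`. -/
def State.vec {n : ℕ} (σ : State n) (a : ℕ) : Fin n → ℝ := fun j => σ.real a 0 j

/-- The index set encoded by the nonzero entries in row `0` of the array `a`. -/
def State.idx {n : ℕ} (σ : State n) (a : ℕ) : Set (Fin n) := {j | σ.vec a j ≠ 0}

/-- The weights encoded in row `0` of the array `a`; a negative entry stands for `∞`. -/
def State.weights {n : ℕ} (σ : State n) (a : ℕ) : Fin n → ℝ≥0∞ :=
  fun j => if σ.vec a j < 0 then ∞ else ENNReal.ofReal (σ.vec a j)

/-- Write a vector to the first entries of row `0` of the array `a`. -/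
def State.writeVec {n k : ℕ} (σ : State n) (a : ℕ) (v : Fin k → ℝ) : State n :=
  { σ with real := fun a' i' j' =>
      if h : a' = a ∧ i' = 0 ∧ j' < k then v ⟨j', h.2.2⟩ else σ.real a' i' j' }

/-- The effect of a call of the ratio oracle with a given answer. -/
def State.afterRatio {m n : ℕ} (σ : State n) (z y s v : ℕ) :
    Option (RatioAnswer m n) → State n
  | none => { σ.setNat v 0 with dir := .none, ratioCalls := σ.ratioCalls + 1 }
  | some r =>
    { (((σ.writeVec z r.z).writeVec y r.y).writeVec s r.s).setNat v 1 with
      dir := .fromRatio r.z, ratioCalls := σ.ratioCalls + 1 }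

/-- The effect of a call of the support-circuit oracle with a given answer. -/
def State.afterSupport {n : ℕ} (σ : State n) (z v : ℕ) : Option (Fin n → ℝ) → State n
  | none => { σ.setNat v 0 with dir := .none }
  | some g => { (σ.writeVec z g).setNat v 1 with dir := .fromSupport g }

/-- Replace the current solution, store it in the array `a`, and use up the direction. -/
def State.moveTo {n : ℕ} (σ : State n) (a : ℕ) (x : Fin n → ℝ) : State n :=
  { σ.writeVec a x with x := x, dir := .none }

/-- `Exec P R O p σ τ`: started in state `σ`, the program `p` halts in state `τ`. The relation is
deterministic. An augmentation without an available direction, or along a direction without a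
maximal positive step size, blocks the program. -/
inductive Exec {m n : ℕ} (P : LP m n) (R : RatioOracle m n) (O : SupportOracle n) :
    Program → State n → State n → Prop where
  | skip (σ : State n) : Exec P R O .skip σ σ.tick
  | setNat (v : ℕ) (e : NExpr) (σ : State n) :
      Exec P R O (.setNat v e) σ (σ.tick.setNat v (e.eval σ))
  | setReal (a : ℕ) (i j : NExpr) (e : RExpr) (σ : State n) :
      Exec P R O (.setReal a i j e) σ (σ.tick.setReal a (i.eval σ) (j.eval σ) (e.eval σ))
  | seq (p q : Program) (σ τ υ : State n) (hp : Exec P R O p σ τ) (hq : Exec P R O q τ υ) :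
      Exec P R O (.seq p q) σ υ
  | branchTrue (t : BExpr) (p q : Program) (σ τ : State n) (ht : t.Holds σ)
      (hp : Exec P R O p σ.tick τ) : Exec P R O (.branch t p q) σ τ
  | branchFalse (t : BExpr) (p q : Program) (σ τ : State n) (ht : ¬ t.Holds σ)
      (hq : Exec P R O q σ.tick τ) : Exec P R O (.branch t p q) σ τ
  | loopDone (t : BExpr) (p : Program) (σ : State n) (ht : ¬ t.Holds σ) :
      Exec P R O (.loop t p) σ σ.tick
  | loopStep (t : BExpr) (p : Program) (σ τ υ : State n) (ht : t.Holds σ)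
      (hp : Exec P R O p σ.tick τ) (hl : Exec P R O (.loop t p) τ υ) :
      Exec P R O (.loop t p) σ υ
  | ratio (cost weight free z y s v : ℕ) (σ : State n) :
      Exec P R O (.ratio cost weight free z y s v) σ
        (σ.tick.afterRatio z y s v (R (σ.idx free) (σ.vec cost) (σ.weights weight)))
  | support (cost vec set free z v : ℕ) (σ : State n) :
      Exec P R O (.support cost vec set free z v) σ
        (σ.tick.afterSupport z v (O (σ.idx free) (σ.vec cost) (σ.vec vec) (σ.idx set)))
  | augmentRatio (a : ℕ) (σ : State n) (g : Fin n → ℝ) (α : ℝ) (hg : σ.dir = .fromRatio g)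
      (hα : P.IsMaxStep σ.x g α) :
      Exec P R O (.augment a) σ (σ.tick.moveTo a (σ.x + α • g))
  | augmentSupport (a : ℕ) (σ : State n) (g : Fin n → ℝ) (α : ℝ) (hg : σ.dir = .fromSupport g)
      (hα : P.IsMaxStep σ.x g α) :
      Exec P R O (.augment a) σ
        { σ.tick.moveTo a (σ.x + α • g) with supportSteps := σ.supportSteps + 1 }

/-- The initial state: the integer variables `1`, `2` hold `m`, `n`; the arrays `0`, `1`, `2`, `3`
hold `A`, `b`, `c`, and the given feasible solution `x₀`; all else is zero. -/
def initial {m n : ℕ} (P : LP m n) (x₀ : Fin n → ℝ) : State n where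
  nat := fun v => if v = 1 then m else if v = 2 then n else 0
  real := fun a i j =>
    if a = 0 then (if h : i < m ∧ j < n then P.A ⟨i, h.1⟩ ⟨j, h.2⟩ else 0)
    else if a = 1 then (if h : i = 0 ∧ j < m then P.b ⟨j, h.2⟩ else 0)
    else if a = 2 then (if h : i = 0 ∧ j < n then P.c ⟨j, h.2⟩ else 0)
    else if a = 3 then (if h : i = 0 ∧ j < n then x₀ ⟨j, h.2⟩ else 0)
    else 0
  x := x₀
  dir := .none
  time := 0
  ratioCalls := 0
  supportSteps := 0

/-- The final state gives the right answer: the variable `0` is `0` and the current solution is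
optimal, or the variable `0` is `1` and the linear program is unbounded. -/
def Solves {m n : ℕ} (P : LP m n) (τ : State n) : Prop :=
  (τ.nat 0 = 0 ∧ P.Optimal τ.x) ∨ (τ.nat 0 = 1 ∧ P.Unbounded)

end CircuitAug

end

/-! # A circuit augmentation algorithm for linear programming -/

namespace CircuitAug

/-! ### Conformal decomposition and the circuit imbalance -/

/-! The algorithm works with a guess `q = 2 ^ K`, and all its estimates are valid as soon as `64 n⁵
κ³ ≤ q`, where `κ` is the circuit imbalance. It has three nested levels.

A phase keeps a nonnegative cost `c` with nonzero entries at least `1 / q`; up to small truncation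
errors it agrees with the normalized cost of the round modulo the row space. Progress is measured by
the potential `Φ = c ⬝ᵥ x`. The phase removes the circuits in the support of `x` that meet the
support of `c`. Then `4 n K` ratio steps with weights `1 / x`, each closing a fraction `1 / n` of
the gap (`ratio_gap`), make the gap at most `η = Φ / q ^ 4`. The dual answer for the weights `1 / (x
+ η)` has slacks with `s j * (x j + η) ≤ 2 n κ η` (`dual_bound`), so the potential of the new cost
is at most `2 n² κ Φ / q ^ 4`. Call a coordinate large if it is at least `2 q ^ 3` times the
potential. Some `j` carries a fraction `1 / n` of `Φ`. Either it keeps half its value, or a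
conformal circuit moves its mass to other coordinates; all coordinates that receive it are large for
the new potential. If the large columns spanned no more than before, column `j` would depend on the
other columns in the support of `x`, which the removal of circuits excludes. Hence the rank of the
large columns grows (`finrank_colSpan_lt`), and after `m + 1` phases the potential is zero.

A round starts from a dual solution whose largest slack is minimal, divided by the sum of its
slacks. Once the potential is zero, the final slacks are at most `1 / q` on the support of `x`, and
a proximity argument (`exists_feasible_restricted`) shows that variables with slack above `1 / (4
n)` may be fixed to zero without loss. There is such a variable, since otherwise the initial largest
slack was not minimal. So `n` rounds suffice.

As `κ` is unknown, `K` is doubled until one ratio call certifies optimality. The cost of a guess is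
linear in `K`, so the doubling costs a constant factor, and `K` stays of order `log (n + κ)`. The
removal of circuits also uses the ratio oracle, with tails of the cost as objectives, so no step
follows a support circuit. -/

/-- `g` is sign-compatible with `h`, and its support is contained in that of `h`. -/
def Conformal {n : ℕ} (g h : Fin n → ℝ) : Prop := ∀ i, g i ≠ 0 → 0 < g i * h i

theorem Conformal.refl {n : ℕ} (h : Fin n → ℝ) : Conformal h h :=
  fun _ hi => mul_self_pos.2 hi

theorem Conformal.trans {n : ℕ} {f g h : Fin n → ℝ} (hfg : Conformal f g) (hgh : Conformal g h) :
    Conformal f h := by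
  intro i hi
  have h1 := hfg i hi
  have hg : g i ≠ 0 := by
    intro h0
    simp [h0] at h1
  have h2 := hgh i hg
  have h3 : 0 < (f i * h i) * (g i * g i) := by nlinarith [mul_pos h1 h2]
  exact pos_of_mul_pos_left h3 (mul_self_nonneg _)

theorem Conformal.smul_left {n : ℕ} {g h : Fin n → ℝ} (hg : Conformal g h) {r : ℝ} (hr : 0 < r) :
    Conformal (r • g) h := by
  intro i hi
  have h0 : g i ≠ 0 := by
    intro h0
    simp [h0] at hi
  have := mul_pos hr (hg i h0)
  simpa [mul_assoc] using this

theorem Conformal.ne_zero {n : ℕ} {g h : Fin n → ℝ} (hg : Conformal g h) {i : Fin n}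
    (hi : g i ≠ 0) : h i ≠ 0 := by
  intro h0
  have := hg i hi
  simp [h0] at this

theorem Conformal.pos {n : ℕ} {g h : Fin n → ℝ} (hg : Conformal g h) {i : Fin n}
    (hi : 0 < g i) : 0 < h i :=
  pos_of_mul_pos_right (hg i hi.ne') hi.le

theorem Conformal.neg {n : ℕ} {g h : Fin n → ℝ} (hg : Conformal g h) {i : Fin n}
    (hi : g i < 0) : h i < 0 := by
  have := hg i hi.ne
  nlinarith

theorem IsElementary.smul {m n : ℕ} {A : Matrix (Fin m) (Fin n) ℝ} {g : Fin n → ℝ}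
    (hg : IsElementary A g) {r : ℝ} (hr : r ≠ 0) : IsElementary A (r • g) := by
  obtain ⟨h1, h2, h3⟩ := hg
  refine ⟨by rw [Matrix.mulVec_smul, h1, smul_zero], smul_ne_zero hr h2, ?_⟩
  rw [Function.support_const_smul_of_ne_zero r g hr]
  exact h3

/-- Subtracting the largest multiple of a vector that keeps the signs. -/
theorem exists_conformal_sub {n : ℕ} (h g : Fin n → ℝ) (hs : ∀ i, h i = 0 → g i = 0)
    (hp : ∃ i, 0 < g i * h i) :
    ∃ r : ℝ, 0 < r ∧ Conformal (h - r • g) h ∧ ∃ i, h i ≠ 0 ∧ (h - r • g) i = 0 := by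
  classical
  obtain ⟨i₁, hi₁⟩ := hp
  -- Ratio test: among the coordinates where `g` and `h` agree in sign, the one with the smallest
  -- quotient reaches zero first; where the signs disagree, subtraction only increases the absolute
  -- value.
  obtain ⟨i₀, hi₀, hmin⟩ := (Finset.univ.filter fun i => 0 < g i * h i).exists_min_image
    (fun i => h i / g i) ⟨i₁, by simpa using hi₁⟩
  simp only [Finset.mem_filter, Finset.mem_univ, true_and] at hi₀ hmin
  have hg0 : g i₀ ≠ 0 := by
    intro h0
    simp [h0] at hi₀
  have hh0 : h i₀ ≠ 0 := by
    intro h0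
    simp [h0] at hi₀
  have hr : 0 < h i₀ / g i₀ := by
    have : h i₀ / g i₀ = (g i₀ * h i₀) / (g i₀ * g i₀) := by field_simp
    rw [this]
    exact div_pos hi₀ (mul_self_pos.2 hg0)
  refine ⟨h i₀ / g i₀, hr, ?_, i₀, hh0, ?_⟩
  · intro i hi
    have hhi : h i ≠ 0 := by
      intro h0
      simp [h0, hs i h0] at hi
    have hnn : 0 ≤ (h - (h i₀ / g i₀) • g) i * h i := by
      simp only [Pi.sub_apply, Pi.smul_apply, smul_eq_mul]
      rcases lt_or_ge 0 (g i * h i) with hpos | hneg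
      · have h1 := hmin i hpos
        have hgi : g i ≠ 0 := by
          intro h0
          simp [h0] at hpos
        have h2 : (h i - h i₀ / g i₀ * g i) * h i = (h i / g i - h i₀ / g i₀) * (g i * h i) := by
          field_simp
        rw [h2]
        exact mul_nonneg (sub_nonneg.2 h1) hpos.le
      · nlinarith [mul_self_nonneg (h i), mul_nonneg hr.le (neg_nonneg.2 hneg)]
    exact lt_of_le_of_ne hnn (mul_ne_zero hi hhi).symm
  · simp [hg0]

theorem support_ncard_lt {n : ℕ} {g h : Fin n → ℝ} (hg : Conformal g h)
    (hz : ∃ i, h i ≠ 0 ∧ g i = 0) :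
    (Function.support g).ncard < (Function.support h).ncard := by
  obtain ⟨i, hi, hgi⟩ := hz
  refine Set.ncard_lt_ncard ⟨fun j hj => hg.ne_zero hj, fun hsub => ?_⟩ (Set.toFinite _)
  exact hsub (show i ∈ Function.support h from hi) hgi

/-- Induction on the support. If `h` is not elementary, subtracting a multiple of a kernel vector of
smaller support removes a coordinate of `h` and keeps the signs of the rest. -/
theorem exists_elementary_conformal {m n : ℕ} (A : Matrix (Fin m) (Fin n) ℝ) (k : ℕ) :
    ∀ h : Fin n → ℝ, A *ᵥ h = 0 → h ≠ 0 → (Function.support h).ncard ≤ k →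
      ∃ g, IsElementary A g ∧ Conformal g h := by
  induction k with
  | zero =>
    intro h _ hne hk
    exfalso
    have h0 : Function.support h = ∅ := by
      rwa [Nat.le_zero, Set.ncard_eq_zero (Set.toFinite _)] at hk
    exact hne (Function.support_eq_empty_iff.1 h0)
  | succ k ih =>
    intro h hA hne hk
    by_cases hel : IsElementary A h
    · exact ⟨h, hel, Conformal.refl h⟩
    have : ∃ g : Fin n → ℝ, A *ᵥ g = 0 ∧ g ≠ 0 ∧ Function.support g ⊂ Function.support h := by
      by_contra hcon
      push Not at hcon
      exact hel ⟨hA, hne, hcon⟩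
    obtain ⟨g₀, hg₀A, hg₀ne, hg₀s⟩ := this
    -- A change of sign makes `g₀` agree in sign with `h` somewhere, so that the ratio test applies.
    have : ∃ g : Fin n → ℝ, A *ᵥ g = 0 ∧ Function.support g ⊂ Function.support h ∧
        ∃ i, 0 < g i * h i := by
      obtain ⟨i, hi⟩ := Function.ne_iff.1 hg₀ne
      have hhi : h i ≠ 0 := hg₀s.1 hi
      rcases lt_or_gt_of_ne (mul_ne_zero hi hhi) with hlt | hgt
      · refine ⟨-g₀, by rw [Matrix.mulVec_neg, hg₀A, neg_zero], by rwa [Function.support_neg],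
          i, ?_⟩
        simpa using hlt
      · exact ⟨g₀, hg₀A, hg₀s, i, hgt⟩
    obtain ⟨g, hgA, hgs, hgp⟩ := this
    obtain ⟨r, hr, hconf, hz⟩ := exists_conformal_sub h g
      (fun i hi => by
        by_contra hgi
        exact hgs.1 hgi hi) hgp
    have hlt := support_ncard_lt hconf hz
    -- A coordinate of `h` outside the support of `g` survives.
    have hne' : h - r • g ≠ 0 := by
      obtain ⟨i, hi, hi'⟩ := Set.exists_of_ssubset hgs
      intro h0
      have := congrFun h0 i
      have hgi : g i = 0 := by simpa using hi'
      simp [hgi] at this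
      exact hi this
    obtain ⟨g', hg', hc⟩ := ih (h - r • g)
      (by rw [Matrix.mulVec_sub, Matrix.mulVec_smul, hgA, hA, smul_zero, sub_zero]) hne' (by omega)
    exact ⟨g', hg', hc.trans hconf⟩

/-- Every vector of the kernel is a conformal sum of at most `n` elementary vectors. -/
theorem exists_conformal_decomposition_aux {m n : ℕ} (A : Matrix (Fin m) (Fin n) ℝ) (k : ℕ) :
    ∀ h : Fin n → ℝ, A *ᵥ h = 0 → (Function.support h).ncard ≤ k →
      ∃ (l : ℕ) (G : Fin l → Fin n → ℝ), l ≤ k ∧ (∀ t, IsElementary A (G t) ∧ Conformal (G t) h) ∧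
        ∑ t, G t = h := by
  induction k with
  | zero =>
    intro h _ hk
    have h0 : Function.support h = ∅ := by
      rwa [Nat.le_zero, Set.ncard_eq_zero (Set.toFinite _)] at hk
    exact ⟨0, Fin.elim0, le_rfl, fun t => t.elim0,
      by simpa using (Function.support_eq_empty_iff.1 h0).symm⟩
  | succ k ih =>
    intro h hA hk
    by_cases hne : h = 0
    · exact ⟨0, Fin.elim0, by omega, fun t => t.elim0, by simpa using hne.symm⟩
    obtain ⟨g, hg, hc⟩ := exists_elementary_conformal A _ h hA hne le_rfl
    obtain ⟨i, hi⟩ := Function.ne_iff.1 hg.2.1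
    obtain ⟨r, hr, hconf, hz⟩ := exists_conformal_sub h g
      (fun i hi => by
        by_contra hgi
        exact hc.ne_zero hgi hi) ⟨i, hc i hi⟩
    have hlt := support_ncard_lt hconf hz
    obtain ⟨l, G, hl, hG, hsum⟩ := ih (h - r • g)
      (by rw [Matrix.mulVec_sub, Matrix.mulVec_smul, hg.1, hA, smul_zero, sub_zero]) (by omega)
    refine ⟨l + 1, Fin.cons (r • g) G, by omega, ?_, ?_⟩
    · intro t
      refine Fin.cases ?_ (fun t => ?_) t
      · exact ⟨hg.smul hr.ne', hc.smul_left hr⟩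
      · exact ⟨(hG t).1, (hG t).2.trans hconf⟩
    · simp [Fin.sum_univ_succ, hsum]

theorem exists_conformal_decomposition {m n : ℕ} (A : Matrix (Fin m) (Fin n) ℝ) (h : Fin n → ℝ)
    (hA : A *ᵥ h = 0) :
    ∃ (l : ℕ) (G : Fin l → Fin n → ℝ), l ≤ n ∧ (∀ t, IsElementary A (G t) ∧ Conformal (G t) h) ∧
      ∑ t, G t = h := by
  refine exists_conformal_decomposition_aux A n h hA ?_
  calc (Function.support h).ncard ≤ (Set.univ : Set (Fin n)).ncard :=
        Set.ncard_le_ncard (Set.subset_univ _) (Set.toFinite _)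
    _ = n := by rw [Set.ncard_univ, Nat.card_eq_fintype_card, Fintype.card_fin]

/-- In a conformal sum the terms at a coordinate have one sign, so absolute values add up without
cancellation. -/
theorem Conformal.abs_le_of_sum {n l : ℕ} {G : Fin l → Fin n → ℝ} {h : Fin n → ℝ}
    (hG : ∀ t, Conformal (G t) h) (hsum : ∑ t, G t = h) (t : Fin l) (i : Fin n) :
    |G t i| ≤ |h i| := by
  have hsi : ∑ t, G t i = h i := by rw [← hsum, Finset.sum_apply]
  have hsame : |h i| = ∑ t, |G t i| := by
    rcases lt_trichotomy (h i) 0 with hh | hh | hh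
    · rw [abs_of_neg hh, ← hsi, ← Finset.sum_neg_distrib]
      refine Finset.sum_congr rfl fun s _ => (abs_of_nonpos ?_).symm
      by_contra hcon
      have := (hG s).pos (not_le.1 hcon)
      linarith
    · rw [hh, abs_zero]
      refine (Finset.sum_eq_zero fun s _ => ?_).symm
      by_contra hcon
      exact (hG s).ne_zero (abs_ne_zero.1 hcon) hh
    · rw [abs_of_pos hh, ← hsi]
      refine Finset.sum_congr rfl fun s _ => (abs_of_nonneg ?_).symm
      by_contra hcon
      have := (hG s).neg (not_le.1 hcon)
      linarith
  rw [hsame]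
  exact Finset.single_le_sum (f := fun s => |G s i|) (fun s _ => abs_nonneg _) (Finset.mem_univ t)

/-- A kernel vector has a conformal elementary vector that is large at a given coordinate. -/
theorem exists_elementary_large {m n : ℕ} (A : Matrix (Fin m) (Fin n) ℝ) (h : Fin n → ℝ)
    (hA : A *ᵥ h = 0) (j : Fin n) (hj : h j ≠ 0) :
    ∃ g, IsElementary A g ∧ Conformal g h ∧ (∀ i, |g i| ≤ |h i|) ∧ |h j| ≤ n * |g j| := by
  obtain ⟨l, G, hl, hG, hsum⟩ := exists_conformal_decomposition A h hA
  by_contra hcon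
  push Not at hcon
  -- At most `n` summands, each below `|h j| / n` at `j`, cannot add up to `h j`.
  have hsmall : ∀ t, n * |G t j| < |h j| := fun t => hcon (G t) (hG t).1 (hG t).2
    (fun i => Conformal.abs_le_of_sum (fun t => (hG t).2) hsum t i)
  have hsj : h j = ∑ t, G t j := by rw [← hsum, Finset.sum_apply]
  have hn : 0 < (n : ℝ) := by
    have := j.pos
    exact_mod_cast this
  have hlpos : (Finset.univ : Finset (Fin l)).Nonempty := by
    by_contra hemp
    rw [Finset.not_nonempty_iff_eq_empty] at hemp
    rw [hsj, hemp, Finset.sum_empty] at hj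
    exact hj rfl
  have h1 : |h j| ≤ ∑ t, |G t j| := by
    rw [hsj]
    exact Finset.abs_sum_le_sum_abs _ _
  have h2 : ∑ t, |G t j| < ∑ _t : Fin l, |h j| / n :=
    Finset.sum_lt_sum_of_nonempty hlpos fun t _ => by
      rw [lt_div_iff₀ hn]
      linarith [hsmall t]
  have h3 : ∑ _t : Fin l, |h j| / n ≤ |h j| := by
    rw [Finset.sum_const, Finset.card_univ, Fintype.card_fin, nsmul_eq_mul]
    have : (l : ℝ) ≤ n := by exact_mod_cast hl
    calc (l : ℝ) * (|h j| / n) ≤ n * (|h j| / n) := by gcongr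
      _ = |h j| := by field_simp
  linarith

/-- The multiple of `g` that matches `h` at one coordinate leaves a difference of strictly smaller
support, which is zero by minimality. -/
theorem IsElementary.proportional {m n : ℕ} {A : Matrix (Fin m) (Fin n) ℝ} {g h : Fin n → ℝ}
    (hg : IsElementary A g) (hh : IsElementary A h)
    (hs : Function.support g = Function.support h) : ∃ r : ℝ, r ≠ 0 ∧ h = r • g := by
  obtain ⟨i, hi⟩ := Function.ne_iff.1 hg.2.1
  have hgi : g i ≠ 0 := hi
  have hhi : h i ≠ 0 := by
    have : i ∈ Function.support h := hs ▸ (show i ∈ Function.support g from hgi)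
    exact this
  refine ⟨h i / g i, div_ne_zero hhi hgi, ?_⟩
  by_contra hne
  refine hg.2.2 (h - (h i / g i) • g)
    (by rw [Matrix.mulVec_sub, Matrix.mulVec_smul, hg.1, hh.1, smul_zero, sub_zero])
    (sub_ne_zero.2 hne) ⟨fun j hj => ?_, fun hsub => ?_⟩
  · by_contra hgj
    have hgj0 : g j = 0 := by simpa using hgj
    have hhj0 : h j = 0 := by
      have : j ∉ Function.support h := hs ▸ hgj
      simpa using this
    simp [hgj0, hhj0] at hj
  · have := hsub (show i ∈ Function.support g from hgi)
    simp [hgi] at this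

/-- Elementary vectors with equal supports are proportional and have the same ratios, so one
representative `rep` per support shows that there are finitely many ratios. Without boundedness the
supremum would be a junk value. -/
theorem bddAbove_imbalance {m n : ℕ} (A : Matrix (Fin m) (Fin n) ℝ) :
    BddAbove (insert 1 {r : ℝ | ∃ g : Fin n → ℝ, IsElementary A g ∧
      ∃ i ∈ Function.support g, ∃ j ∈ Function.support g, r = |g i| / |g j|}) := by
  classical
  rw [bddAbove_insert]
  let rep : Set (Fin n) → Fin n → ℝ := fun S =>
    if h : ∃ g, IsElementary A g ∧ Function.support g = S then h.choose else 0
  refine Set.Finite.bddAbove (Set.Finite.subset (Set.finite_range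
    fun p : Set (Fin n) × Fin n × Fin n => |rep p.1 p.2.1| / |rep p.1 p.2.2|) ?_)
  rintro r ⟨g, hg, i, hi, j, hj, rfl⟩
  have hex : ∃ g', IsElementary A g' ∧ Function.support g' = Function.support g := ⟨g, hg, rfl⟩
  have hrep : rep (Function.support g) = hex.choose := dif_pos hex
  obtain ⟨t, ht, hgt⟩ := hex.choose_spec.1.proportional hg hex.choose_spec.2
  refine ⟨(Function.support g, i, j), ?_⟩
  simp only [hrep]
  have hgi : g i = t * hex.choose i := congrFun hgt i
  have hgj : g j = t * hex.choose j := congrFun hgt j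
  rw [hgi, hgj, abs_mul, abs_mul, mul_div_mul_left _ _ (abs_ne_zero.2 ht)]

theorem one_le_circuitImbalance {m n : ℕ} (A : Matrix (Fin m) (Fin n) ℝ) :
    1 ≤ circuitImbalance A :=
  le_csSup (bddAbove_imbalance A) (Set.mem_insert _ _)

/-- Together with `1 ≤ κ`, this is the only property of the imbalance that the later estimates use.
-/
theorem IsElementary.abs_le {m n : ℕ} {A : Matrix (Fin m) (Fin n) ℝ} {g : Fin n → ℝ}
    (hg : IsElementary A g) (i : Fin n) {j : Fin n} (hj : g j ≠ 0) :
    |g i| ≤ circuitImbalance A * |g j| := by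
  by_cases hi : g i = 0
  · rw [hi, abs_zero]
    exact mul_nonneg (zero_le_one.trans (one_le_circuitImbalance A)) (abs_nonneg _)
  · rw [← div_le_iff₀ (abs_pos.2 hj)]
    exact le_csSup (bddAbove_imbalance A)
      (Set.mem_insert_of_mem _ ⟨g, hg, i, hi, j, hj, rfl⟩)

/-! ### Consequences of the correctness of the ratio oracle -/

/-- Extended weights encoded by a real vector: a negative entry stands for `∞`. -/
noncomputable def weightsOf {n : ℕ} (v : Fin n → ℝ) : Fin n → ℝ≥0∞ :=
  fun j => if v j < 0 then ∞ else ENNReal.ofReal (v j)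

/-- The vector that encodes the weights `1 / x`. -/
noncomputable def invWeights {n : ℕ} (x : Fin n → ℝ) : Fin n → ℝ :=
  fun j => 1 / x j + (x j / x j - 1)

/-- Replaces the extended-real constraint by real ones: negative codes force a sign, the others
contribute to an ordinary sum. -/
theorem ratioFeasible_weightsOf {m n : ℕ} (A : Matrix (Fin m) (Fin n) ℝ) (F : Set (Fin n))
    (v z : Fin n → ℝ) :
    RatioFeasible A F (weightsOf v) z ↔ A *ᵥ z = 0 ∧ (∀ j, j ∉ F → z j = 0) ∧
      (∀ j, v j < 0 → 0 ≤ z j) ∧ ∑ j, max 0 (v j) * max 0 (-z j) ≤ 1 := by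
  unfold RatioFeasible
  refine and_congr_right fun _ => and_congr_right fun _ => ?_
  have key : (∀ j, v j < 0 → 0 ≤ z j) →
      ∑ j, weightsOf v j * ENNReal.ofReal (max 0 (-z j)) =
        ENNReal.ofReal (∑ j, max 0 (v j) * max 0 (-z j)) := by
    intro h
    rw [ENNReal.ofReal_sum_of_nonneg fun j _ => mul_nonneg (le_max_left _ _) (le_max_left _ _)]
    refine Finset.sum_congr rfl fun j _ => ?_
    unfold weightsOf
    split_ifs with hv
    · have := h j hv
      rw [max_eq_left (by linarith : -z j ≤ 0)]
      simp
    · rw [max_eq_right (not_lt.1 hv), ENNReal.ofReal_mul (not_lt.1 hv)]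
  constructor
  · intro h
    have hv : ∀ j, v j < 0 → 0 ≤ z j := by
      intro j hj
      by_contra hz
      have h1 : weightsOf v j * ENNReal.ofReal (max 0 (-z j)) ≤ 1 :=
        (Finset.single_le_sum (f := fun j => weightsOf v j * ENNReal.ofReal (max 0 (-z j)))
          (fun _ _ => zero_le) (Finset.mem_univ j)).trans h
      have h2 : ENNReal.ofReal (max 0 (-z j)) ≠ 0 := by
        rw [Ne, ENNReal.ofReal_eq_zero, not_le]
        exact lt_max_of_lt_right (by linarith)
      have h3 : weightsOf v j = ∞ := if_pos hj
      rw [h3, ENNReal.top_mul h2] at h1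
      exact absurd h1 (by simp)
    refine ⟨hv, ?_⟩
    rw [key hv] at h
    exact ENNReal.ofReal_le_one.1 h
  · rintro ⟨hv, h⟩
    rw [key hv]
    exact ENNReal.ofReal_le_one.2 h

theorem dotProduct_transpose_mulVec_eq_zero {m n : ℕ} {A : Matrix (Fin m) (Fin n) ℝ}
    {z : Fin n → ℝ} (hz : A *ᵥ z = 0) (y : Fin m → ℝ) : (Aᵀ *ᵥ y) ⬝ᵥ z = 0 := by
  rw [Matrix.mulVec_transpose, ← Matrix.dotProduct_mulVec, hz, dotProduct_zero]

/-- Costs that differ by an element of the row space agree on the kernel. -/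
theorem dotProduct_eq_of_rowSpace {m n : ℕ} {A : Matrix (Fin m) (Fin n) ℝ} {F : Set (Fin n)}
    {z c e : Fin n → ℝ} {y : Fin m → ℝ} (hz : A *ᵥ z = 0) (hF : ∀ j, j ∉ F → z j = 0)
    (h : ∀ j ∈ F, c j = e j + (Aᵀ *ᵥ y) j) : c ⬝ᵥ z = e ⬝ᵥ z := by
  have h1 : c ⬝ᵥ z = (e + Aᵀ *ᵥ y) ⬝ᵥ z := by
    unfold dotProduct
    refine Finset.sum_congr rfl fun j _ => ?_
    by_cases hj : j ∈ F
    · rw [h j hj, Pi.add_apply]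
    · rw [hF j hj, mul_zero, mul_zero]
  rw [h1, add_dotProduct, dotProduct_transpose_mulVec_eq_zero hz, add_zero]

/-- If the cost is equivalent to a nonnegative one, the minimum-ratio system is bounded. -/
theorem IsRatioOracle.exists_eq_some {m n : ℕ} {A : Matrix (Fin m) (Fin n) ℝ}
    {R : RatioOracle m n} (hR : IsRatioOracle A R) (F : Set (Fin n)) (c v : Fin n → ℝ)
    (hv : ∀ j ∈ F, v j ≠ 0) (y : Fin m → ℝ) (s : Fin n → ℝ) (hs : ∀ j ∈ F, 0 ≤ s j)
    (hc : ∀ j ∈ F, c j = s j + (Aᵀ *ᵥ y) j) : ∃ r, R F c (weightsOf v) = some r := by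
  rw [← Option.ne_none_iff_exists']
  intro hnone
  -- A negative entry `z j` with `j ∈ F` has a positive finite weight, so `z j ≥ -1 / v j`. Summing
  -- against `s ≥ 0` gives this lower bound; zero weights are excluded because they would not limit
  -- `z j`.
  obtain ⟨z, hz, hlt⟩ := (hR F c (weightsOf v)).1 hnone (-∑ j, |s j| / |v j|)
  rw [ratioFeasible_weightsOf] at hz
  obtain ⟨hA, hF, hz0, hsum⟩ := hz
  rw [dotProduct_eq_of_rowSpace hA hF hc] at hlt
  have : -∑ j, |s j| / |v j| ≤ s ⬝ᵥ z := by
    rw [← Finset.sum_neg_distrib]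
    refine Finset.sum_le_sum fun j _ => ?_
    have hnn : 0 ≤ |s j| / |v j| := by positivity
    by_cases hj : j ∈ F
    · have hsj := hs j hj
      rcases le_or_gt 0 (z j) with h0 | h0
      · have := mul_nonneg hsj h0
        linarith
      · have hvp : 0 < v j := by
          rcases lt_or_gt_of_ne (hv j hj) with h | h
          · exact absurd (hz0 j h) (not_le.2 h0)
          · exact h
        have h1 : max 0 (v j) * max 0 (-z j) ≤ 1 :=
          (Finset.single_le_sum (f := fun j => max 0 (v j) * max 0 (-z j))
            (fun j _ => mul_nonneg (le_max_left _ _) (le_max_left _ _))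
            (Finset.mem_univ j)).trans hsum
        rw [max_eq_right hvp.le, max_eq_right (by linarith)] at h1
        have h2 : -z j ≤ 1 / v j := by
          rw [le_div_iff₀ hvp]
          linarith
        rw [abs_of_nonneg hsj, abs_of_pos hvp]
        have h3 := mul_le_mul_of_nonneg_left h2 hsj
        have h4 : s j / v j = s j * (1 / v j) := by ring
        rw [h4]
        linarith
    · rw [hF j hj, mul_zero]
      linarith
  linarith

/-- Strong duality for minimum-ratio systems with finite positive weights. -/
theorem exists_dual_of_bound {m n : ℕ} (A : Matrix (Fin m) (Fin n) ℝ) (F : Set (Fin n))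
    (c v : Fin n → ℝ) (hv : ∀ j, 0 < v j) (μ : ℝ) (hμ : 0 ≤ μ)
    (hb : ∀ z, RatioFeasible A F (weightsOf v) z → -μ ≤ c ⬝ᵥ z) :
    ∃ y : Fin m → ℝ, ∀ j ∈ F, 0 ≤ c j + (Aᵀ *ᵥ y) j ∧ c j + (Aᵀ *ᵥ y) j ≤ μ * v j := by
  classical
  by_contra hcon
  push Not at hcon
  -- The dual system is solvable exactly if the translate `c + W` of the row space meets this box;
  -- otherwise a compact and a closed convex set are strictly separated. `W` is unrestricted outside
  -- `F`, so the separating functional vanishes there.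
  let box : Set (Fin n → ℝ) := Set.Icc 0 (fun j => if j ∈ F then μ * v j else 0)
  let W : Submodule ℝ (Fin n → ℝ) :=
    { carrier := {u | ∃ y : Fin m → ℝ, ∀ j ∈ F, u j = (Aᵀ *ᵥ y) j}
      add_mem' := by
        rintro u u' ⟨y, hy⟩ ⟨y', hy'⟩
        exact ⟨y + y', fun j hj => by
          rw [Matrix.mulVec_add, Pi.add_apply, Pi.add_apply, hy j hj, hy' j hj]⟩
      zero_mem' := ⟨0, fun j _ => by simp⟩
      smul_mem' := by
        rintro r u ⟨y, hy⟩
        exact ⟨r • y, fun j hj => by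
          rw [Matrix.mulVec_smul, Pi.smul_apply, Pi.smul_apply, hy j hj]⟩ }
  let t : Set (Fin n → ℝ) := (fun u => c + u) '' (W : Set (Fin n → ℝ))
  have htconv : Convex ℝ t := W.convex.translate c
  have htclosed : IsClosed t :=
    (Homeomorph.addLeft c).isClosedMap _ W.closed_of_finiteDimensional
  have hdisj : Disjoint box t := by
    rw [Set.disjoint_left]
    rintro s ⟨hs0, hs1⟩ ⟨u, ⟨y, hy⟩, rfl⟩
    obtain ⟨j, hj, hj'⟩ := hcon y
    have h0 := hs0 j
    have h1 := hs1 j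
    simp only [Pi.zero_apply, Pi.add_apply, hy j hj, hj, if_true] at h0 h1
    linarith [hj' h0]
  obtain ⟨f, α, β, hα, hαβ, hβ⟩ := geometric_hahn_banach_compact_closed
    (convex_Icc _ _) (isCompact_Icc) htconv htclosed hdisj
  let z : Fin n → ℝ := fun j => f (Pi.single j 1)
  have hf : ∀ u, f u = z ⬝ᵥ u := by
    intro u
    have : u = ∑ j, u j • (Pi.single j (1 : ℝ) : Fin n → ℝ) := by
      simpa using pi_eq_sum_univ' u
    conv_lhs => rw [this]
    rw [map_sum]
    simp only [map_smul, smul_eq_mul, dotProduct]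
    exact Finset.sum_congr rfl fun j _ => mul_comm _ _
  have hW : ∀ u ∈ W, z ⬝ᵥ u = 0 := by
    intro u hu
    by_contra hne
    -- A nonzero value on `W` could be scaled until the functional equals `β - 1` on the translate.
    have h1 := hβ (c + ((β - z ⬝ᵥ c - 1) / (z ⬝ᵥ u)) • u) ⟨_, W.smul_mem _ hu, rfl⟩
    rw [hf, dotProduct_add, dotProduct_smul, smul_eq_mul, div_mul_cancel₀ _ hne] at h1
    linarith
  have hzF : ∀ j, j ∉ F → z j = 0 := by
    intro j hj
    have hmem : (Pi.single j 1 : Fin n → ℝ) ∈ W := by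
      refine ⟨0, fun i hi => ?_⟩
      have : i ≠ j := fun h => hj (h ▸ hi)
      simp [Pi.single_eq_of_ne this]
    have := hW _ hmem
    rwa [dotProduct_single, mul_one] at this
  have hzA : A *ᵥ z = 0 := by
    funext i
    have hmem : Aᵀ *ᵥ (Pi.single i 1) ∈ W := ⟨Pi.single i 1, fun j _ => rfl⟩
    have := hW _ hmem
    rw [Matrix.mulVec_single_one] at this
    rw [Pi.zero_apply, ← this, dotProduct_comm]
    rfl
  have hzc : α < z ⬝ᵥ c := by
    have := hβ (c + 0) ⟨0, W.zero_mem, rfl⟩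
    rw [add_zero, hf] at this
    linarith
  have hbox : ∑ j, μ * (v j * max 0 (z j)) < z ⬝ᵥ c := by
    -- The corner of the box at which the functional is largest.
    have h1 := hα (fun j => if 0 < z j then (if j ∈ F then μ * v j else 0) else 0) (by
      constructor
      · intro j
        have := mul_nonneg hμ (hv j).le
        simp only [Pi.zero_apply]
        split_ifs <;> simp [this]
      · intro j
        have := mul_nonneg hμ (hv j).le
        simp only
        split_ifs <;> simp [this])
    rw [hf] at h1
    refine lt_of_le_of_lt (le_of_eq ?_) (h1.trans hzc)
    refine Finset.sum_congr rfl fun j _ => ?_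
    change μ * (v j * max 0 (z j)) = z j * (if 0 < z j then (if j ∈ F then μ * v j else 0) else 0)
    by_cases hj : 0 < z j
    · have hjF : j ∈ F := by
        by_contra h
        rw [hzF j h] at hj
        exact lt_irrefl _ hj
      rw [if_pos hj, if_pos hjF, max_eq_right hj.le]
      ring
    · rw [if_neg hj, max_eq_left (not_lt.1 hj)]
      ring
  set N := ∑ j, v j * max 0 (z j) with hN
  have hN0 : 0 ≤ N := Finset.sum_nonneg fun j _ => mul_nonneg (hv j).le (le_max_left _ _)
  rw [← Finset.mul_sum, ← hN] at hbox
  have hfeas : ∀ r : ℝ, 0 ≤ r → r * N ≤ 1 → -μ ≤ c ⬝ᵥ (-(r • z)) := by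
    intro r hr hrN
    refine hb _ ?_
    rw [ratioFeasible_weightsOf]
    refine ⟨by rw [Matrix.mulVec_neg, Matrix.mulVec_smul, hzA, smul_zero, neg_zero],
      fun j hj => by simp [hzF j hj], fun j hj => absurd hj (not_lt.2 (hv j).le), ?_⟩
    refine le_trans (le_of_eq ?_) hrN
    rw [hN, Finset.mul_sum]
    refine Finset.sum_congr rfl fun j _ => ?_
    rw [max_eq_right (hv j).le, Pi.neg_apply, neg_neg, Pi.smul_apply, smul_eq_mul]
    have : max 0 (r * z j) = r * max 0 (z j) := by
      rw [mul_max_of_nonneg _ _ hr, mul_zero]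
    rw [this]
    ring
  have hval : ∀ r : ℝ, c ⬝ᵥ (-(r • z)) = -(r * (z ⬝ᵥ c)) := by
    intro r
    rw [dotProduct_neg, dotProduct_smul, smul_eq_mul, dotProduct_comm]
  -- `N` is the weight consumed by `-z`. If it is zero, arbitrary multiples of `-z` are feasible;
  -- otherwise the multiple `1 / N` violates the bound.
  rcases hN0.eq_or_lt with h0 | h0
  · rw [← h0, mul_zero] at hbox
    have h1 := hfeas ((μ + 1) / (z ⬝ᵥ c)) (by positivity) (by rw [← h0]; simp)
    rw [hval, div_mul_cancel₀ _ hbox.ne'] at h1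
    linarith
  · have h1 := hfeas (1 / N) (by positivity) (by rw [one_div_mul_cancel h0.ne'])
    rw [hval] at h1
    have h2 : 1 / N * (z ⬝ᵥ c) ≤ μ := by linarith
    rw [one_div_mul_eq_div, div_le_iff₀ h0] at h2
    linarith

/-! ### Minimum-ratio systems with weights `1 / x`. -/

theorem invWeights_neg_iff {n : ℕ} {x : Fin n → ℝ} (hx : ∀ j, 0 ≤ x j) (j : Fin n) :
    invWeights x j < 0 ↔ x j = 0 := by
  unfold invWeights
  constructor
  · intro h
    by_contra hne
    have hpos : 0 < x j := lt_of_le_of_ne (hx j) (Ne.symm hne)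
    rw [div_self hne] at h
    have : 0 < 1 / x j := by positivity
    linarith
  · intro h
    simp [h]

theorem max_invWeights {n : ℕ} {x : Fin n → ℝ} (hx : ∀ j, 0 ≤ x j) (j : Fin n) :
    max 0 (invWeights x j) = 1 / x j := by
  unfold invWeights
  by_cases h : x j = 0
  · simp [h]
  · have hpos : 0 < x j := lt_of_le_of_ne (hx j) (Ne.symm h)
    rw [div_self h, sub_self, add_zero, max_eq_right (by positivity)]

theorem invWeights_ne_zero {n : ℕ} {x : Fin n → ℝ} (hx : ∀ j, 0 ≤ x j) (j : Fin n) :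
    invWeights x j ≠ 0 := by
  unfold invWeights
  by_cases h : x j = 0
  · simp [h]
  · have hpos : 0 < x j := lt_of_le_of_ne (hx j) (Ne.symm h)
    rw [div_self h, sub_self, add_zero]
    positivity

/-- Feasibility for the minimum-ratio system with weights `1 / x`. -/
theorem ratioFeasible_inv {m n : ℕ} (A : Matrix (Fin m) (Fin n) ℝ) (F : Set (Fin n))
    {x : Fin n → ℝ} (hx : ∀ j, 0 ≤ x j) (z : Fin n → ℝ) :
    RatioFeasible A F (weightsOf (invWeights x)) z ↔ A *ᵥ z = 0 ∧ (∀ j, j ∉ F → z j = 0) ∧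
      (∀ j, x j = 0 → 0 ≤ z j) ∧ ∑ j, 1 / x j * max 0 (-z j) ≤ 1 := by
  rw [ratioFeasible_weightsOf]
  simp only [invWeights_neg_iff hx, max_invWeights hx]

/-- A single term of the weight constraint already bounds each decrease by the current value, so a
step of length one stays feasible. -/
theorem neg_le_of_ratioFeasible_inv {m n : ℕ} {A : Matrix (Fin m) (Fin n) ℝ} {F : Set (Fin n)}
    {x : Fin n → ℝ} (hx : ∀ j, 0 ≤ x j) {z : Fin n → ℝ}
    (hz : RatioFeasible A F (weightsOf (invWeights x)) z) (j : Fin n) : -z j ≤ x j := by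
  rw [ratioFeasible_inv A F hx] at hz
  obtain ⟨-, -, h0, hsum⟩ := hz
  rcases (hx j).eq_or_lt with h | h
  · have := h0 j h.symm
    linarith
  · have h1 : 1 / x j * max 0 (-z j) ≤ 1 :=
      (Finset.single_le_sum (f := fun j => 1 / x j * max 0 (-z j))
        (fun j _ => mul_nonneg (by have := hx j; positivity) (le_max_left _ _))
        (Finset.mem_univ j)).trans hsum
    rw [one_div_mul_eq_div, div_le_iff₀ h, one_mul] at h1
    exact (le_max_right _ _).trans h1

/-- The maximal step along an improving answer of the ratio oracle. -/
theorem exists_maxStep {m n : ℕ} (P : LP m n) {F : Set (Fin n)} {x d z : Fin n → ℝ}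
    (hx : P.Feasible x) (hd : ∀ j ∈ F, 0 ≤ d j)
    (hz : RatioFeasible P.A F (weightsOf (invWeights x)) z) (hneg : d ⬝ᵥ z < 0) :
    ∃ α, 1 ≤ α ∧ P.IsMaxStep x z α ∧ (∃ i, x i ≠ 0 ∧ (x + α • z) i = 0) ∧
      ∃ j, 0 < d j ∧ z j < 0 := by
  classical
  have hle := neg_le_of_ratioFeasible_inv hx.2 hz
  have hz' := (ratioFeasible_inv P.A F hx.2 z).1 hz
  obtain ⟨hA, hF, h0, -⟩ := hz'
  have hj : ∃ j, 0 < d j ∧ z j < 0 := by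
    by_contra hcon
    push Not at hcon
    refine absurd hneg (not_lt.2 (Finset.sum_nonneg fun j _ => ?_))
    by_cases hjF : j ∈ F
    · rcases (hd j hjF).eq_or_lt with h | h
      · rw [← h, zero_mul]
      · exact mul_nonneg h.le (hcon j h)
    · rw [hF j hjF, mul_zero]
  obtain ⟨j₀, hdj, hzj⟩ := hj
  -- The first coordinate to reach zero determines the step; `-z i ≤ x i` makes its length at least
  -- one.
  obtain ⟨i, hi, hmin⟩ := (Finset.univ.filter fun i => z i < 0).exists_min_image
    (fun i => x i / (-z i)) ⟨j₀, by simpa using hzj⟩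
  simp only [Finset.mem_filter, Finset.mem_univ, true_and] at hi hmin
  have hzi : 0 < -z i := by linarith
  have hα1 : 1 ≤ x i / (-z i) := by
    rw [le_div_iff₀ hzi, one_mul]
    exact hle i
  have hval : x i + x i / (-z i) * z i = 0 := by
    have := hi.ne
    rw [div_neg, neg_mul, div_mul_cancel₀ _ this, add_neg_cancel]
  refine ⟨x i / (-z i), hα1, ⟨by linarith, ⟨?_, ?_⟩, ?_⟩, ⟨i, ?_, ?_⟩, j₀, hdj, hzj⟩
  · rw [Matrix.mulVec_add, Matrix.mulVec_smul, hA, smul_zero, add_zero, hx.1]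
  · intro j
    simp only [Pi.add_apply, Pi.smul_apply, smul_eq_mul]
    rcases lt_or_ge (z j) 0 with h | h
    · have h1 := hmin j h
      rw [le_div_iff₀ (by linarith : 0 < -z j)] at h1
      linarith
    · have h1 := hx.2 j
      have h2 : 0 ≤ x i / (-z i) * z j := mul_nonneg (by linarith) h
      linarith
  · rintro α' hα' ⟨-, hnn⟩
    have h1 := hnn i
    simp only [Pi.add_apply, Pi.smul_apply, smul_eq_mul] at h1
    nlinarith
  · have := hle i
    exact (lt_of_lt_of_le hzi this).ne'
  · simpa using hval

/-- The optimal direction for the weights `1 / x` recovers a fraction `1 / n` of the gap. -/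
theorem ratio_gap {m n : ℕ} (P : LP m n) {F : Set (Fin n)} {x x' d z : Fin n → ℝ}
    (hn : 0 < n) (hx : P.Feasible x) (hx' : P.Feasible x') (hxF : ∀ j, j ∉ F → x' j = x j)
    (hopt : ∀ z', RatioFeasible P.A F (weightsOf (invWeights x)) z' → d ⬝ᵥ z ≤ d ⬝ᵥ z') :
    n * (d ⬝ᵥ z) ≤ d ⬝ᵥ x' - d ⬝ᵥ x := by
  have hn' : (0 : ℝ) < n := by exact_mod_cast hn
  -- No coordinate decreases from `x` by more than its value, so each coordinate of the scaled
  -- difference uses at most `1 / n` of the weight budget.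
  have h := hopt ((1 / (n : ℝ)) • (x' - x)) ?_
  · rw [dotProduct_smul, dotProduct_sub, smul_eq_mul, one_div_mul_eq_div, le_div_iff₀ hn'] at h
    linarith
  · rw [ratioFeasible_inv P.A F hx.2]
    refine ⟨by rw [Matrix.mulVec_smul, Matrix.mulVec_sub, hx.1, hx'.1, sub_self, smul_zero],
      fun j hj => by simp [hxF j hj], fun j hj => ?_, ?_⟩
    · simp only [Pi.smul_apply, Pi.sub_apply, smul_eq_mul, hj, sub_zero]
      have := hx'.2 j
      positivity
    · calc ∑ j, 1 / x j * max 0 (-((1 / (n : ℝ)) • (x' - x)) j) ≤ ∑ _j : Fin n, 1 / (n : ℝ) := by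
            refine Finset.sum_le_sum fun j _ => ?_
            have h1 := hx.2 j
            have h2 := hx'.2 j
            have h3 : max 0 (-((1 / (n : ℝ)) • (x' - x)) j) ≤ 1 / (n : ℝ) * x j := by
              refine max_le (by positivity) ?_
              simp only [Pi.smul_apply, Pi.sub_apply, smul_eq_mul]
              have : 0 ≤ 1 / (n : ℝ) * x' j := by positivity
              linarith
            rcases h1.eq_or_lt with h0 | h0
            · rw [← h0]
              simp
            · calc 1 / x j * max 0 (-((1 / (n : ℝ)) • (x' - x)) j)
                  ≤ 1 / x j * (1 / (n : ℝ) * x j) := by gcongr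
                _ = 1 / (n : ℝ) := by field_simp
        _ = 1 := by
            rw [Finset.sum_const, Finset.card_univ, Fintype.card_fin, nsmul_eq_mul]
            field_simp

/-- If no direction in the support of `x` improves `d`, then `d` vanishes on the kernel vectors
supported there. -/
theorem dotProduct_eq_zero_of_no_improvement {m n : ℕ} (P : LP m n) {x d z : Fin n → ℝ}
    (hx : P.Feasible x) (hz : 0 ≤ d ⬝ᵥ z)
    (hopt : ∀ z', RatioFeasible P.A (Function.support x) (weightsOf (invWeights x)) z' →
      d ⬝ᵥ z ≤ d ⬝ᵥ z') (h : Fin n → ℝ) (hA : P.A *ᵥ h = 0)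
    (hs : ∀ j, x j = 0 → h j = 0) : d ⬝ᵥ h = 0 := by
  have key : ∀ h : Fin n → ℝ, P.A *ᵥ h = 0 → (∀ j, x j = 0 → h j = 0) → 0 ≤ d ⬝ᵥ h := by
    intro h hA hs
    set t := ∑ j, 1 / x j * max 0 (-h j) with ht
    have ht0 : 0 ≤ t := Finset.sum_nonneg fun j _ =>
      mul_nonneg (by have := hx.2 j; positivity) (le_max_left _ _)
    -- Weights are finite on the support of `x`, so `h` becomes feasible after scaling; the summand
    -- `1` avoids a division by zero. The same applies to `-h`, which gives equality below.
    have h1 := hopt ((1 / (t + 1)) • h) ?_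
    · rw [dotProduct_smul, smul_eq_mul] at h1
      have h2 : 0 ≤ 1 / (t + 1) * (d ⬝ᵥ h) := hz.trans h1
      exact nonneg_of_mul_nonneg_right h2 (by positivity)
    · rw [ratioFeasible_inv P.A _ hx.2]
      refine ⟨by rw [Matrix.mulVec_smul, hA, smul_zero], fun j hj => ?_, fun j hj => ?_, ?_⟩
      · have : x j = 0 := by simpa using hj
        simp [hs j this]
      · simp [hs j hj]
      · have h2 : ∑ j, 1 / x j * max 0 (-((1 / (t + 1)) • h) j) = 1 / (t + 1) * t := by
          rw [ht, Finset.mul_sum]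
          refine Finset.sum_congr rfl fun j _ => ?_
          have h3 : (0 : ℝ) ≤ 1 / (t + 1) := by positivity
          have : max 0 (-((1 / (t + 1)) • h) j) = 1 / (t + 1) * max 0 (-h j) := by
            rw [mul_max_of_nonneg _ _ h3, mul_zero]
            simp
          rw [this, ← ht]
          ring
        rw [h2, one_div_mul_eq_div, div_le_one (by positivity)]
        linarith
  refine le_antisymm ?_ (key h hA hs)
  have := key (-h) (by rw [Matrix.mulVec_neg, hA, neg_zero]) (fun j hj => by simp [hs j hj])
  rw [dotProduct_neg] at this
  linarith

/-- The dual answer for weights `1 / (x + η)` at an almost optimal `x`. -/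
theorem dual_bound {m n : ℕ} (P : LP m n) {R : RatioOracle m n} (hR : IsRatioOracle P.A R)
    {F : Set (Fin n)} {x c e : Fin n → ℝ} {y : Fin m → ℝ} {η : ℝ} (hη : 0 < η)
    (hx : P.Feasible x) (hce : ∀ j ∈ F, c j = e j + (P.Aᵀ *ᵥ y) j)
    (he : ∀ j ∈ F, |e j| ≤ 1)
    (hgap : ∀ x', P.Feasible x' → (∀ j, j ∉ F → x' j = x j) → c ⬝ᵥ x - c ⬝ᵥ x' ≤ η)
    {r : RatioAnswer m n} (hr : R F c (weightsOf fun j => 1 / (x j + η)) = some r) :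
    ∀ j ∈ F, r.s j = c j + (P.Aᵀ *ᵥ r.y) j ∧ 0 ≤ r.s j ∧
      r.s j * (x j + η) ≤ 2 * n * circuitImbalance P.A * η := by
  classical
  obtain ⟨⟨hfeas, hopt⟩, hel, lam, ⟨hlam, hdual⟩, hdopt⟩ := (hR _ _ _).2 r hr
  have hv : ∀ j, 0 < 1 / (x j + η) := fun j => by have := hx.2 j; positivity
  have hκ := one_le_circuitImbalance P.A
  set κ := circuitImbalance P.A with hκdef
  have hz0 : c ⬝ᵥ r.z ≤ 0 := by
    have := hopt 0 (by
      rw [ratioFeasible_weightsOf]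
      simp)
    simpa using this
  -- Strong duality: the optimal `lam` is at most the gain `-(c ⬝ᵥ r.z)`, which remains to be
  -- bounded.
  obtain ⟨y', hy'⟩ := exists_dual_of_bound P.A F c _ hv (-(c ⬝ᵥ r.z)) (by linarith)
    (fun z hz => by rw [neg_neg]; exact hopt z hz)
  have hlam_le : lam ≤ -(c ⬝ᵥ r.z) := by
    refine hdopt y' (fun j => c j + (P.Aᵀ *ᵥ y') j) _ ⟨by linarith, fun j hj =>
      ⟨rfl, (hy' j hj).1, fun _ => ?_⟩⟩
    have hw : (weightsOf (fun j => 1 / (x j + η)) j).toReal = 1 / (x j + η) := by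
      unfold weightsOf
      rw [if_neg (not_lt.2 (hv j).le), ENNReal.toReal_ofReal (hv j).le]
    rw [hw]
    exact (hy' j hj).2
  have hn : ∀ j : Fin n, (1 : ℝ) ≤ n := fun j => by
    have := j.pos
    exact_mod_cast this
  have hlam_le' : lam ≤ 2 * n * κ * η := by
    obtain ⟨hA, hF, -, hsum⟩ := (ratioFeasible_weightsOf P.A F _ r.z).1 hfeas
    have hle : ∀ j, -r.z j ≤ x j + η := by
      intro j
      have hxj := hx.2 j
      have h1 : max 0 (1 / (x j + η)) * max 0 (-r.z j) ≤ 1 :=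
        (Finset.single_le_sum (f := fun j => max 0 (1 / (x j + η)) * max 0 (-r.z j))
          (fun j _ => mul_nonneg (le_max_left _ _) (le_max_left _ _))
          (Finset.mem_univ j)).trans hsum
      rw [max_eq_right (hv j).le, one_div_mul_eq_div, div_le_one (by positivity)] at h1
      exact (le_max_right _ _).trans h1
    rcases hel with hel | hel
    · rw [hel, dotProduct_zero, neg_zero] at hlam_le
      exact hlam_le.trans (by positivity)
    obtain ⟨i₀, -⟩ := Function.ne_iff.1 hel.2.1
    have hn1 := hn i₀
    -- If the circuit decreases a coordinate below `η`, then `|z j| ≤ 2 η`, and the imbalance bounds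
    -- all its entries by `2 κ η`. On the kernel `c` may be replaced by `e`, whose entries are at
    -- most one in absolute value.
    by_cases hsmall : ∃ j, r.z j < 0 ∧ x j < η
    · obtain ⟨j, hzj, hxj⟩ := hsmall
      have hzj' : |r.z j| ≤ 2 * η := by
        rw [abs_of_neg hzj]
        linarith [hle j]
      have hall : ∀ i, |r.z i| ≤ κ * (2 * η) := fun i =>
        (hel.abs_le i hzj.ne).trans (by gcongr)
      rw [dotProduct_eq_of_rowSpace hA hF hce] at hlam_le
      refine hlam_le.trans ?_
      calc -(e ⬝ᵥ r.z) = ∑ i, -(e i * r.z i) := by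
            rw [Finset.sum_neg_distrib]
            rfl
        _ ≤ ∑ _i : Fin n, κ * (2 * η) := by
            refine Finset.sum_le_sum fun i _ => ?_
            by_cases hi : i ∈ F
            · calc -(e i * r.z i) ≤ |e i * r.z i| := neg_le_abs _
                _ = |e i| * |r.z i| := abs_mul _ _
                _ ≤ 1 * (κ * (2 * η)) :=
                  mul_le_mul (he i hi) (hall i) (abs_nonneg _) zero_le_one
                _ = _ := one_mul _
            · rw [hF i hi, mul_zero, neg_zero]
              positivity
        _ = 2 * n * κ * η := by
            rw [Finset.sum_const, Finset.card_univ, Fintype.card_fin, nsmul_eq_mul]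
            ring
    · push Not at hsmall
      -- Every decreasing coordinate satisfies `-z j ≤ x j + η ≤ 2 * x j`, so the half step is
      -- feasible and gains at most the gap.
      have hg := hgap (x + (1 / 2 : ℝ) • r.z) ⟨by
          rw [Matrix.mulVec_add, Matrix.mulVec_smul, hA, smul_zero, add_zero, hx.1], fun j => by
          simp only [Pi.add_apply, Pi.smul_apply, smul_eq_mul]
          rcases lt_or_ge (r.z j) 0 with h | h
          · linarith [hle j, hsmall j h]
          · linarith [hx.2 j]⟩ (fun j hj => by simp [hF j hj])
      rw [dotProduct_add, dotProduct_smul, smul_eq_mul] at hg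
      have h1 : lam ≤ 2 * η := by linarith
      refine h1.trans ?_
      have h2 : 1 ≤ n * κ := one_le_mul_of_one_le_of_one_le hn1 hκ
      nlinarith
  intro j hj
  obtain ⟨h1, h2, h3⟩ := hdual j hj
  refine ⟨h1, h2, ?_⟩
  have hxj := hx.2 j
  have hw : (weightsOf (fun j => 1 / (x j + η)) j).toReal = 1 / (x j + η) := by
    unfold weightsOf
    rw [if_neg (not_lt.2 (hv j).le), ENNReal.toReal_ofReal (hv j).le]
  have hwt : weightsOf (fun j => 1 / (x j + η)) j ≠ ∞ := by
    unfold weightsOf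
    rw [if_neg (not_lt.2 (hv j).le)]
    exact ENNReal.ofReal_ne_top
  have h4 := h3 hwt
  rw [hw, mul_one_div, le_div_iff₀ (by positivity)] at h4
  exact h4.trans hlam_le'

/-! ### Progress of one phase -/

theorem mulVec_eq_sum_smul_col {m n : ℕ} (A : Matrix (Fin m) (Fin n) ℝ) (h : Fin n → ℝ) :
    A *ᵥ h = ∑ i, h i • A.col i := by
  funext k
  simp [Matrix.mulVec, dotProduct, Finset.sum_apply, mul_comm]

/-- The span of the columns in `L`. -/
def colSpan {m n : ℕ} (A : Matrix (Fin m) (Fin n) ℝ) (L : Set (Fin n)) :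
    Submodule ℝ (Fin m → ℝ) :=
  Submodule.span ℝ (A.col '' L)

theorem col_mem_colSpan {m n : ℕ} (A : Matrix (Fin m) (Fin n) ℝ) {L : Set (Fin n)} {i : Fin n}
    (hi : i ∈ L) : A.col i ∈ colSpan A L :=
  Submodule.subset_span ⟨i, hi, rfl⟩

theorem colSpan_mono {m n : ℕ} (A : Matrix (Fin m) (Fin n) ℝ) {L L' : Set (Fin n)}
    (h : L ⊆ L') : colSpan A L ≤ colSpan A L' :=
  Submodule.span_mono (Set.image_mono h)

/-- A column in the span of other columns gives a kernel vector. -/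
theorem exists_kernel_of_mem_colSpan {m n : ℕ} (A : Matrix (Fin m) (Fin n) ℝ) {L : Set (Fin n)}
    {j : Fin n} (hj : j ∉ L) (h : A.col j ∈ colSpan A L) :
    ∃ u : Fin n → ℝ, A *ᵥ u = 0 ∧ u j ≠ 0 ∧ ∀ i, u i ≠ 0 → i = j ∨ i ∈ L := by
  classical
  unfold colSpan at h
  rw [Finsupp.mem_span_image_iff_linearCombination] at h
  obtain ⟨l, hl, hlj⟩ := h
  have hls : ∀ i, l i ≠ 0 → i ∈ L := fun i hi =>
    (Finsupp.mem_supported ℝ l).1 hl (Finsupp.mem_support_iff.2 hi)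
  have hlj0 : l j = 0 := by
    by_contra h0
    exact hj (hls j h0)
  refine ⟨fun i => l i - (if i = j then 1 else 0), ?_, ?_, ?_⟩
  · rw [mulVec_eq_sum_smul_col]
    simp only [sub_smul, Finset.sum_sub_distrib, ite_smul, one_smul, zero_smul,
      Finset.sum_ite_eq', Finset.mem_univ, if_true]
    rw [sub_eq_zero, ← hlj, Finsupp.linearCombination_apply, Finsupp.sum_fintype]
    intro i
    rw [zero_smul]
  · simp [hlj0]
  · intro i hi
    by_cases hij : i = j
    · exact Or.inl hij
    · right
      simp only [hij, if_false, sub_zero] at hi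
      exact hls i hi

/-- The change of the solution in a step along an elementary vector. -/
theorem step_bound {m n : ℕ} {A : Matrix (Fin m) (Fin n) ℝ} {x z c : Fin n → ℝ} {α q : ℝ}
    (hq : 0 < q) (hα : 0 < α) (hz : IsElementary A z) (hx : ∀ j, 0 ≤ x j)
    (hx' : ∀ j, 0 ≤ (x + α • z) j) (hc : ∀ j, 0 ≤ c j) (hcq : ∀ j, c j ≠ 0 → 1 / q ≤ c j)
    {j : Fin n} (hj : c j ≠ 0) (hzj : z j < 0) (i : Fin n) :
    |(x + α • z) i - x i| ≤ circuitImbalance A * q * (c ⬝ᵥ x) := by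
  have h1 : c j * x j ≤ c ⬝ᵥ x :=
    Finset.single_le_sum (f := fun j => c j * x j) (fun j _ => mul_nonneg (hc j) (hx j))
      (Finset.mem_univ j)
  -- A positive cost entry is at least `1 / q`, so `x j` is controlled by the potential; the step
  -- cannot exceed it at `j`, and the imbalance carries this bound to all coordinates.
  have h2 : x j ≤ q * (c ⬝ᵥ x) := by
    have h3 : 1 / q * x j ≤ c j * x j := mul_le_mul_of_nonneg_right (hcq j hj) (hx j)
    have h4 : 1 / q * x j ≤ c ⬝ᵥ x := h3.trans h1
    rw [one_div_mul_eq_div, div_le_iff₀ hq] at h4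
    linarith
  have h5 : α * |z j| ≤ x j := by
    have := hx' j
    simp only [Pi.add_apply, Pi.smul_apply, smul_eq_mul] at this
    rw [abs_of_neg hzj]
    linarith
  have hκ := one_le_circuitImbalance A
  have h6 := hz.abs_le i hzj.ne
  calc |(x + α • z) i - x i| = α * |z i| := by
        simp [abs_mul, abs_of_pos hα]
    _ ≤ α * (circuitImbalance A * |z j|) := by gcongr
    _ = circuitImbalance A * (α * |z j|) := by ring
    _ ≤ circuitImbalance A * (q * (c ⬝ᵥ x)) := by
        exact mul_le_mul_of_nonneg_left (h5.trans h2) (by linarith)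
    _ = _ := by ring

/-- The rank of the large columns grows when the potential drops. -/
theorem finrank_colSpan_lt {m n : ℕ} {A : Matrix (Fin m) (Fin n) ℝ} {b : Fin m → ℝ}
    {x x' c : Fin n → ℝ} {q Φ' : ℝ} (hq : 2 ≤ q)
    (hxA : A *ᵥ x = b) (hxA' : A *ᵥ x' = b) (hx : ∀ j, 0 ≤ x j) (hx' : ∀ j, 0 ≤ x' j)
    (hc : ∀ j, 0 ≤ c j) (hcq : ∀ j, c j ≠ 0 → 1 / q ≤ c j)
    (hcB : ∀ j, c j ≤ 2 * n * circuitImbalance A)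
    (hco : ∀ h : Fin n → ℝ, A *ᵥ h = 0 → (∀ j, x j = 0 → h j = 0) → ∀ j, c j ≠ 0 → h j = 0)
    (hΦ : 0 < c ⬝ᵥ x) (hΦ' : 0 ≤ Φ')
    (hsmall : 2 * q ^ 3 * Φ' * (4 * n ^ 3 * circuitImbalance A ^ 2) ≤ c ⬝ᵥ x)
    {L : Set (Fin n)} (hL : ∀ i ∈ L, q ^ 3 * (c ⬝ᵥ x) ≤ x i)
    (hmove : ∀ i, |x' i - x i| ≤ q ^ 3 * (c ⬝ᵥ x) / 2) :
    Module.finrank ℝ (colSpan A L) <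
      Module.finrank ℝ (colSpan A {i | 2 * q ^ 3 * Φ' ≤ x' i}) := by
  have hκ := one_le_circuitImbalance A
  set κ := circuitImbalance A with hκdef
  set Φ := c ⬝ᵥ x with hΦdef
  set L' : Set (Fin n) := {i | 2 * q ^ 3 * Φ' ≤ x' i} with hL'
  -- A coordinate that carries at least the average share of the potential.
  have hex : ∃ j, Φ ≤ n * (c j * x j) := by
    by_contra hcon
    push Not at hcon
    have hnpos : 0 < n := by
      by_contra h0
      have : n = 0 := by omega
      subst this
      simp [hΦdef, dotProduct] at hΦ
    have : n * Φ < n * Φ := by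
      have : Nonempty (Fin n) := ⟨⟨0, hnpos⟩⟩
      calc n * Φ = ∑ j, n * (c j * x j) := by
            rw [hΦdef, dotProduct, Finset.mul_sum]
        _ < ∑ _j : Fin n, Φ :=
            Finset.sum_lt_sum_of_nonempty Finset.univ_nonempty fun j _ => hcon j
        _ = n * Φ := by
            rw [Finset.sum_const, Finset.card_univ, Fintype.card_fin, nsmul_eq_mul]
    exact lt_irrefl _ this
  obtain ⟨j, hj⟩ := hex
  have hn1 : (1 : ℝ) ≤ n := by
    have := j.pos
    exact_mod_cast this
  have hn0 : (0 : ℝ) < n := by linarith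
  have hcx : 0 < c j * x j := by
    have : 0 < n * (c j * x j) := hΦ.trans_le hj
    exact pos_of_mul_pos_right this hn0.le
  have hcj : c j ≠ 0 := fun h => by simp [h] at hcx
  have hxj0 : x j ≠ 0 := fun h => by simp [h] at hcx
  have hxj : Φ ≤ 2 * n ^ 2 * κ * x j := by
    have h1 : c j * x j ≤ 2 * n * κ * x j := mul_le_mul_of_nonneg_right (hcB j) (hx j)
    calc Φ ≤ n * (c j * x j) := hj
      _ ≤ n * (2 * n * κ * x j) := by gcongr
      _ = _ := by ring
  have hq3 : 8 ≤ q ^ 3 := by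
    calc (8 : ℝ) = 2 ^ 3 := by norm_num
      _ ≤ q ^ 3 := by gcongr
  -- Its cost is at least `1 / q`, so `x j ≤ q * Φ`, which is below the threshold of `L`.
  have hjL : j ∉ L := by
    intro hjL
    have h1 := hL j hjL
    have h2 : c j * x j ≤ Φ :=
      Finset.single_le_sum (f := fun j => c j * x j) (fun j _ => mul_nonneg (hc j) (hx j))
        (Finset.mem_univ j)
    have h3 : 1 / q * x j ≤ Φ := (mul_le_mul_of_nonneg_right (hcq j hcj) (hx j)).trans h2
    rw [one_div_mul_eq_div, div_le_iff₀ (by linarith)] at h3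
    have h4 : q ^ 3 * Φ = q * (q * (q * Φ)) := by ring
    have h5 : q * Φ < q * (q * (q * Φ)) := by
      have : 0 < q * Φ := by positivity
      nlinarith [mul_pos (by linarith : 0 < q) this]
    nlinarith
  have hLx : ∀ i ∈ L, x i ≠ 0 := by
    intro i hi h0
    have := hL i hi
    rw [h0] at this
    have : 0 < q ^ 3 * Φ := by positivity
    linarith
  have hfac : (4 : ℝ) ≤ 4 * n ^ 3 * κ ^ 2 := by
    have h1 : (1 : ℝ) ≤ n ^ 3 := one_le_pow₀ hn1
    have h2 : (1 : ℝ) ≤ κ ^ 2 := one_le_pow₀ hκ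
    nlinarith
  have hΦ'4 : 2 * q ^ 3 * Φ' * 4 ≤ Φ := by
    refine le_trans ?_ hsmall
    have : 0 ≤ 2 * q ^ 3 * Φ' := by positivity
    gcongr
  have hLL' : L ⊆ L' := by
    intro i hi
    have h1 := hL i hi
    have h2 := abs_le.1 (hmove i)
    have h3 : 8 * Φ ≤ q ^ 3 * Φ := by gcongr
    show 2 * q ^ 3 * Φ' ≤ x' i
    linarith [h2.1]
  -- The old large columns stay large. If the span did not grow, every column in `L'` would lie in
  -- the span of `L`, hence of the support of `x` without `j`.
  refine Submodule.finrank_lt_finrank_of_lt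
    (lt_of_le_of_ne (colSpan_mono A hLL') fun heq => ?_)
  have hmem : ∀ i ∈ L', A.col i ∈ colSpan A L := fun i hi => heq ▸ col_mem_colSpan A hi
  set S : Set (Fin n) := {i | x i ≠ 0 ∧ i ≠ j} with hS
  have hLS : colSpan A L ≤ colSpan A S :=
    colSpan_mono A fun i hi => ⟨hLx i hi, fun h => hjL (h ▸ hi)⟩
  have hspan : A.col j ∈ colSpan A S := by
    by_cases hbig : x j ≤ 2 * x' j
    · refine hLS (hmem j ?_)
      show 2 * q ^ 3 * Φ' ≤ x' j
      have h1 : 2 * q ^ 3 * Φ' * (4 * n ^ 3 * κ ^ 2) ≤ x' j * (4 * n ^ 3 * κ ^ 2) := by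
        refine hsmall.trans (hxj.trans ?_)
        have h2 : 2 * n ^ 2 * κ * x j ≤ 2 * n ^ 2 * κ * (2 * x' j) := by gcongr
        refine h2.trans ?_
        have h3 : x' j * (4 * n ^ 2 * κ) ≤ x' j * (4 * n ^ 3 * κ ^ 2) := by
          have := hx' j
          have h4 : (n : ℝ) ^ 2 ≤ n ^ 3 := pow_le_pow_right₀ hn1 (by norm_num)
          have h5 : κ ≤ κ ^ 2 := le_self_pow₀ hκ (by norm_num)
          gcongr
        linarith
      exact le_of_mul_le_mul_right h1 (by linarith)
    · push Not at hbig
      obtain ⟨g, hg, hconf, hgle, hlarge⟩ := exists_elementary_large A (x' - x)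
        (by rw [Matrix.mulVec_sub, hxA, hxA', sub_self]) j (by
          simp only [Pi.sub_apply]
          have := hx' j
          intro h0
          have h1 := lt_of_le_of_ne (hx j) (Ne.symm hxj0)
          linarith)
      simp only [Pi.sub_apply] at hlarge
      have hxjpos := lt_of_le_of_ne (hx j) (Ne.symm hxj0)
      have hneg : x' j - x j < 0 := by linarith
      rw [abs_of_neg hneg] at hlarge
      have hgj : g j ≠ 0 := by
        intro h0
        rw [h0, abs_zero, mul_zero] at hlarge
        linarith
      have hgl : x j ≤ 2 * n * |g j| := by linarith
      -- Coordinates that `g` decreases lie in the support of `x`. Coordinates that it increases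
      -- receive at least `|g j| / κ` and are therefore large in `x'`.
      have hin : ∀ i, i ≠ j → g i ≠ 0 → A.col i ∈ colSpan A S := by
        intro i hij hgi
        rcases lt_or_gt_of_ne hgi with hlt | hgt
        · have h1 := hconf.neg hlt
          simp only [Pi.sub_apply] at h1
          refine col_mem_colSpan A ⟨?_, hij⟩
          have := hx' i
          linarith
        · refine hLS (hmem i ?_)
          show 2 * q ^ 3 * Φ' ≤ x' i
          have h1 := hgle i
          rw [abs_of_pos (hconf.pos hgt)] at h1
          simp only [Pi.sub_apply] at h1
          have h2 : |g j| ≤ κ * |g i| := hg.abs_le j hgi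
          have h3 : |g i| ≤ x' i := by
            have h5 := hx i
            linarith
          have h6 : 2 * q ^ 3 * Φ' * (4 * n ^ 3 * κ ^ 2) ≤ x' i * (4 * n ^ 3 * κ ^ 2) := by
            refine hsmall.trans (hxj.trans ?_)
            calc 2 * n ^ 2 * κ * x j ≤ 2 * n ^ 2 * κ * (2 * n * (κ * x' i)) := by
                  have : |g j| ≤ κ * x' i := h2.trans (by gcongr)
                  have h7 : x j ≤ 2 * n * (κ * x' i) := hgl.trans (by gcongr)
                  gcongr
              _ = _ := by ring
          exact le_of_mul_le_mul_right h6 (by linarith)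
      have hsum := mulVec_eq_sum_smul_col A g
      rw [hg.1, ← Finset.add_sum_erase _ _ (Finset.mem_univ j)] at hsum
      have h1 : g j • A.col j = -∑ i ∈ Finset.univ.erase j, g i • A.col i := by
        rw [eq_neg_iff_add_eq_zero]
        exact hsum.symm
      have h2 : g j • A.col j ∈ colSpan A S := by
        rw [h1]
        refine Submodule.neg_mem _ (Submodule.sum_mem _ fun i hi => ?_)
        by_cases hgi : g i = 0
        · rw [hgi, zero_smul]
          exact Submodule.zero_mem _
        · exact Submodule.smul_mem _ _ (hin i (Finset.ne_of_mem_erase hi) hgi)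
      have h3 := Submodule.smul_mem _ (g j)⁻¹ h2
      rwa [smul_smul, inv_mul_cancel₀ hgj, one_smul] at h3
  -- The dependence of column `j` gives a kernel vector in the support of `x` that is nonzero at a
  -- column of positive cost, contrary to `hco`.
  obtain ⟨u, hu, huj, hus⟩ := exists_kernel_of_mem_colSpan A (fun h : j ∈ S => h.2 rfl) hspan
  refine huj (hco u hu (fun i hi => ?_) j hcj)
  by_contra hne
  rcases hus i hne with h | h
  · exact hxj0 (h ▸ hi)
  · exact h.1 hi

/-! ### Proximity: fixing variables with large slack. -/

/-- Variables with a large reduced cost can be eliminated. -/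
theorem exists_feasible_restricted {m n : ℕ} (P : LP m n) {F : Set (Fin n)}
    {x s δ : Fin n → ℝ} {y : Fin m → ℝ} {ρ ε : ℝ} (hρ : 0 ≤ ρ) (hε : 0 ≤ ε)
    (hx : P.Feasible x) (hxF : ∀ j, j ∉ F → x j = 0)
    (hc : ∀ j ∈ F, P.c j = ρ * (s j + δ j) + (P.Aᵀ *ᵥ y) j)
    (hs : ∀ j ∈ F, 0 ≤ s j) (hδ : ∀ j ∈ F, 0 ≤ δ j) (hδε : ∀ j ∈ F, δ j ≤ ε)
    (hcomp : ∀ j ∈ F, x j ≠ 0 → s j ≤ ε)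
    (hsmall : 8 * n ^ 2 * circuitImbalance P.A * ε ≤ 1)
    {x' : Fin n → ℝ} (hx' : P.Feasible x') (hxF' : ∀ j, j ∉ F → x' j = 0) :
    ∃ x'', P.Feasible x'' ∧ (∀ j, ¬ (j ∈ F ∧ s j ≤ 1 / (4 * n)) → x'' j = 0) ∧
      P.c ⬝ᵥ x'' ≤ P.c ⬝ᵥ x' := by
  classical
  have hκ := one_le_circuitImbalance P.A
  set κ := circuitImbalance P.A with hκdef
  have hA : P.A *ᵥ (x - x') = 0 := by
    rw [Matrix.mulVec_sub, hx.1, hx'.1, sub_self]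
  obtain ⟨l, G, -, hG, hsum⟩ := exists_conformal_decomposition P.A (x - x') hA
  have hn : ∀ j : Fin n, (1 : ℝ) ≤ n := fun j => by
    have := j.pos
    exact_mod_cast this
  have hD0 : ∀ j ∈ F, 1 / (4 * n) < s j → x j = 0 := by
    intro j hj hsj
    by_contra hne
    have h1 := hcomp j hj hne
    have hnj := hn j
    have h2 : 1 / (4 * (n : ℝ)) < ε := hsj.trans_le h1
    rw [div_lt_iff₀ (by positivity)] at h2
    have h3 : ε * (4 * n) ≤ 8 * n ^ 2 * κ * ε := by
      have : (4 : ℝ) * n ≤ 8 * n ^ 2 * κ := by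
        have h4 : (n : ℝ) ≤ n ^ 2 := le_self_pow₀ hnj (by norm_num)
        have h5 : (n : ℝ) ^ 2 ≤ n ^ 2 * κ := le_mul_of_one_le_right (by positivity) hκ
        linarith
      nlinarith
    linarith
  have hGF : ∀ t j, j ∉ F → G t j = 0 := by
    intro t j hj
    by_contra hne
    have := (hG t).2.ne_zero hne
    simp [hxF j hj, hxF' j hj] at this
  -- The circuits of `x - x'` that meet a column with large slack. Adding exactly these to `x'`
  -- makes such columns agree with `x`, where they vanish.
  let T : Finset (Fin l) :=
    Finset.univ.filter fun t => ∃ j ∈ F, 1 / (4 * n) < s j ∧ G t j ≠ 0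
  have hcost : ∀ t ∈ T, P.c ⬝ᵥ G t ≤ 0 := by
    intro t ht
    obtain ⟨j, hjF, hsj, hgj⟩ : ∃ j ∈ F, 1 / (4 * n) < s j ∧ G t j ≠ 0 :=
      (Finset.mem_filter.1 ht).2
    have hnj := hn j
    have hxj := hD0 j hjF hsj
    have hgneg : G t j < 0 := by
      rcases lt_or_gt_of_ne hgj with h | h
      · exact h
      · have h1 := (hG t).2.pos h
        simp only [Pi.sub_apply, hxj] at h1
        have := hx'.2 j
        linarith
    have hc' : ∀ i ∈ F, P.c i = (fun i => ρ * (s i + δ i)) i + (P.Aᵀ *ᵥ y) i := hc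
    rw [dotProduct_eq_of_rowSpace (hG t).1.1 (hGF t) hc']
    -- Increasing coordinates lie in the support of `x`, where the reduced cost is at most `2 ε`;
    -- the decrease at `j` gains at least `s j * |G t j|`, which outweighs all of them.
    have hterm : ∀ i, (fun i => ρ * (s i + δ i)) i * G t i ≤
        ρ * (2 * ε * κ * |G t j| - (if i = j then s j * |G t j| else 0)) := by
      intro i
      have hb : 0 ≤ 2 * ε * κ * |G t j| := by positivity
      by_cases hi : i ∈ F
      · have hsδ := add_nonneg (hs i hi) (hδ i hi)
        simp only [mul_assoc]
        refine mul_le_mul_of_nonneg_left ?_ hρ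
        rcases le_or_gt (G t i) 0 with h | h
        · by_cases hij : i = j
          · subst hij
            rw [if_pos rfl, abs_of_neg hgneg]
            have h1 := mul_nonneg (hδ i hi) (neg_nonneg.2 h)
            rw [abs_of_neg hgneg] at hb
            nlinarith
          · rw [if_neg hij]
            have := mul_nonneg hsδ (neg_nonneg.2 h)
            nlinarith
        · have hij : i ≠ j := fun hij => by
            rw [hij] at h
            exact lt_asymm h hgneg
          rw [if_neg hij, sub_zero]
          have hxi : x i ≠ 0 := by
            have h1 := (hG t).2.pos h
            simp only [Pi.sub_apply] at h1
            have := hx'.2 i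
            intro h0
            linarith
          have h2 : |G t i| ≤ κ * |G t j| := (hG t).1.abs_le i hgj
          rw [abs_of_pos h] at h2
          have h3 : s i + δ i ≤ 2 * ε := by linarith [hcomp i hi hxi, hδε i hi]
          calc (s i + δ i) * G t i ≤ 2 * ε * (κ * |G t j|) := by gcongr
            _ = _ := by ring
      · have hij : i ≠ j := fun h => hi (h ▸ hjF)
        rw [hGF t i hi, mul_zero, if_neg hij, sub_zero]
        positivity
    refine (Finset.sum_le_sum fun i _ => hterm i).trans ?_
    rw [← Finset.mul_sum, Finset.sum_sub_distrib, Finset.sum_ite_eq', if_pos (Finset.mem_univ _),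
      Finset.sum_const, Finset.card_univ, Fintype.card_fin, nsmul_eq_mul]
    refine mul_nonpos_of_nonneg_of_nonpos hρ ?_
    have h1 : (n : ℝ) * (2 * ε * κ) ≤ 1 / (4 * n) := by
      rw [le_div_iff₀ (by positivity)]
      nlinarith
    have h2 : (n : ℝ) * (2 * ε * κ) ≤ s j := h1.trans hsj.le
    have := mul_le_mul_of_nonneg_right h2 (abs_nonneg (G t j))
    linarith
  have hcoord : ∀ i, x i - x' i = ∑ t, G t i := by
    intro i
    rw [← Finset.sum_apply, hsum, Pi.sub_apply]
  refine ⟨x' + ∑ t ∈ T, G t, ⟨?_, fun i => ?_⟩, fun j hj => ?_, ?_⟩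
  · rw [Matrix.mulVec_add, Matrix.mulVec_sum, Finset.sum_eq_zero fun t _ => (hG t).1.1, add_zero,
      hx'.1]
  · rw [Pi.add_apply, Finset.sum_apply]
    rcases le_or_gt 0 (x i - x' i) with h | h
    · refine add_nonneg (hx'.2 i) (Finset.sum_nonneg fun t _ => ?_)
      by_contra hcon
      have := (hG t).2.neg (not_le.1 hcon)
      simp only [Pi.sub_apply] at this
      linarith
    · have h1 : ∑ t ∈ T, -G t i ≤ ∑ t, -G t i :=
        Finset.sum_le_sum_of_subset_of_nonneg (Finset.subset_univ T) fun t _ _ => by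
          by_contra hcon
          have := (hG t).2.pos (by linarith : 0 < G t i)
          simp only [Pi.sub_apply] at this
          linarith
      rw [Finset.sum_neg_distrib, Finset.sum_neg_distrib] at h1
      have := hcoord i
      have := hx.2 i
      linarith
  · rw [Pi.add_apply, Finset.sum_apply]
    by_cases hjF : j ∈ F
    · have hsj : 1 / (4 * n) < s j := by
        by_contra h
        exact hj ⟨hjF, not_lt.1 h⟩
      have h1 : ∑ t ∈ T, G t j = ∑ t, G t j := by
        refine Finset.sum_subset (Finset.subset_univ T) fun t _ ht => ?_
        by_contra hne
        exact ht (Finset.mem_filter.2 ⟨Finset.mem_univ _, j, hjF, hsj, hne⟩)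
      rw [h1, ← hcoord, hD0 j hjF hsj]
      ring
    · rw [hxF' j hjF, Finset.sum_eq_zero fun t _ => hGF t j hjF, add_zero]
  · rw [dotProduct_add]
    have h1 : P.c ⬝ᵥ ∑ t ∈ T, G t = ∑ t ∈ T, P.c ⬝ᵥ G t := dotProduct_sum _ _ _
    have := Finset.sum_nonpos hcost
    rw [h1]
    linarith

/-! ### Truncated costs and the invariant of the phases. -/

/-- The cost `s` on the free columns, with entries up to `1 / q` replaced by zero. -/
noncomputable def truncCost {n : ℕ} (q : ℝ) (f s : Fin n → ℝ) : Fin n → ℝ :=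
  fun j => if 1 / q < s j * f j then s j else 0

theorem truncCost_nonneg {n : ℕ} {q : ℝ} (hq : 0 < q) {f : Fin n → ℝ}
    (hf : ∀ j, f j = 0 ∨ f j = 1) (s : Fin n → ℝ) (j : Fin n) : 0 ≤ truncCost q f s j := by
  unfold truncCost
  split_ifs with h
  · have hq' : 0 < 1 / q := by positivity
    rcases hf j with h0 | h1
    · rw [h0, mul_zero] at h
      linarith
    · rw [h1, mul_one] at h
      linarith
  · exact le_rfl

theorem le_truncCost {n : ℕ} {q : ℝ} (hq : 0 < q) {f : Fin n → ℝ}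
    (hf : ∀ j, f j = 0 ∨ f j = 1) (s : Fin n → ℝ) (j : Fin n) (h : truncCost q f s j ≠ 0) :
    1 / q ≤ truncCost q f s j := by
  unfold truncCost at h ⊢
  split_ifs at h ⊢ with h'
  · have hq' : 0 < 1 / q := by positivity
    rcases hf j with h0 | h1
    · rw [h0, mul_zero] at h'
      linarith
    · rw [h1, mul_one] at h'
      linarith
  · exact absurd rfl h

theorem truncCost_eq_zero {n : ℕ} {q : ℝ} (hq : 0 < q) {f s : Fin n → ℝ} {j : Fin n}
    (hj : f j = 0) : truncCost q f s j = 0 := by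
  unfold truncCost
  rw [hj, mul_zero, if_neg]
  have : 0 < 1 / q := by positivity
  exact not_lt.2 this.le

theorem truncCost_sub {n : ℕ} {q : ℝ} (hq : 0 < q) {f s : Fin n → ℝ} {j : Fin n}
    (hj : f j = 1) (hs : 0 ≤ s j) : truncCost q f s j ≤ s j ∧ s j - truncCost q f s j ≤ 1 / q := by
  have hq' : 0 < 1 / q := by positivity
  unfold truncCost
  rw [hj, mul_one]
  split_ifs with h
  · exact ⟨le_rfl, by linarith⟩
  · exact ⟨hs, by linarith⟩

/-- The invariant of the phases: `f` is the indicator of the free columns, `s₀` the normalized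
cost, `x` the current solution, `s` the current slack and `c` the current truncated cost. -/
structure PhaseInv {m n : ℕ} (P : LP m n) (f s₀ : Fin n → ℝ) (q : ℝ) (k : ℕ)
    (x s c : Fin n → ℝ) : Prop where
  feas : P.Feasible x
  off : ∀ j, f j = 0 → x j = 0
  dual : ∃ (y : Fin m → ℝ) (δ : Fin n → ℝ), ∀ j, f j ≠ 0 →
    s j + δ j = s₀ j + (P.Aᵀ *ᵥ y) j ∧ 0 ≤ s j ∧ 0 ≤ δ j ∧ δ j ≤ k / q
  bound : ∀ j, f j ≠ 0 → s j ≤ 2 * n * circuitImbalance P.A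
  cost : c = truncCost q f s
  prog : c ⬝ᵥ x = 0 ∨ ∃ L : Set (Fin n), k ≤ Module.finrank ℝ (colSpan P.A L) ∧
    ∀ i ∈ L, 2 * q ^ 3 * (c ⬝ᵥ x) ≤ x i

/-- What a phase does. -/
structure PhaseStep {m n : ℕ} (P : LP m n) (R : RatioOracle m n) (f : Fin n → ℝ) (q : ℝ) (K : ℕ)
    (x s c x' s' c' : Fin n → ℝ) : Prop where
  out : ∃ x₁, P.Feasible x₁ ∧ (∀ j, f j = 0 → x j = 0 → x₁ j = 0) ∧ c ⬝ᵥ x₁ ≤ c ⬝ᵥ x ∧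
    (∀ i, |x₁ i - x i| ≤ 2 * n * (circuitImbalance P.A * q * (c ⬝ᵥ x))) ∧
    (∀ h : Fin n → ℝ, P.A *ᵥ h = 0 → (∀ j, x₁ j = 0 → h j = 0) → ∀ j, c j ≠ 0 → h j = 0) ∧
    ((c ⬝ᵥ x₁ = 0 ∧ x' = x₁ ∧ s' = s ∧ c' = c) ∨
      (0 < c ⬝ᵥ x₁ ∧ P.Feasible x' ∧ (∀ j, f j = 0 → x₁ j = 0 → x' j = 0) ∧
        (∀ i, |x' i - x₁ i| ≤ 4 * n * K * (circuitImbalance P.A * q * (c ⬝ᵥ x₁))) ∧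
        (∀ u, P.Feasible u → (∀ j, f j = 0 → u j = x' j) →
          c ⬝ᵥ x' - c ⬝ᵥ u ≤ (1 - 1 / (n : ℝ)) ^ (4 * n * K) * (c ⬝ᵥ x₁ - c ⬝ᵥ u)) ∧
        ∃ r, R (Function.support f) c
          (weightsOf fun j => 1 / (x' j + c ⬝ᵥ x₁ / q ^ 4)) = some r ∧
          s' = r.s ∧ c' = truncCost q f r.s))

/-- Every `n` steps at least halve the gap, so `4 n K` steps divide it by `q ^ 4` for `q = 2 ^ K`;
this is the number of steps in a phase. -/
theorem one_sub_inv_pow_le {n K : ℕ} (hn : 1 ≤ n) :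
    (1 - 1 / (n : ℝ)) ^ (4 * n * K) ≤ 1 / ((2 : ℝ) ^ K) ^ 4 := by
  have hn' : (1 : ℝ) ≤ n := by exact_mod_cast hn
  have h1 : (1 - 1 / (n : ℝ)) ^ n ≤ 1 / 2 := by
    refine (Real.one_sub_div_pow_le_exp_neg hn').trans ?_
    rw [Real.exp_neg, one_div]
    refine inv_anti₀ (by norm_num) ?_
    have := Real.add_one_le_exp (1 : ℝ)
    linarith
  have h0 : 0 ≤ (1 - 1 / (n : ℝ)) ^ n := by
    refine pow_nonneg ?_ _
    rw [sub_nonneg, div_le_one (by linarith)]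
    exact hn'
  calc (1 - 1 / (n : ℝ)) ^ (4 * n * K) = ((1 - 1 / (n : ℝ)) ^ n) ^ (4 * K) := by
        rw [← pow_mul]
        congr 1
        ring
    _ ≤ (1 / 2) ^ (4 * K) := by gcongr
    _ = 1 / ((2 : ℝ) ^ K) ^ 4 := by
        rw [one_div_pow, ← pow_mul, mul_comm K 4]

/-- The support reduction and the descent each use at most half of the available margin on `L`, and
the drop of the potential makes the threshold for the new large coordinates much lower, so the rank
increases. The part of the slack that is truncated is moved to `δ` and costs `1 / q` per phase. If
the reduction alone brings the potential to zero, nothing else changes. -/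
theorem PhaseInv.next {m n : ℕ} {P : LP m n} {R : RatioOracle m n} (hR : IsRatioOracle P.A R)
    {f s₀ x s c x' s' c' : Fin n → ℝ} {q : ℝ} {k K : ℕ} (hn : 1 ≤ n) (hmn : m ≤ n) (hk : k ≤ m)
    (hf : ∀ j, f j = 0 ∨ f j = 1) (hs₀ : ∀ j, f j ≠ 0 → 0 ≤ s₀ j ∧ s₀ j ≤ 1)
    (hqK : q = 2 ^ K) (hq : 64 * n ^ 5 * circuitImbalance P.A ^ 3 ≤ q)
    (hinv : PhaseInv P f s₀ q k x s c) (hstep : PhaseStep P R f q K x s c x' s' c') :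
    PhaseInv P f s₀ q (k + 1) x' s' c' := by
  obtain ⟨x₁, hx₁, hoff₁, hΦ₁, hmove₁, hco, hout⟩ := hstep.out
  obtain ⟨hx, hoff, ⟨y, δ, hdual⟩, hbound, hcost, hprog⟩ := hinv
  have hκ := one_le_circuitImbalance P.A
  set κ := circuitImbalance P.A with hκdef
  have hn1 : (1 : ℝ) ≤ n := by exact_mod_cast hn
  have hn5 : (n : ℝ) ≤ n ^ 5 := le_self_pow₀ hn1 (by norm_num)
  have hn5' : (n : ℝ) ^ 2 ≤ n ^ 5 := pow_le_pow_right₀ hn1 (by norm_num)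
  have hκ3 : κ ≤ κ ^ 3 := le_self_pow₀ hκ (by norm_num)
  have hn0 : (0 : ℝ) ≤ n := by linarith
  have hnκ : 64 * (n * κ) ≤ q := by
    refine le_trans ?_ hq
    have : (n : ℝ) * κ ≤ n ^ 5 * κ ^ 3 := by gcongr
    linarith
  have hn1κ : (n : ℝ) ≤ n * κ := le_mul_of_one_le_right hn0 hκ
  have hκ0 : 0 < κ := by linarith
  have hq64 : 64 ≤ q := by linarith
  have hq0 : 0 < q := by linarith
  have hKq : (K : ℝ) ≤ q := by
    rw [hqK]
    exact_mod_cast Nat.lt_two_pow_self.le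
  have hkn : (k : ℝ) ≤ n := by exact_mod_cast hk.trans hmn
  have hc0 : ∀ j, 0 ≤ c j := fun j => hcost ▸ truncCost_nonneg hq0 hf s j
  have hcq : ∀ j, c j ≠ 0 → 1 / q ≤ c j := fun j hj => by
    subst hcost
    exact le_truncCost hq0 hf s j hj
  have hcF : ∀ j, f j = 0 → c j = 0 := fun j hj => by
    rw [hcost]
    exact truncCost_eq_zero hq0 hj
  have hcB : ∀ j, c j ≤ 2 * n * κ := by
    intro j
    rcases hf j with h | h
    · rw [hcF j h]
      positivity
    · have hne : f j ≠ 0 := by rw [h]; exact one_ne_zero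
      rw [hcost]
      exact (truncCost_sub hq0 h (hdual j hne).2.1).1.trans (hbound j hne)
  have hΦ0 : 0 ≤ c ⬝ᵥ x := Finset.sum_nonneg fun j _ => mul_nonneg (hc0 j) (hx.2 j)
  rcases hout with ⟨hzero, rfl, rfl, rfl⟩ | ⟨hpos, hx', hoff', hmove', hgap, r, hr, rfl, rfl⟩
  · refine ⟨hx₁, fun j hj => hoff₁ j hj (hoff j hj), ⟨y, δ, fun j hj => ?_⟩, hbound, hcost,
      Or.inl hzero⟩
    obtain ⟨h1, h2, h3, h4⟩ := hdual j hj
    refine ⟨h1, h2, h3, h4.trans ?_⟩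
    push_cast
    gcongr
    linarith
  have hoffx' : ∀ j, f j = 0 → x' j = 0 := fun j hj => hoff' j hj (hoff₁ j hj (hoff j hj))
  set Φ := c ⬝ᵥ x₁ with hΦdef
  have hη : 0 < Φ / q ^ 4 := by positivity
  -- the current cost in terms of the normalized one
  have hce : ∀ j ∈ Function.support f,
      c j = (fun j => s₀ j - δ j - (s j - c j)) j + (P.Aᵀ *ᵥ y) j := by
    intro j hj
    have := (hdual j hj).1
    simp only
    linarith
  have hsc : ∀ j, f j ≠ 0 → 0 ≤ s j - c j ∧ s j - c j ≤ 1 / q := by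
    intro j hj
    have h1 : f j = 1 := (hf j).resolve_left hj
    have := truncCost_sub (s := s) hq0 h1 (hdual j hj).2.1
    rw [hcost]
    exact ⟨by linarith [this.1], this.2⟩
  have he : ∀ j ∈ Function.support f, |(fun j => s₀ j - δ j - (s j - c j)) j| ≤ 1 := by
    intro j hj
    obtain ⟨h1, h2, h3, h4⟩ := hdual j hj
    obtain ⟨h5, h6⟩ := hsc j hj
    obtain ⟨h7, h8⟩ := hs₀ j hj
    -- All truncations together stay below one, so the cost is equivalent to one with entries in
    -- `[-1, 1]`, as `dual_bound` requires.
    have h9 : (k : ℝ) / q + 1 / q ≤ 1 := by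
      rw [← add_div, div_le_one hq0]
      linarith
    simp only
    rw [abs_le]
    constructor <;> linarith
  have hgap' : ∀ u, P.Feasible u → (∀ j, j ∉ Function.support f → u j = x' j) →
      c ⬝ᵥ x' - c ⬝ᵥ u ≤ Φ / q ^ 4 := by
    intro u hu huF
    have hcu : 0 ≤ c ⬝ᵥ u := Finset.sum_nonneg fun j _ => mul_nonneg (hc0 j) (hu.2 j)
    have h1 := hgap u hu (fun j hj => huF j (by simpa using hj))
    have h2 := one_sub_inv_pow_le (K := K) hn
    rw [← hqK] at h2
    have h3 : 0 ≤ (1 - 1 / (n : ℝ)) ^ (4 * n * K) := by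
      refine pow_nonneg ?_ _
      rw [sub_nonneg, div_le_one (by linarith)]
      exact hn1
    refine h1.trans ?_
    calc (1 - 1 / (n : ℝ)) ^ (4 * n * K) * (Φ - c ⬝ᵥ u)
        ≤ (1 - 1 / (n : ℝ)) ^ (4 * n * K) * Φ := by
          gcongr
          linarith
      _ ≤ 1 / q ^ 4 * Φ := by gcongr
      _ = Φ / q ^ 4 := by ring
  have hdb := dual_bound P hR hη hx' hce he hgap' hr
  have hsbound : ∀ j, f j ≠ 0 → r.s j ≤ 2 * n * κ := by
    intro j hj
    obtain ⟨-, h2, h3⟩ := hdb j hj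
    have h4 : r.s j * (Φ / q ^ 4) ≤ 2 * n * κ * (Φ / q ^ 4) := by
      refine le_trans ?_ h3
      have := hx'.2 j
      gcongr
      linarith
    exact le_of_mul_le_mul_right h4 hη
  -- The drop of the potential: each coordinate contributes at most the bound of `dual_bound`.
  have hΦ' : truncCost q f r.s ⬝ᵥ x' ≤ n * (2 * n * κ * (Φ / q ^ 4)) := by
    calc truncCost q f r.s ⬝ᵥ x' ≤ ∑ _j : Fin n, 2 * n * κ * (Φ / q ^ 4) := by
          refine Finset.sum_le_sum fun j _ => ?_
          rcases hf j with h | h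
          · rw [truncCost_eq_zero hq0 h, zero_mul]
            positivity
          · have hne : f j ≠ 0 := by rw [h]; exact one_ne_zero
            obtain ⟨-, h2, h3⟩ := hdb j hne
            have h4 := (truncCost_sub hq0 h h2).1
            have := hx'.2 j
            calc truncCost q f r.s j * x' j ≤ r.s j * (x' j + Φ / q ^ 4) := by
                  gcongr
                  linarith
              _ ≤ _ := h3
      _ = _ := by
          rw [Finset.sum_const, Finset.card_univ, Fintype.card_fin, nsmul_eq_mul]
  have hΦ'0 : 0 ≤ truncCost q f r.s ⬝ᵥ x' :=
    Finset.sum_nonneg fun j _ => mul_nonneg (truncCost_nonneg hq0 hf _ j) (hx'.2 j)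
  refine ⟨hx', hoffx', ⟨y + r.y, fun j => δ j + (s j - c j), fun j hj => ?_⟩, hsbound, rfl, ?_⟩
  · obtain ⟨h1, h2, h3, h4⟩ := hdual j hj
    obtain ⟨h5, h6⟩ := hsc j hj
    obtain ⟨h7, h8, -⟩ := hdb j hj
    refine ⟨?_, h8, by linarith, ?_⟩
    · rw [Matrix.mulVec_add, Pi.add_apply, h7]
      linarith
    · push_cast
      rw [add_div]
      linarith
  · right
    rcases hprog with h0 | ⟨L, hkL, hL⟩
    · linarith
    refine ⟨{i | 2 * q ^ 3 * (truncCost q f r.s ⬝ᵥ x') ≤ x' i}, ?_, fun i hi => hi⟩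
    have hL₁ : ∀ i ∈ L, q ^ 3 * Φ ≤ x₁ i := by
      intro i hi
      have h1 := (abs_le.1 (hmove₁ i)).1
      have h2 := hL i hi
      have h3 : 2 * n * (κ * q * (c ⬝ᵥ x)) ≤ q ^ 3 * (c ⬝ᵥ x) := by
        have h4 : 2 * n * κ * q ≤ q ^ 3 := by
          have h5 : 2 * n * κ ≤ q := by linarith
          have h6 : q ≤ q ^ 2 := le_self_pow₀ (by linarith) (by norm_num)
          calc 2 * n * κ * q ≤ q ^ 2 * q := by
                gcongr
                linarith
            _ = q ^ 3 := by ring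
        calc 2 * n * (κ * q * (c ⬝ᵥ x)) = 2 * n * κ * q * (c ⬝ᵥ x) := by ring
          _ ≤ _ := by gcongr
      have h7 : q ^ 3 * Φ ≤ q ^ 3 * (c ⬝ᵥ x) := by gcongr
      linarith
    have hmoveB : ∀ i, |x' i - x₁ i| ≤ q ^ 3 * Φ / 2 := by
      intro i
      refine (hmove' i).trans ?_
      -- Here `K ≤ 2 ^ K = q` absorbs the number of steps.
      have h4 : 8 * n * K * κ * q ≤ q ^ 3 := by
        calc 8 * n * K * κ * q = (8 * (n * κ)) * K * q := by ring
          _ ≤ q * q * q := by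
            gcongr
            linarith
          _ = q ^ 3 := by ring
      have h5 : 8 * n * K * κ * q * Φ ≤ q ^ 3 * Φ := by gcongr
      linarith
    -- This is where the fifth power of `n` and the third power of `κ` in the required size of `q`
    -- come from.
    have hsmall : 2 * q ^ 3 * (truncCost q f r.s ⬝ᵥ x') * (4 * n ^ 3 * κ ^ 2) ≤ Φ := by
      calc 2 * q ^ 3 * (truncCost q f r.s ⬝ᵥ x') * (4 * n ^ 3 * κ ^ 2)
          ≤ 2 * q ^ 3 * (n * (2 * n * κ * (Φ / q ^ 4))) * (4 * n ^ 3 * κ ^ 2) := by gcongr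
        _ = (16 * n ^ 5 * κ ^ 3) / q * Φ := by
            field_simp
            ring
        _ ≤ 1 * Φ := by
            have : 0 ≤ n ^ 5 * κ ^ 3 := by positivity
            gcongr
            rw [div_le_one hq0]
            linarith
        _ = Φ := one_mul _
    have hlt := finrank_colSpan_lt (by linarith : 2 ≤ q) hx₁.1 hx'.1 hx₁.2 hx'.2 hc0 hcq hcB hco
      hpos hΦ'0 hsmall hL₁ hmoveB
    omega

/-- The span of columns has rank at most `m`, so rank `m + 1` is impossible and only the alternative
of zero potential remains. -/
theorem PhaseInv.finish {m n : ℕ} {P : LP m n} {f s₀ x s c : Fin n → ℝ} {q : ℝ}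
    (h : PhaseInv P f s₀ q (m + 1) x s c) : c ⬝ᵥ x = 0 := by
  rcases h.prog with h0 | ⟨L, hL, -⟩
  · exact h0
  · have h1 := Submodule.finrank_le (colSpan P.A L)
    rw [Module.finrank_fin_fun] at h1
    omega

/-! ### Elimination of variables -/

/-- The invariant of the elimination rounds: `f` is the indicator of the free columns. -/
structure RoundInv {m n : ℕ} (P : LP m n) (r : ℕ) (f x : Fin n → ℝ) : Prop where
  feas : P.Feasible x
  ind : ∀ j, f j = 0 ∨ f j = 1
  off : ∀ j, f j = 0 → x j = 0
  opt : ∀ u, P.Feasible u → ∃ u', P.Feasible u' ∧ (∀ j, f j = 0 → u' j = 0) ∧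
    P.c ⬝ᵥ u' ≤ P.c ⬝ᵥ u
  prog : (Function.support f).ncard + r ≤ n ∨
    ∃ y : Fin m → ℝ, ∀ j, f j ≠ 0 → P.c j = (P.Aᵀ *ᵥ y) j

/-- The new indicator of the free columns after a round. -/
noncomputable def fixLarge {n : ℕ} (f s : Fin n → ℝ) : Fin n → ℝ :=
  fun j => if 1 / (4 * n) < s j then 0 else f j

theorem RoundInv.init {m n : ℕ} {P : LP m n} {x : Fin n → ℝ} (hx : P.Feasible x) :
    RoundInv P 0 (fun _ => 1) x :=
  ⟨hx, fun _ => Or.inr rfl, fun _ h => absurd h one_ne_zero,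
    fun u hu => ⟨u, hu, fun _ h => absurd h one_ne_zero, le_rfl⟩, Or.inl (by
      have := Set.ncard_le_ncard (Set.subset_univ (Function.support fun _ : Fin n => (1 : ℝ)))
      rw [Set.ncard_univ, Nat.card_eq_fintype_card, Fintype.card_fin] at this
      simpa using this)⟩

/-- After `n` rounds no column is free, or the cost lies in the row space on the free columns;
either way all feasible points supported there have the same cost. -/
theorem RoundInv.optimal {m n : ℕ} {P : LP m n} {f x : Fin n → ℝ} (h : RoundInv P n f x) :
    P.Optimal x := by
  obtain ⟨y, hy⟩ : ∃ y : Fin m → ℝ, ∀ j, f j ≠ 0 → P.c j = (P.Aᵀ *ᵥ y) j := by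
    rcases h.prog with h0 | h0
    · refine ⟨0, fun j hj => ?_⟩
      have h1 : (Function.support f).ncard = 0 := by omega
      rw [Set.ncard_eq_zero (Set.toFinite _)] at h1
      exact absurd (h1 ▸ (show j ∈ Function.support f from hj)) (Set.notMem_empty j)
    · exact h0
  refine ⟨h.feas, fun u hu => ?_⟩
  obtain ⟨u', hu', hoff, hle⟩ := h.opt u hu
  refine le_trans (le_of_eq ?_) hle
  have h1 : P.c ⬝ᵥ (u' - x) = (0 : Fin n → ℝ) ⬝ᵥ (u' - x) :=
    dotProduct_eq_of_rowSpace (F := Function.support f) (y := y)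
      (by rw [Matrix.mulVec_sub, hu'.1, h.feas.1, sub_self])
      (fun j hj => by
        have hj' : f j = 0 := by simpa using hj
        rw [Pi.sub_apply, hoff j hj', h.off j hj', sub_zero])
      (fun j hj => by
        rw [hy j hj]
        simp)
  rw [zero_dotProduct, dotProduct_sub] at h1
  linarith

theorem PhaseInv.init {m n : ℕ} {P : LP m n} {f x s : Fin n → ℝ} {q : ℝ} (hn : 1 ≤ n)
    (hx : P.Feasible x) (hoff : ∀ j, f j = 0 → x j = 0)
    (hs : ∀ j, f j ≠ 0 → 0 ≤ s j ∧ s j ≤ 1) :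
    PhaseInv P f s q 0 x s (truncCost q f s) := by
  have hκ := one_le_circuitImbalance P.A
  have hn1 : (1 : ℝ) ≤ n := by exact_mod_cast hn
  refine ⟨hx, hoff, ⟨0, 0, fun j hj => ⟨by simp, (hs j hj).1, le_rfl, by simp⟩⟩,
    fun j hj => (hs j hj).2.trans ?_, rfl, Or.inr ⟨∅, Nat.zero_le _, fun i hi => hi.elim⟩⟩
  have := one_le_mul_of_one_le_of_one_le hn1 hκ
  linarith

/-- The slacks of the first dual answer of a round are normalized by their sum. -/
theorem normalized_slack {m n : ℕ} {P : LP m n} {R : RatioOracle m n}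
    (hR : IsRatioOracle P.A R) {f : Fin n → ℝ} (hf : ∀ j, f j = 0 ∨ f j = 1)
    {r : RatioAnswer m n}
    (hr : R (Function.support f) P.c (weightsOf fun _ => 1) = some r) (hρ : 0 < f ⬝ᵥ r.s) :
    ∀ j, f j ≠ 0 → 0 ≤ r.s j / (f ⬝ᵥ r.s) ∧ r.s j / (f ⬝ᵥ r.s) ≤ 1 := by
  obtain ⟨-, -, lam, ⟨-, hd⟩, -⟩ := (hR _ _ _).2 r hr
  have hnn : ∀ j, 0 ≤ f j * r.s j := by
    intro j
    rcases hf j with h | h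
    · rw [h, zero_mul]
    · rw [h, one_mul]
      exact (hd j (by rw [Function.mem_support, h]; exact one_ne_zero)).2.1
  intro j hj
  have h1 := (hf j).resolve_left hj
  refine ⟨div_nonneg (hd j hj).2.1 hρ.le, (div_le_one hρ).2 ?_⟩
  have := Finset.single_le_sum (f := fun j => f j * r.s j) (fun j _ => hnn j) (Finset.mem_univ j)
  simp only [h1, one_mul] at this
  exact this

/-- If the slacks sum to zero, the cost is in the row space on the free columns. Otherwise the
phases end with zero potential, fixing large slacks is harmless by proximity, and minimality of the
first dual answer guarantees that a column gets fixed. -/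
theorem RoundInv.next {m n : ℕ} {P : LP m n} {R : RatioOracle m n} (hR : IsRatioOracle P.A R)
    {f x f' x' : Fin n → ℝ} {q : ℝ} {i : ℕ} (hn : 1 ≤ n) (hmn : m ≤ n)
    (hq : 64 * n ^ 5 * circuitImbalance P.A ^ 3 ≤ q) (hinv : RoundInv P i f x)
    {r : RatioAnswer m n}
    (hr : R (Function.support f) P.c (weightsOf fun _ => 1) = some r)
    (hstep : (¬ 0 < f ⬝ᵥ r.s ∧ f' = f ∧ x' = x) ∨ (0 < f ⬝ᵥ r.s ∧ ∃ s' c',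
      PhaseInv P f (fun j => r.s j / (f ⬝ᵥ r.s)) q (m + 1) x' s' c' ∧ f' = fixLarge f s')) :
    RoundInv P (i + 1) f' x' := by
  obtain ⟨-, -, lam, ⟨hlam, hd⟩, hdopt⟩ := (hR _ _ _).2 r hr
  have hw : ∀ j : Fin n, weightsOf (fun _ : Fin n => (1 : ℝ)) j = 1 := fun j => by
    simp [weightsOf]
  have hnn : ∀ j, 0 ≤ f j * r.s j := by
    intro j
    rcases hinv.ind j with h | h
    · rw [h, zero_mul]
    · rw [h, one_mul]
      exact (hd j (by rw [Function.mem_support, h]; exact one_ne_zero)).2.1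
  rcases hstep with ⟨hρ, rfl, rfl⟩ | ⟨hρ, s', c', hphase, rfl⟩
  · refine ⟨hinv.feas, hinv.ind, hinv.off, hinv.opt, Or.inr ⟨-r.y, fun j hj => ?_⟩⟩
    have h0 : f' ⬝ᵥ r.s = 0 := le_antisymm (not_lt.1 hρ) (Finset.sum_nonneg fun j _ => hnn j)
    have h1 := (Finset.sum_eq_zero_iff_of_nonneg fun j _ => hnn j).1 h0 j (Finset.mem_univ j)
    have h2 : r.s j = 0 := (mul_eq_zero.1 h1).resolve_left hj
    have h3 := (hd j hj).1
    rw [Matrix.mulVec_neg, Pi.neg_apply]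
    linarith
  set ρ := f ⬝ᵥ r.s with hρdef
  have hc0 := hphase.finish
  obtain ⟨hx', hoff', ⟨y, δ, hdual⟩, -, hcost, -⟩ := hphase
  have hκ := one_le_circuitImbalance P.A
  set κ := circuitImbalance P.A with hκdef
  have hn1 : (1 : ℝ) ≤ n := by exact_mod_cast hn
  have hmn' : (m : ℝ) ≤ n := by exact_mod_cast hmn
  have hn35 : (n : ℝ) ^ 3 ≤ n ^ 5 := pow_le_pow_right₀ hn1 (by norm_num)
  have hn23 : (n : ℝ) ^ 2 * n = n ^ 3 := by ring
  have hκ3 : κ ≤ κ ^ 3 := le_self_pow₀ hκ (by norm_num)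
  have hbig : 64 * (n ^ 3 * κ) ≤ q := by
    refine le_trans ?_ hq
    have : (n : ℝ) ^ 3 * κ ≤ n ^ 5 * κ ^ 3 := by gcongr
    linarith
  have hn2 : (1 : ℝ) ≤ n ^ 2 := one_le_pow₀ hn1
  have hbig2 : 64 * (n : ℝ) ^ 2 ≤ q := by
    refine le_trans ?_ hbig
    have h1 : (n : ℝ) ^ 2 ≤ n ^ 3 := pow_le_pow_right₀ hn1 (by norm_num)
    have h2 : (n : ℝ) ^ 3 ≤ n ^ 3 * κ := le_mul_of_one_le_right (by positivity) hκ
    linarith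
  have hq0 : 0 < q := by linarith
  -- Dominates both the accumulated truncation, at most `(m + 1) / q`, and the slacks on the support
  -- of `x'`, at most `1 / q`.
  set ε : ℝ := (m + 2) / q with hε
  have hε0 : 0 ≤ ε := by positivity
  have hqε : 1 / q ≤ ε := by
    rw [hε]
    gcongr
    linarith [(Nat.cast_nonneg m : (0 : ℝ) ≤ m)]
  have hsmall : 8 * n ^ 2 * κ * ε ≤ 1 := by
    rw [hε, mul_div_assoc', div_le_one hq0]
    refine le_trans ?_ hbig
    have h1 : (m : ℝ) + 2 ≤ 3 * n := by linarith
    calc 8 * n ^ 2 * κ * (m + 2) ≤ 8 * n ^ 2 * κ * (3 * n) := by gcongr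
      _ = 24 * (n ^ 3 * κ) := by ring
      _ ≤ 64 * (n ^ 3 * κ) := by
        have : 0 ≤ n ^ 3 * κ := by positivity
        linarith
  have hε4 : ε ≤ 1 / (4 * n) := by
    rw [hε, div_le_div_iff₀ hq0 (by positivity)]
    have h1 : (m : ℝ) + 2 ≤ 3 * n := by linarith
    nlinarith
  have hcomp : ∀ j, f j ≠ 0 → x' j ≠ 0 → s' j ≤ 1 / q := by
    intro j hj hxj
    have hcnn := fun j => truncCost_nonneg hq0 hinv.ind s' j
    rw [hcost] at hc0
    have h1 := (Finset.sum_eq_zero_iff_of_nonneg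
      fun j _ => mul_nonneg (hcnn j) (hx'.2 j)).1 hc0 j (Finset.mem_univ j)
    have h2 := (mul_eq_zero.1 h1).resolve_right hxj
    by_contra hcon
    unfold truncCost at h2
    rw [(hinv.ind j).resolve_left hj, mul_one, if_pos (not_le.1 hcon)] at h2
    have : 0 < 1 / q := by positivity
    linarith [not_le.1 hcon]
  have hδε : ∀ j, f j ≠ 0 → δ j ≤ ε := by
    intro j hj
    refine (hdual j hj).2.2.2.trans ?_
    rw [hε]
    push_cast
    gcongr
    linarith
  have hcs : ∀ j, f j ≠ 0 → P.c j = ρ * (s' j + δ j) + (P.Aᵀ *ᵥ (-r.y - ρ • y)) j := by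
    intro j hj
    have h1 := (hdual j hj).1
    have h2 := (hd j hj).1
    rw [Matrix.mulVec_sub, Matrix.mulVec_neg, Matrix.mulVec_smul, Pi.sub_apply, Pi.neg_apply,
      Pi.smul_apply, smul_eq_mul, h1]
    have h3 : ρ * (r.s j / ρ) = r.s j := by field_simp
    rw [mul_add, h3, h2]
    ring
  have hfix : ∀ j, fixLarge f s' j = 0 ↔ f j = 0 ∨ 1 / (4 * n) < s' j := by
    intro j
    unfold fixLarge
    split_ifs with h
    · exact ⟨fun _ => Or.inr h, fun _ => rfl⟩
    · exact ⟨Or.inl, fun h' => h'.resolve_right h⟩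
  refine ⟨hx', fun j => ?_, fun j hj => ?_, fun u hu => ?_, ?_⟩
  · unfold fixLarge
    split_ifs
    · exact Or.inl rfl
    · exact hinv.ind j
  · by_cases hfj : f j = 0
    · exact hoff' j hfj
    by_contra hne
    have h1 := hcomp j hfj hne
    rcases (hfix j).1 hj with h | h
    · exact hfj h
    · linarith
  · obtain ⟨u₁, hu₁, hoff₁, hle₁⟩ := hinv.opt u hu
    obtain ⟨u₂, hu₂, hoff₂, hle₂⟩ := exists_feasible_restricted P (F := Function.support f)
      hρ.le hε0 hx' (fun j hj => hoff' j (by simpa using hj)) hcs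
      (fun j hj => (hdual j hj).2.1) (fun j hj => (hdual j hj).2.2.1) hδε
      (fun j hj hxj => (hcomp j hj hxj).trans hqε) hsmall hu₁
      (fun j hj => hoff₁ j (by simpa using hj))
    refine ⟨u₂, hu₂, fun j hj => hoff₂ j ?_, hle₂.trans hle₁⟩
    rintro ⟨h1, h2⟩
    rcases (hfix j).1 hj with h | h
    · exact h1 h
    · exact absurd h (not_lt.2 h2)
  · have hsub : Function.support (fixLarge f s') ⊆ Function.support f := by
      intro j hj hfj
      exact hj ((hfix j).2 (Or.inl hfj))
    rcases hinv.prog with h | ⟨y', hy'⟩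
    · left
      -- Otherwise `ρ * (s' + δ)` would be a dual solution with entries at most `ρ / (2 n)`, while
      -- the minimal largest slack `lam` is at least the average `ρ / n`.
      obtain ⟨j, hfj, hsj⟩ : ∃ j, f j ≠ 0 ∧ 1 / (4 * n) < s' j := by
        by_contra hcon
        push Not at hcon
        have h1 : lam ≤ ρ * (1 / (2 * n)) := by
          refine hdopt (r.y + ρ • y) (fun j => ρ * (s' j + δ j)) _ ⟨by positivity,
            fun j hj => ⟨?_, ?_, fun _ => ?_⟩⟩
          · have := hcs j hj
            have h3 : P.Aᵀ *ᵥ (-r.y - ρ • y) = -(P.Aᵀ *ᵥ (r.y + ρ • y)) := by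
              rw [← Matrix.mulVec_neg]
              congr 1
              abel
            rw [h3, Pi.neg_apply] at this
            linarith
          · have h3 := (hdual j hj).2.1
            have h4 := (hdual j hj).2.2.1
            positivity
          · rw [hw, ENNReal.toReal_one, mul_one]
            have h3 := hcon j hj
            have h4 : δ j ≤ 1 / (4 * n) := (hδε j hj).trans hε4
            have h5 : 1 / (4 * (n : ℝ)) + 1 / (4 * n) = 1 / (2 * n) := by
              field_simp
              norm_num
            exact mul_le_mul_of_nonneg_left (by linarith) hρ.le
        have h2 : ρ ≤ n * lam := by
          calc ρ ≤ ∑ _j : Fin n, lam := by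
                refine Finset.sum_le_sum fun j _ => ?_
                rcases hinv.ind j with h0 | h0
                · rw [h0, zero_mul]
                  exact hlam
                · have h3 := (hd j (by rw [Function.mem_support, h0]; exact one_ne_zero)).2.2
                  rw [hw, ENNReal.toReal_one, mul_one] at h3
                  rw [h0, one_mul]
                  exact h3 ENNReal.one_ne_top
            _ = n * lam := by
                rw [Finset.sum_const, Finset.card_univ, Fintype.card_fin, nsmul_eq_mul]
        have h3 : n * (ρ * (1 / (2 * (n : ℝ)))) = ρ / 2 := by
          field_simp
        have h4 : n * lam ≤ n * (ρ * (1 / (2 * (n : ℝ)))) := by gcongr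
        linarith
      have hlt : (Function.support (fixLarge f s')).ncard < (Function.support f).ncard := by
        refine Set.ncard_lt_ncard ⟨hsub, fun hsup => ?_⟩ (Set.toFinite _)
        exact hsup (show j ∈ Function.support f from hfj) ((hfix j).2 (Or.inr hsj))
      omega
    · exact Or.inr ⟨y', fun j hj => hy' j (hsub hj)⟩

/-! ### Reasoning about programs -/

/-- `p` halts from `σ` after at most `t` instructions and `k` ratio calls, without steps along
support circuits, in a state that satisfies `Q`. -/
def Runs {m n : ℕ} (P : LP m n) (R : RatioOracle m n) (O : SupportOracle n) (p : Program)
    (σ : State n) (t k : ℕ) (Q : State n → Prop) : Prop :=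
  ∃ τ, Exec P R O p σ τ ∧ τ.time ≤ σ.time + t ∧ τ.ratioCalls ≤ σ.ratioCalls + k ∧
    τ.supportSteps = σ.supportSteps ∧ Q τ

section

variable {m n : ℕ} {P : LP m n} {R : RatioOracle m n} {O : SupportOracle n}

theorem Runs.mono {p : Program} {σ : State n} {t t' k k' : ℕ} {Q Q' : State n → Prop}
    (h : Runs P R O p σ t k Q) (ht : t ≤ t') (hk : k ≤ k') (hQ : ∀ τ, Q τ → Q' τ) :
    Runs P R O p σ t' k' Q' := by
  obtain ⟨τ, h1, h2, h3, h4, h5⟩ := h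
  exact ⟨τ, h1, by omega, by omega, h4, hQ τ h5⟩

theorem Runs.seq {p q : Program} {σ : State n} {t₁ t₂ k₁ k₂ : ℕ} {Q₁ Q : State n → Prop}
    (hp : Runs P R O p σ t₁ k₁ Q₁) (hq : ∀ τ, Q₁ τ → Runs P R O q τ t₂ k₂ Q) :
    Runs P R O (.seq p q) σ (t₁ + t₂) (k₁ + k₂) Q := by
  obtain ⟨τ, h1, h2, h3, h4, h5⟩ := hp
  obtain ⟨υ, g1, g2, g3, g4, g5⟩ := hq τ h5
  exact ⟨υ, .seq _ _ _ _ _ h1 g1, by omega, by omega, by omega, g5⟩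

theorem Runs.skip {σ : State n} {Q : State n → Prop} (h : Q σ.tick) :
    Runs P R O .skip σ 1 0 Q :=
  ⟨_, .skip σ, le_rfl, le_rfl, rfl, h⟩

theorem Runs.setNat {v : ℕ} {e : NExpr} {σ : State n} {Q : State n → Prop}
    (h : Q (σ.tick.setNat v (e.eval σ))) : Runs P R O (.setNat v e) σ 1 0 Q :=
  ⟨_, .setNat v e σ, le_rfl, le_rfl, rfl, h⟩

theorem Runs.setReal {a : ℕ} {i j : NExpr} {e : RExpr} {σ : State n} {Q : State n → Prop}
    (h : Q (σ.tick.setReal a (i.eval σ) (j.eval σ) (e.eval σ))) :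
    Runs P R O (.setReal a i j e) σ 1 0 Q :=
  ⟨_, .setReal a i j e σ, le_rfl, le_rfl, rfl, h⟩

theorem Runs.branch {b : BExpr} {p q : Program} {σ : State n} {t k : ℕ} {Q : State n → Prop}
    (hp : b.Holds σ → Runs P R O p σ.tick t k Q) (hq : ¬ b.Holds σ → Runs P R O q σ.tick t k Q) :
    Runs P R O (.branch b p q) σ (t + 1) k Q := by
  have key : ∀ p', Runs P R O p' σ.tick t k Q → (∀ τ, Exec P R O p' σ.tick τ →
      Exec P R O (.branch b p q) σ τ) → Runs P R O (.branch b p q) σ (t + 1) k Q := by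
    rintro p' ⟨τ, h1, h2, h3, h4, h5⟩ hex
    refine ⟨τ, hex τ h1, ?_, h3, h4, h5⟩
    have : σ.tick.time = σ.time + 1 := rfl
    omega
  by_cases hb : b.Holds σ
  · exact key p (hp hb) fun τ h => .branchTrue _ _ _ _ _ hb h
  · exact key q (hq hb) fun τ h => .branchFalse _ _ _ _ _ hb h

theorem Runs.ratio {d w f z y s v : ℕ} {σ : State n} {r : RatioAnswer m n} {Q : State n → Prop}
    (hr : R (Function.support (σ.vec f)) (σ.vec d) (weightsOf (σ.vec w)) = some r)
    (h : Q (σ.tick.afterRatio z y s v (some r))) :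
    Runs P R O (.ratio d w f z y s v) σ 1 1 Q := by
  have h1 := Exec.ratio (P := P) (R := R) (O := O) d w f z y s v σ
  have h2 : R (σ.idx f) (σ.vec d) (σ.weights w) = some r := hr
  rw [h2] at h1
  exact ⟨_, h1, le_rfl, le_rfl, rfl, h⟩

theorem NExpr.eval_tick (e : NExpr) (σ : State n) : e.eval σ.tick = e.eval σ := by
  induction e with
  | const k => rfl
  | var v => rfl
  | add e f he hf => simp only [NExpr.eval, he, hf]
  | sub e f he hf => simp only [NExpr.eval, he, hf]
  | mul e f he hf => simp only [NExpr.eval, he, hf]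

theorem RExpr.eval_tick (e : RExpr) (σ : State n) : e.eval σ.tick = e.eval σ := by
  induction e with
  | const k => rfl
  | read a i j =>
    simp only [RExpr.eval, NExpr.eval_tick]
    rfl
  | ofNat e => simp only [RExpr.eval, NExpr.eval_tick]
  | add e f he hf => simp only [RExpr.eval, he, hf]
  | sub e f he hf => simp only [RExpr.eval, he, hf]
  | mul e f he hf => simp only [RExpr.eval, he, hf]
  | div e f he hf => simp only [RExpr.eval, he, hf]

theorem BExpr.holds_tick (b : BExpr) (σ : State n) : b.Holds σ.tick ↔ b.Holds σ := by
  induction b with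
  | natLT e f => simp only [BExpr.Holds, NExpr.eval_tick]
  | realLT e f => simp only [BExpr.Holds, RExpr.eval_tick]
  | not t ht => simp only [BExpr.Holds, ht]
  | and t u ht hu => simp only [BExpr.Holds, ht, hu]

/-- A loop whose measure decreases. -/
theorem Runs.loop {b : BExpr} {p : Program} {t k : ℕ} (I : State n → Prop) (μ : State n → ℕ)
    (hI : ∀ τ, I τ → I τ.tick) (hμ : ∀ τ, μ τ.tick = μ τ)
    (hstep : ∀ τ, I τ → b.Holds τ → Runs P R O p τ t k fun υ => I υ ∧ μ υ < μ τ)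
    {σ : State n} (hσ : I σ) :
    Runs P R O (.loop b p) σ (μ σ * (t + 1) + 1) (μ σ * k) fun τ => I τ ∧ ¬ b.Holds τ := by
  have key : ∀ N : ℕ, ∀ σ, μ σ ≤ N → I σ →
      Runs P R O (.loop b p) σ (μ σ * (t + 1) + 1) (μ σ * k) fun τ => I τ ∧ ¬ b.Holds τ := by
    intro N
    induction N with
    | zero =>
      intro σ hN hσ
      by_cases hbσ : b.Holds σ
      · obtain ⟨υ, -, -, -, -, -, h⟩ := hstep σ hσ hbσ
        omega
      · exact ⟨_, .loopDone b p σ hbσ, by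
          have : σ.tick.time = σ.time + 1 := rfl
          omega, Nat.le_add_right _ _, rfl, hI σ hσ, fun h => hbσ ((b.holds_tick σ).1 h)⟩
    | succ N ih =>
      intro σ hN hσ
      by_cases hbσ : b.Holds σ
      · obtain ⟨τ, h1, h2, h3, h4, h5, h6⟩ := hstep σ.tick (hI σ hσ) ((b.holds_tick σ).2 hbσ)
        rw [hμ] at h6
        obtain ⟨υ, g1, g2, g3, g4, g5⟩ := ih τ (by omega) h5
        refine ⟨υ, .loopStep b p σ τ υ hbσ h1 g1, ?_, ?_, by rw [g4, h4]; rfl, g5⟩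
        · have e1 : σ.tick.time = σ.time + 1 := rfl
          have e2 : (μ τ + 1) * (t + 1) ≤ μ σ * (t + 1) := Nat.mul_le_mul_right _ h6
          have e3 : (μ τ + 1) * (t + 1) = μ τ * (t + 1) + (t + 1) := by ring
          omega
        · have e1 : σ.tick.ratioCalls = σ.ratioCalls := rfl
          have e2 : (μ τ + 1) * k ≤ μ σ * k := Nat.mul_le_mul_right _ h6
          have e3 : (μ τ + 1) * k = μ τ * k + k := by ring
          omega
      · exact ⟨_, .loopDone b p σ hbσ, by
          have : σ.tick.time = σ.time + 1 := rfl
          omega, Nat.le_add_right _ _, rfl, hI σ hσ, fun h => hbσ ((b.holds_tick σ).1 h)⟩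
  exact key _ σ le_rfl hσ

/-- Run `p` for the values `0, …, e - 1` of the variable `v`. -/
def forLoop (v : ℕ) (e : NExpr) (p : Program) : Program :=
  .seq (.setNat v (.const 0))
    (.loop (.natLT (.var v) e) (.seq p (.setNat v (.add (.var v) (.const 1)))))

/-- Each pass adds one test and one increment to the body; the initialization and the last test give
the final `2`. The body must restore the loop variable. -/
theorem Runs.forLoop {v : ℕ} {e : NExpr} {p : Program} {t k N : ℕ} (I : ℕ → State n → Prop)
    (hI : ∀ i τ, I i τ → I i τ.tick) (hN : ∀ i τ, I i τ → e.eval τ = N)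
    (hstep : ∀ i τ, i < N → τ.nat v = i → I i τ →
      Runs P R O p τ t k fun υ => υ.nat v = i ∧ I (i + 1) (υ.setNat v (i + 1)))
    {σ : State n} (hσ : I 0 (σ.setNat v 0)) :
    Runs P R O (forLoop v e p) σ (N * (t + 2) + 2) (N * k) fun τ => I N τ := by
  have h0 : Runs P R O (.setNat v (.const 0)) σ 1 0
      fun τ => τ = (σ.setNat v 0).tick := Runs.setNat rfl
  have h1 := h0.seq (q := .loop (.natLT (.var v) e) (.seq p (.setNat v (.add (.var v) (.const 1)))))
    (t₂ := N * (t + 1 + 1) + 1) (k₂ := N * k) (Q := fun τ => I N τ) ?_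
  · exact h1.mono (by ring_nf; omega) (by omega) fun _ h => h
  rintro τ rfl
  set τ₀ := (σ.setNat v 0).tick with hτ₀
  have hv0 : τ₀.nat v = 0 := by simp [hτ₀, State.tick, State.setNat]
  have h2 := Runs.loop (P := P) (R := R) (O := O) (b := .natLT (.var v) e)
    (p := .seq p (.setNat v (.add (.var v) (.const 1)))) (t := t + 1) (k := k)
    (fun τ => τ.nat v ≤ N ∧ I (τ.nat v) τ) (fun τ => N - τ.nat v)
    (fun τ h => ⟨h.1, hI _ _ h.2⟩) (fun τ => rfl) ?_ (σ := τ₀)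
    ⟨by rw [hv0]; exact Nat.zero_le _, by rw [hv0]; exact hI _ _ hσ⟩
  · rw [hv0, Nat.sub_zero] at h2
    refine h2.mono le_rfl le_rfl ?_
    rintro τ ⟨⟨h3, h4⟩, h5⟩
    have h6 := hN _ _ h4
    simp only [BExpr.Holds, NExpr.eval, h6, not_lt] at h5
    have : τ.nat v = N := le_antisymm h3 h5
    rwa [this] at h4
  · rintro τ ⟨h3, h4⟩ h5
    have h6 := hN _ _ h4
    simp only [BExpr.Holds, NExpr.eval, h6] at h5
    have h7 := (hstep _ τ h5 rfl h4).seq (q := .setNat v (.add (.var v) (.const 1)))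
      (t₂ := 1) (k₂ := 0)
      (Q := fun υ => (υ.nat v ≤ N ∧ I (υ.nat v) υ) ∧ N - υ.nat v < N - τ.nat v) ?_
    · exact h7
    · rintro υ ⟨h8, h9⟩
      refine Runs.setNat ?_
      have e1 : (NExpr.add (.var v) (.const 1)).eval υ = τ.nat v + 1 := by
        simp [NExpr.eval, h8]
      rw [e1]
      have e2 : (υ.tick.setNat v (τ.nat v + 1)).nat v = τ.nat v + 1 := by simp [State.setNat]
      rw [e2]
      exact ⟨⟨h5, hI _ _ h9⟩, by omega⟩

/-! ### Frame conditions and columnwise assignments. -/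

/-- Only the arrays in `as` and the variables in `vs` have changed. -/
def Frame (as vs : List ℕ) (σ τ : State n) : Prop :=
  (∀ a, a ∉ as → τ.real a = σ.real a) ∧ ∀ v, v ∉ vs → τ.nat v = σ.nat v

theorem Frame.trans {as vs : List ℕ} {σ τ υ : State n} (h : Frame as vs σ τ)
    (h' : Frame as vs τ υ) : Frame as vs σ υ :=
  ⟨fun a ha => (h'.1 a ha).trans (h.1 a ha), fun v hv => (h'.2 v hv).trans (h.2 v hv)⟩

theorem Frame.mono {as as' vs vs' : List ℕ} {σ τ : State n} (h : Frame as vs σ τ)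
    (has : as ⊆ as') (hvs : vs ⊆ vs') : Frame as' vs' σ τ :=
  ⟨fun a ha => h.1 a fun h => ha (has h), fun v hv => h.2 v fun h => hv (hvs h)⟩

theorem Frame.vec {as vs : List ℕ} {σ τ : State n} (h : Frame as vs σ τ) {a : ℕ} (ha : a ∉ as) :
    τ.vec a = σ.vec a := by
  funext j
  exact congrFun (congrFun (h.1 a ha) 0) j

/-- For all columns `j`, write to entry `j` of the array `a` the value of `e` if `b` holds, and
the value of `f` otherwise. The variable `5` runs through the columns. -/
def assign (a : ℕ) (b : BExpr) (e f : RExpr) : Program :=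
  forLoop 5 (.var 2) (.branch b (.setReal a (.const 0) (.var 5) e)
    (.setReal a (.const 0) (.var 5) f))

/-- Entry `j` still has its old value when it is overwritten, so the expressions may read it and
arrays can be updated in place. -/
theorem runs_assign {a : ℕ} {b : BExpr} {e f : RExpr} {σ : State n} (hn : σ.nat 2 = n)
    (g : Fin n → ℝ)
    (hg : ∀ (j : Fin n) (τ : State n), τ.nat 5 = j → Frame [a] [5] σ τ → τ.vec a j = σ.vec a j →
      (b.Holds τ → e.eval τ = g j) ∧ (¬ b.Holds τ → f.eval τ = g j)) :
    Runs P R O (assign a b e f) σ (4 * n + 2) 0 fun τ =>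
      Frame [a] [5] σ τ ∧ τ.x = σ.x ∧ τ.dir = σ.dir ∧ τ.vec a = g := by
  have h := Runs.forLoop (P := P) (R := R) (O := O) (v := 5) (e := .var 2)
    (p := .branch b (.setReal a (.const 0) (.var 5) e) (.setReal a (.const 0) (.var 5) f))
    (t := 2) (k := 0) (N := n)
    (fun i τ => Frame [a] [5] σ τ ∧ τ.x = σ.x ∧ τ.dir = σ.dir ∧
      (∀ j : Fin n, (j : ℕ) < i → τ.vec a j = g j) ∧
      ∀ j : Fin n, i ≤ j → τ.vec a j = σ.vec a j)
    (fun i τ h => h) ?_ ?_ (σ := σ) ?_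
  · refine h.mono (by omega) (by omega) ?_
    rintro τ ⟨h1, h2, h3, h4, -⟩
    exact ⟨h1, h2, h3, funext fun j => h4 j j.2⟩
  · rintro i τ ⟨h1, -⟩
    simp only [NExpr.eval]
    rw [h1.2 2 (by simp), hn]
  · rintro i τ hi hv ⟨h1, h2, h3, h4, h5⟩
    have hfin : ∀ r : ℝ, r = g ⟨i, hi⟩ → (fun υ : State n => υ.nat 5 = i ∧
        (Frame [a] [5] σ (υ.setNat 5 (i + 1)) ∧ (υ.setNat 5 (i + 1)).x = σ.x ∧
        (υ.setNat 5 (i + 1)).dir = σ.dir ∧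
        (∀ j : Fin n, (j : ℕ) < i + 1 → (υ.setNat 5 (i + 1)).vec a j = g j) ∧
        ∀ j : Fin n, i + 1 ≤ j → (υ.setNat 5 (i + 1)).vec a j = σ.vec a j))
        ((τ.tick.tick).setReal a 0 i r) := by
      rintro r rfl
      refine ⟨hv, ⟨fun a' ha' => ?_, fun v hv' => ?_⟩, h2, h3, fun j hj => ?_, fun j hj => ?_⟩
      · have hne : a' ≠ a := by simpa using ha'
        rw [← h1.1 a' ha']
        funext i' j'
        simp [State.setNat, State.setReal, State.tick, hne]
      · have hne : v ≠ 5 := by simpa using hv'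
        rw [← h1.2 v hv']
        simp [State.setNat, State.setReal, State.tick, hne]
      · by_cases hji : (j : ℕ) = i
        · have : j = ⟨i, hi⟩ := Fin.ext hji
          simp [State.vec, State.setNat, State.setReal, this]
        · rw [← h4 j (by omega)]
          simp [State.vec, State.setNat, State.setReal, State.tick, hji]
      · have hji : (j : ℕ) ≠ i := by omega
        rw [← h5 j (by omega)]
        simp [State.vec, State.setNat, State.setReal, State.tick, hji]
    have hgi := hg ⟨i, hi⟩ τ.tick hv h1 (h5 _ le_rfl)
    refine Runs.branch (fun hb => ?_) (fun hb => ?_)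
    · refine (Runs.setReal ?_).mono le_rfl le_rfl fun _ h => h
      have e1 : (NExpr.var 5).eval τ.tick = i := hv
      rw [e1]
      exact hfin _ (hgi.1 ((b.holds_tick τ).2 hb))
    · refine (Runs.setReal ?_).mono le_rfl le_rfl fun _ h => h
      have e1 : (NExpr.var 5).eval τ.tick = i := hv
      rw [e1]
      exact hfin _ (hgi.2 fun h => hb ((b.holds_tick τ).1 h))
  · exact ⟨⟨fun _ _ => rfl, fun v hv => by
      have hne : v ≠ 5 := by simpa using hv
      simp [State.setNat, hne]⟩, rfl, rfl, fun j hj => absurd hj (Nat.not_lt_zero _),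
      fun _ _ => rfl⟩

/-! ### Improvement steps -/

/-- The entry of the array `a` at the current column. -/
def entry (a : ℕ) : RExpr := .read a (.const 0) (.var 5)

/-- The first entry of the array `a`. -/
def scalar (a : ℕ) : RExpr := .read a (.const 0) (.const 0)

theorem eval_entry {a : ℕ} {τ : State n} {j : Fin n} (h : τ.nat 5 = j) :
    (entry a).eval τ = τ.vec a j := by
  simp [entry, RExpr.eval, NExpr.eval, State.vec, h]

theorem eval_scalar (a : ℕ) (τ : State n) : (scalar a).eval τ = τ.real a 0 0 := rfl

/-- The test that always succeeds. -/
def always : BExpr := .natLT (.const 0) (.const 1)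

/-- Write to entry `j` of the array `a` the value of `e`. -/
def assignAll (a : ℕ) (e : RExpr) : Program := assign a always e e

theorem runs_assignAll {a : ℕ} {e : RExpr} {σ : State n} (hn : σ.nat 2 = n)
    (g : Fin n → ℝ)
    (hg : ∀ (j : Fin n) (τ : State n), τ.nat 5 = j → Frame [a] [5] σ τ → τ.vec a j = σ.vec a j →
      e.eval τ = g j) :
    Runs P R O (assignAll a e) σ (4 * n + 2) 0 fun τ =>
      Frame [a] [5] σ τ ∧ τ.x = σ.x ∧ τ.dir = σ.dir ∧ τ.vec a = g :=
  runs_assign hn g fun j τ h1 h2 h3 => ⟨fun _ => hg j τ h1 h2 h3, fun _ => hg j τ h1 h2 h3⟩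

/-- Store the scalar product of the arrays `a` and `b` in the array `12`. -/
def dot (a b : ℕ) : Program :=
  .seq (.setReal 12 (.const 0) (.const 0) (.const 0))
    (forLoop 5 (.var 2) (.setReal 12 (.const 0) (.const 0)
      (.add (scalar 12) (.mul (entry a) (entry b)))))

theorem runs_dot {a b : ℕ} {σ : State n} (hn : σ.nat 2 = n) (ha : a ≠ 12) (hb : b ≠ 12) :
    Runs P R O (dot a b) σ (3 * n + 3) 0 fun τ =>
      Frame [12] [5] σ τ ∧ τ.x = σ.x ∧ τ.dir = σ.dir ∧
        τ.real 12 0 0 = σ.vec a ⬝ᵥ σ.vec b := by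
  have h0 : Runs P R O (.setReal 12 (.const 0) (.const 0) (.const 0)) σ 1 0
      fun τ => τ = (σ.tick.setReal 12 0 0 0) := Runs.setReal (by simp [RExpr.eval, NExpr.eval])
  have h := h0.seq (q := forLoop 5 (.var 2) (.setReal 12 (.const 0) (.const 0)
      (.add (scalar 12) (.mul (entry a) (entry b))))) (t₂ := n * (1 + 2) + 2) (k₂ := n * 0)
      (Q := fun τ => Frame [12] [5] σ τ ∧ τ.x = σ.x ∧ τ.dir = σ.dir ∧
        τ.real 12 0 0 = ∑ j ∈ Finset.range n, σ.real a 0 j * σ.real b 0 j) ?_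
  · refine h.mono (by omega) (by omega) ?_
    rintro τ ⟨h1, h2, h3, h4⟩
    refine ⟨h1, h2, h3, ?_⟩
    rw [h4, Finset.sum_range]
    rfl
  rintro τ₀ rfl
  refine Runs.forLoop (N := n) (fun i τ => Frame [12] [5] σ τ ∧ τ.x = σ.x ∧ τ.dir = σ.dir ∧
    τ.real 12 0 0 = ∑ j ∈ Finset.range i, σ.real a 0 j * σ.real b 0 j) (fun i τ h => h) ?_ ?_ ?_
  · rintro i τ ⟨h1, -⟩
    simp only [NExpr.eval]
    rw [h1.2 2 (by simp), hn]
  · rintro i τ hi hv ⟨h1, h2, h3, h4⟩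
    refine Runs.setReal ?_
    have ea : (entry a).eval τ = σ.real a 0 i := by
      rw [← h1.1 a (by simpa using ha)]
      simp [entry, RExpr.eval, NExpr.eval, hv]
    have eb : (entry b).eval τ = σ.real b 0 i := by
      rw [← h1.1 b (by simpa using hb)]
      simp [entry, RExpr.eval, NExpr.eval, hv]
    simp only [RExpr.eval, NExpr.eval, eval_scalar, ea, eb, h4]
    refine ⟨hv, ⟨fun a' ha' => ?_, fun v hv' => ?_⟩, h2, h3, ?_⟩
    · have hne : a' ≠ 12 := by simpa using ha'
      rw [← h1.1 a' ha']
      funext i' j'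
      simp [State.setNat, State.setReal, State.tick, hne]
    · have hne : v ≠ 5 := by simpa using hv'
      rw [← h1.2 v hv']
      simp [State.setNat, State.setReal, State.tick, hne]
    · rw [Finset.sum_range_succ]
      simp [State.setNat, State.setReal]
  · refine ⟨⟨fun a' ha' => ?_, fun v hv' => ?_⟩, rfl, rfl, ?_⟩
    · have hne : a' ≠ 12 := by simpa using ha'
      funext i' j'
      simp [State.setNat, State.setReal, State.tick, hne]
    · have hne : v ≠ 5 := by simpa using hv'
      simp [State.setNat, State.setReal, State.tick, hne]
    · simp [State.setNat, State.setReal]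

theorem vec_writeVec {σ : State n} {a : ℕ} (v : Fin n → ℝ) : (σ.writeVec a v).vec a = v := by
  funext j
  simp [State.vec, State.writeVec]

theorem real_writeVec {k : ℕ} {σ : State n} {a b : ℕ} (v : Fin k → ℝ) (h : b ≠ a) :
    (σ.writeVec a v).real b = σ.real b := by
  funext i j
  simp [State.writeVec, h]

/-- A call of the ratio oracle. -/
theorem runs_ratio {d w f z y s v : ℕ} {σ : State n} {r : RatioAnswer m n}
    (hr : R (Function.support (σ.vec f)) (σ.vec d) (weightsOf (σ.vec w)) = some r)
    (hzy : z ≠ y) (hzs : z ≠ s) :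
    Runs P R O (.ratio d w f z y s v) σ 1 1 fun τ =>
      Frame [z, y, s] [v] σ τ ∧ τ.x = σ.x ∧ τ.dir = .fromRatio r.z ∧ τ.vec z = r.z ∧
        τ.vec s = r.s ∧ τ.nat v = 1 := by
  refine Runs.ratio hr ⟨⟨fun a ha => ?_, fun u hu => ?_⟩, rfl, rfl, ?_, ?_, ?_⟩
  · simp only [List.mem_cons, List.not_mem_nil, or_false, not_or] at ha
    obtain ⟨h1, h2, h3⟩ := ha
    show (((σ.tick.writeVec z r.z).writeVec y r.y).writeVec s r.s).real a = σ.real a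
    rw [real_writeVec _ h3, real_writeVec _ h2, real_writeVec _ h1]
    rfl
  · have hne : u ≠ v := by simpa using hu
    show (if u = v then 1 else σ.nat u) = σ.nat u
    rw [if_neg hne]
  · funext j
    show (((σ.tick.writeVec z r.z).writeVec y r.y).writeVec s r.s).real z 0 j = r.z j
    rw [real_writeVec _ hzs, real_writeVec _ hzy]
    exact congrFun (vec_writeVec r.z) j
  · exact vec_writeVec (σ := (σ.tick.writeVec z r.z).writeVec y r.y) r.s
  · show (if v = v then 1 else σ.nat v) = 1
    rw [if_pos rfl]

/-- Call the ratio oracle with weights `1 / x` for the cost `d` and the columns `f`, and compute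
the cost of the answer. -/
def consult (d f : ℕ) : Program :=
  .seq (assignAll 9 (.add (.div (.const 1) (entry 3))
      (.sub (.div (entry 3) (entry 3)) (.const 1))))
    (.seq (.ratio d 9 f 7 8 15 3) (dot d 7))

/-- The slacks of this call go to the array `15`, so those of the current phase in the array `6`
survive. The oracle's direction remains available for an augmentation. -/
theorem runs_consult {d f : ℕ} {σ : State n} (hn : σ.nat 2 = n)
    (hd : d ∉ [7, 8, 9, 12, 15]) (hf : f ≠ 9) {r : RatioAnswer m n}
    (hr : R (Function.support (σ.vec f)) (σ.vec d) (weightsOf (invWeights (σ.vec 3))) = some r) :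
    Runs P R O (consult d f) σ (7 * n + 6) 1 fun τ =>
      Frame [7, 8, 9, 12, 15] [3, 5] σ τ ∧ τ.x = σ.x ∧ τ.dir = .fromRatio r.z ∧
        τ.real 12 0 0 = σ.vec d ⬝ᵥ r.z := by
  have hd9 : d ≠ 9 := fun h => hd (by simp [h])
  have hd7 : d ≠ 7 := fun h => hd (by simp [h])
  have hd12 : d ≠ 12 := fun h => hd (by simp [h])
  refine ((runs_assignAll hn (invWeights (σ.vec 3)) ?_).seq (t₂ := 1 + (3 * n + 3)) (k₂ := 1 + 0)
    (Q := fun τ =>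
      Frame [7, 8, 9, 12, 15] [3, 5] σ τ ∧ τ.x = σ.x ∧ τ.dir = .fromRatio r.z ∧
        τ.real 12 0 0 = σ.vec d ⬝ᵥ r.z) ?_).mono (by omega) (by omega) fun _ h => h
  · intro j τ hj hfr _
    simp only [RExpr.eval, eval_entry hj, hfr.vec (by decide : 3 ∉ [9]), invWeights]
    norm_num
  · rintro τ ⟨h1, h2, -, h4⟩
    refine (runs_ratio (r := r) ?_ (by norm_num) (by norm_num)).seq ?_
    · rw [h4, h1.vec (by simpa using hf), h1.vec (by simpa using hd9)]
      exact hr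
    · rintro υ ⟨g1, g2, g3, g4, -, -⟩
      refine (runs_dot ?_ hd12 (by norm_num)).mono le_rfl le_rfl ?_
      · rw [g1.2 2 (by decide), h1.2 2 (by decide), hn]
      · rintro ω ⟨k1, k2, k3, k4⟩
        refine ⟨((h1.mono (by decide) (by decide)).trans (g1.mono (by decide) (by decide))).trans
          (k1.mono (by decide) (by decide)), by rw [k2, g2, h2], by rw [k3, g3], ?_⟩
        rw [k4, g4, g1.vec (fun h => hd (by
          simp only [List.mem_cons, List.not_mem_nil, or_false] at h ⊢
          tauto)), h1.vec (by simpa using hd9)]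

/-- The part of the state that all pieces of the algorithm rely on; `K` is the logarithm of the
current guess. -/
structure Base (P : LP m n) (K : ℕ) (σ : State n) : Prop where
  flag : σ.nat 0 = 0
  rows : σ.nat 1 = m
  cols : σ.nat 2 = n
  guess : σ.nat 4 = K
  pow : σ.real 13 0 0 = 2 ^ K
  cost : σ.vec 2 = P.c
  sol : σ.vec 3 = σ.x
  feas : P.Feasible σ.x

/-- Memory layout: `2` cost, `3` solution, `4` free columns, `5` truncated cost, `6` slacks, `7` and
`8` oracle answers, `9` weights, `10` all ones, `11` tail of the cost, `12` scalar product, `13`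
guess `q`, `14` the value `η`. -/
theorem Base.frame {K : ℕ} {σ τ : State n} (h : Base P K σ) {as vs : List ℕ}
    (hfr : Frame as vs σ τ) (hx : τ.x = σ.x) (has : ∀ a ∈ [2, 3, 13], a ∉ as)
    (hvs : ∀ v ∈ [0, 1, 2, 4], v ∉ vs) : Base P K τ :=
  ⟨(hfr.2 0 (hvs 0 (by decide))).trans h.flag, (hfr.2 1 (hvs 1 (by decide))).trans h.rows,
    (hfr.2 2 (hvs 2 (by decide))).trans h.cols, (hfr.2 4 (hvs 4 (by decide))).trans h.guess,
    by rw [hfr.1 13 (has 13 (by decide)), h.pow],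
    (hfr.vec (has 2 (by decide))).trans h.cost,
    by rw [hfr.vec (has 3 (by decide)), h.sol, hx], by rw [hx]; exact h.feas⟩

/-- `x'` results from `x` by a maximal step along an answer of the ratio oracle that improves the
cost `d` and is supported in `F`. -/
structure Improved (P : LP m n) (F : Set (Fin n)) (d x x' : Fin n → ℝ) : Prop where
  out : ∃ (z : Fin n → ℝ) (α : ℝ), 1 ≤ α ∧ x' = x + α • z ∧ IsElementary P.A z ∧
    (∀ j, j ∉ F → z j = 0) ∧ (∃ i, x i ≠ 0 ∧ x' i = 0) ∧ (∃ j, 0 < d j ∧ z j < 0) ∧ d ⬝ᵥ z < 0 ∧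
    (∀ z', RatioFeasible P.A F (weightsOf (invWeights x)) z' → d ⬝ᵥ z ≤ d ⬝ᵥ z')
  feas : P.Feasible x'

/-- Consult the oracle, and augment if the answer improves the cost. -/
def improve (d f : ℕ) (els : Program) : Program :=
  .seq (consult d f) (.branch (.realLT (scalar 12) (.const 0)) (.augment 3) els)

/-- A nonnegative cost keeps the system bounded, so the oracle answers. A strictly improving answer
is elementary and has a maximal step by `exists_maxStep`, so the augmentation cannot block. -/
theorem runs_improve (hR : IsRatioOracle P.A R) {K d f t k : ℕ} {els : Program} {σ : State n}
    {Q : State n → Prop} (hσ : Base P K σ) (hd : d ∉ [7, 8, 9, 12, 15]) (hf : f ≠ 9)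
    (hels : ∀ τ z, Frame [7, 8, 9, 12, 15] [3, 5] σ τ → τ.x = σ.x → 0 ≤ σ.vec d ⬝ᵥ z →
      (∀ z', RatioFeasible P.A (Function.support (σ.vec f)) (weightsOf (invWeights σ.x)) z' →
        σ.vec d ⬝ᵥ z ≤ σ.vec d ⬝ᵥ z') → Runs P R O els τ t k Q)
    (hd0 : ∀ j, σ.vec f j ≠ 0 → 0 ≤ σ.vec d j)
    (haug : ∀ τ, Base P K τ → Frame [3, 7, 8, 9, 12, 15] [3, 5] σ τ →
      Improved P (Function.support (σ.vec f)) (σ.vec d) σ.x τ.x → Q τ) :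
    Runs P R O (improve d f els) σ (7 * n + 8 + t) (1 + k) Q := by
  obtain ⟨r, hr⟩ := hR.exists_eq_some (Function.support (σ.vec f)) (σ.vec d)
    (invWeights (σ.vec 3)) (fun j _ => invWeights_ne_zero (by rw [hσ.sol]; exact hσ.feas.2) j)
    0 (σ.vec d) hd0 (fun j _ => by simp)
  obtain ⟨⟨hfeas, hopt⟩, hel, -⟩ := (hR _ _ _).2 r hr
  rw [hσ.sol] at hfeas hopt
  refine ((runs_consult (P := P) (O := O) hσ.cols hd hf hr).seq (t₂ := t + 1 + 1) (k₂ := k)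
    (Q := Q) ?_).mono (by omega) le_rfl fun _ h => h
  rintro τ ⟨h1, h2, h3, h4⟩
  refine Runs.branch (fun hb => ?_) (fun hb => ?_)
  · have hlt : σ.vec d ⬝ᵥ r.z < 0 := by
      have : τ.real 12 0 0 < ((0 : ℚ) : ℝ) := hb
      rwa [h4, Rat.cast_zero] at this
    obtain ⟨α, hα, hmax, hzero, hneg⟩ := exists_maxStep P hσ.feas hd0 hfeas hlt
    have hex := Exec.augmentRatio (P := P) (R := R) (O := O) 3 τ.tick r.z α h3 (by
      show P.IsMaxStep τ.x r.z α
      rw [h2]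
      exact hmax)
    have hz : r.z ≠ 0 := by
      intro h0
      rw [h0, dotProduct_zero] at hlt
      exact lt_irrefl _ hlt
    have hxτ : (τ.tick.tick.moveTo 3 (τ.tick.x + α • r.z)).x = σ.x + α • r.z := by
      show τ.x + α • r.z = _
      rw [h2]
    refine ⟨_, hex, ?_, le_self_add, rfl, ?_⟩
    · show τ.time + 1 + 1 ≤ τ.time + 1 + (t + 1)
      omega
    have hfr : Frame [3] [] τ (τ.tick.tick.moveTo 3 (τ.tick.x + α • r.z)) :=
      ⟨fun a ha => real_writeVec (σ := τ.tick.tick) _ (by simpa using ha), fun v _ => rfl⟩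
    have hfr' : Frame [3, 7, 8, 9, 12, 15] [3, 5] σ
        (τ.tick.tick.moveTo 3 (τ.tick.x + α • r.z)) :=
      (h1.mono (by decide) (by decide)).trans (hfr.mono (by decide) (by decide))
    refine haug _ ⟨?_, ?_, ?_, ?_, ?_, ?_, ?_, ?_⟩ hfr' ⟨⟨r.z, α, hα, hxτ,
      hel.resolve_left hz, hfeas.2.1, ?_, hneg, hlt, hopt⟩, ?_⟩
    · rw [hfr'.2 0 (by decide), hσ.flag]
    · rw [hfr'.2 1 (by decide), hσ.rows]
    · rw [hfr'.2 2 (by decide), hσ.cols]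
    · rw [hfr'.2 4 (by decide), hσ.guess]
    · rw [hfr'.1 13 (by decide), hσ.pow]
    · rw [hfr'.vec (by decide), hσ.cost]
    · exact vec_writeVec (σ := τ.tick.tick) _
    · rw [hxτ]
      exact hmax.2.1
    · rw [hxτ]
      exact hzero
    · rw [hxτ]
      exact hmax.2.1
  · have hge : 0 ≤ σ.vec d ⬝ᵥ r.z := by
      have h5 : ¬ τ.real 12 0 0 < ((0 : ℚ) : ℝ) := hb
      rwa [h4, Rat.cast_zero, not_lt] at h5
    exact (hels τ.tick r.z h1 h2 hge hopt).mono (by omega) le_rfl fun _ h => h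

/-! ### Phases -/

theorem Improved.abs_sub_le {F : Set (Fin n)} {c d x x' : Fin n → ℝ} {q : ℝ} (hq : 0 < q)
    (h : Improved P F d x x') (hx : P.Feasible x) (hc : ∀ j, 0 ≤ c j)
    (hcq : ∀ j, c j ≠ 0 → 1 / q ≤ c j) (hdc : ∀ j, 0 < d j → c j ≠ 0) (i : Fin n) :
    |x' i - x i| ≤ circuitImbalance P.A * q * (c ⬝ᵥ x) := by
  obtain ⟨⟨z, α, hα, rfl, hz, -, -, ⟨j, hj, hzj⟩, -, -⟩, hx'⟩ := h
  exact step_bound hq (by linarith) hz hx.2 hx'.2 hc hcq (hdc j hj) hzj i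

/-- The effect of `i` improvement steps for the cost `c` on the columns where `f` is nonzero. -/
structure Descent (P : LP m n) (f c : Fin n → ℝ) (q : ℝ) (i : ℕ) (x x' : Fin n → ℝ) : Prop where
  off : ∀ j, f j = 0 → x' j = x j
  move : ∀ j, |x' j - x j| ≤ i * (circuitImbalance P.A * q * (c ⬝ᵥ x))
  mono : c ⬝ᵥ x' ≤ c ⬝ᵥ x
  gap : ∀ u, P.Feasible u → (∀ j, f j = 0 → u j = x' j) →
    c ⬝ᵥ x' - c ⬝ᵥ u ≤ (1 - 1 / (n : ℝ)) ^ i * (c ⬝ᵥ x - c ⬝ᵥ u)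

theorem Descent.refl (f c : Fin n → ℝ) (q : ℝ) (x : Fin n → ℝ) : Descent P f c q 0 x x :=
  ⟨fun _ _ => rfl, fun j => by simp, le_rfl, fun u _ _ => by simp⟩

/-- Contraction factors multiply, and displacements add because the potential that bounds them does
not increase. -/
theorem Descent.trans {f c x x' x'' : Fin n → ℝ} {q : ℝ} {i : ℕ} (hn : 1 ≤ n) (hq : 0 < q)
    (h : Descent P f c q i x x') (h' : Descent P f c q 1 x' x'') :
    Descent P f c q (i + 1) x x'' := by
  have hκ := one_le_circuitImbalance P.A
  have hn' : (1 : ℝ) ≤ n := by exact_mod_cast hn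
  refine ⟨fun j hj => (h'.off j hj).trans (h.off j hj), fun j => ?_, h'.mono.trans h.mono,
    fun u hu huf => ?_⟩
  · have h1 := h.move j
    have h2 := h'.move j
    have h3 : circuitImbalance P.A * q * (c ⬝ᵥ x') ≤ circuitImbalance P.A * q * (c ⬝ᵥ x) :=
      mul_le_mul_of_nonneg_left h.mono (by positivity)
    have h4 := abs_sub_le (x'' j) (x' j) (x j)
    push_cast at h2 ⊢
    linarith
  · have h1 := h'.gap u hu huf
    have h2 := h.gap u hu fun j hj => by rw [huf j hj, h'.off j hj]
    have h3 : 0 ≤ 1 - 1 / (n : ℝ) := by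
      rw [sub_nonneg, div_le_one (by linarith)]
      exact hn'
    rw [pow_one] at h1
    rw [pow_succ', mul_assoc]
    exact h1.trans (mul_le_mul_of_nonneg_left h2 h3)

/-- If the oracle finds no improvement, the gap is already nonpositive and contracts trivially;
otherwise `ratio_gap` and a step length of at least one give the factor `1 - 1 / n`. -/
theorem runs_improve_main (hR : IsRatioOracle P.A R) {K : ℕ} {σ : State n} (hn : 1 ≤ n)
    (hσ : Base P K σ) (hc : ∀ j, 0 ≤ σ.vec 5 j) (hcq : ∀ j, σ.vec 5 j ≠ 0 → 1 / 2 ^ K ≤ σ.vec 5 j) :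
    Runs P R O (improve 5 4 .skip) σ (7 * n + 9) 1 fun τ => Base P K τ ∧
      Frame [3, 7, 8, 9, 12, 15] [3, 5] σ τ ∧
      Descent P (σ.vec 4) (σ.vec 5) (2 ^ K) 1 σ.x τ.x := by
  have hn' : (0 : ℝ) < n := by exact_mod_cast hn
  have hκ := one_le_circuitImbalance P.A
  have hΦ : 0 ≤ σ.vec 5 ⬝ᵥ σ.x := Finset.sum_nonneg fun j _ => mul_nonneg (hc j) (hσ.feas.2 j)
  refine (runs_improve hR (t := 1) (k := 0) hσ (by decide) (by decide) ?_ (fun j _ => hc j)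
    ?_).mono (by omega) (by omega) fun _ h => h
  · intro τ z hfr hx hz hopt
    refine Runs.skip ⟨hσ.frame hfr hx (by decide) (by decide),
      Frame.mono hfr (by decide) (by decide), ?_⟩
    show Descent P (σ.vec 4) (σ.vec 5) (2 ^ K) 1 σ.x τ.x
    rw [hx]
    refine ⟨fun _ _ => rfl, fun j => ?_, le_rfl, fun u hu huf => ?_⟩
    · rw [sub_self, abs_zero]
      positivity
    · have h1 := ratio_gap P (x' := u) (d := σ.vec 5) (z := z) hn hσ.feas hu
        (fun j hj => huf j (by simpa using hj)) hopt
      have h2 : 0 ≤ n * (σ.vec 5 ⬝ᵥ z) := by positivity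
      have h3 : 0 ≤ 1 / (n : ℝ) * (σ.vec 5 ⬝ᵥ u - σ.vec 5 ⬝ᵥ σ.x) := by
        have : 0 ≤ σ.vec 5 ⬝ᵥ u - σ.vec 5 ⬝ᵥ σ.x := h2.trans h1
        positivity
      rw [pow_one]
      linarith
  · intro τ hB hfr himp
    refine ⟨hB, hfr, ?_⟩
    have hmove := himp.abs_sub_le (by positivity) hσ.feas hc hcq (fun j hj => hj.ne')
    obtain ⟨⟨z, α, hα, hxz, -, hF, -, -, hneg, hopt⟩, -⟩ := himp
    have hcost : σ.vec 5 ⬝ᵥ τ.x = σ.vec 5 ⬝ᵥ σ.x + α * (σ.vec 5 ⬝ᵥ z) := by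
      rw [hxz, dotProduct_add, dotProduct_smul, smul_eq_mul]
    have hle : α * (σ.vec 5 ⬝ᵥ z) ≤ σ.vec 5 ⬝ᵥ z := by nlinarith
    refine ⟨fun j hj => ?_, fun j => ?_, by linarith, fun u hu huf => ?_⟩
    · rw [hxz, Pi.add_apply, Pi.smul_apply, hF j (by simpa using hj), smul_zero, add_zero]
    · rw [Nat.cast_one, one_mul]
      exact hmove j
    · have h1 := ratio_gap P (x' := u) (d := σ.vec 5) (z := z) hn hσ.feas hu
        (fun j hj => by
          have hj' : j ∉ Function.support (σ.vec 4) := hj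
          rw [huf j (by simpa using hj), hxz, Pi.add_apply, Pi.smul_apply, hF j hj', smul_zero,
            add_zero]) hopt
      have h3 : σ.vec 5 ⬝ᵥ z ≤ 1 / (n : ℝ) * (σ.vec 5 ⬝ᵥ u - σ.vec 5 ⬝ᵥ σ.x) := by
        rw [one_div_mul_eq_div, le_div_iff₀ hn']
        linarith
      rw [pow_one]
      linarith

/-- The improvement steps of a phase. -/
def descend : Program :=
  forLoop 8 (.mul (.mul (.const 4) (.var 2)) (.var 4)) (improve 5 4 .skip)

theorem runs_descend (hR : IsRatioOracle P.A R) {K : ℕ} {σ : State n} (hn : 1 ≤ n)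
    (hσ : Base P K σ) (hc : ∀ j, 0 ≤ σ.vec 5 j) (hcq : ∀ j, σ.vec 5 j ≠ 0 → 1 / 2 ^ K ≤ σ.vec 5 j) :
    Runs P R O descend σ (4 * n * K * (7 * n + 11) + 2) (4 * n * K) fun τ => Base P K τ ∧
      Frame [3, 7, 8, 9, 12, 15] [3, 5, 8] σ τ ∧
      Descent P (σ.vec 4) (σ.vec 5) (2 ^ K) (4 * n * K) σ.x τ.x := by
  refine (Runs.forLoop (N := 4 * n * K) (t := 7 * n + 9) (k := 1)
    (fun i τ => Base P K τ ∧ Frame [3, 7, 8, 9, 12, 15] [3, 5, 8] σ τ ∧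
      Descent P (σ.vec 4) (σ.vec 5) (2 ^ K) i σ.x τ.x) ?_ ?_ ?_ ?_).mono le_rfl (by omega)
      fun _ h => h
  · rintro i τ ⟨h1, h2, h3⟩
    exact ⟨h1.frame (as := []) (vs := []) ⟨fun _ _ => rfl, fun _ _ => rfl⟩ rfl (by decide)
      (by decide), h2, h3⟩
  · rintro i τ ⟨h1, -⟩
    simp only [NExpr.eval, h1.cols, h1.guess]
  · rintro i τ hi hv ⟨h1, h2, h3⟩
    have e5 : τ.vec 5 = σ.vec 5 := h2.vec (by decide)
    have e4 : τ.vec 4 = σ.vec 4 := h2.vec (by decide)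
    refine (runs_improve_main hR hn h1 (by rw [e5]; exact hc) (by rw [e5]; exact hcq)).mono
      le_rfl le_rfl ?_
    rintro υ ⟨g1, g2, g3⟩
    rw [e4, e5] at g3
    have hfr : Frame [] [8] υ (υ.setNat 8 (i + 1)) :=
      ⟨fun _ _ => rfl, fun v hv => by
        have hne : v ≠ 8 := by simpa using hv
        simp [State.setNat, hne]⟩
    exact ⟨by rw [g2.2 8 (by decide), hv], g1.frame hfr rfl (by decide) (by decide),
      (h2.trans (g2.mono (by decide) (by decide))).trans (hfr.mono (by decide) (by decide)),
      h3.trans hn (by positivity) g3⟩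
  · have hfr : Frame [] [8] σ (σ.setNat 8 0) :=
      ⟨fun _ _ => rfl, fun v hv => by
        have hne : v ≠ 8 := by simpa using hv
        simp [State.setNat, hne]⟩
    exact ⟨hσ.frame hfr rfl (by decide) (by decide), hfr.mono (by decide) (by decide),
      Descent.refl _ _ _ _⟩

/-! ### Support reduction by means of tails of the cost. -/

/-- The cost `c` without its first `p` entries. -/
def tail (c : Fin n → ℝ) (p : ℕ) : Fin n → ℝ := fun j => if (j : ℕ) < p then 0 else c j

theorem tail_zero (c : Fin n → ℝ) : tail c 0 = c := by
  funext j
  simp [tail]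

theorem tail_eq_single_add (c : Fin n → ℝ) (j : Fin n) :
    tail c j = Pi.single j (c j) + tail c (j + 1) := by
  funext i
  by_cases h : i = j
  · subst h
    simp [tail]
  · have h' : (i : ℕ) ≠ j := fun e => h (Fin.ext e)
    rw [Pi.add_apply, Pi.single_eq_of_ne h, zero_add]
    unfold tail
    by_cases h1 : (i : ℕ) < j
    · rw [if_pos h1, if_pos (by omega)]
    · rw [if_neg h1, if_neg (by omega)]

/-- Vanishing of all tails of the cost on a kernel vector. -/
theorem eq_zero_of_tails {c h : Fin n → ℝ} (ht : ∀ p < n, tail c p ⬝ᵥ h = 0) (j : Fin n)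
    (hj : c j ≠ 0) : h j = 0 := by
  -- Consecutive tails differ in the single entry `c j`, so their vanishing isolates `c j * h j =
  -- 0`.
  have h1 := ht j j.2
  have h2 : tail c (j + 1) ⬝ᵥ h = 0 := by
    by_cases hlt : (j : ℕ) + 1 < n
    · exact ht _ hlt
    · refine Finset.sum_eq_zero fun i _ => ?_
      unfold tail
      rw [if_pos (by omega), zero_mul]
  rw [tail_eq_single_add, add_dotProduct, h2, add_zero, single_dotProduct] at h1
  exact (mul_eq_zero.1 h1).resolve_left hj

/-- Remove the circuits in the support of the solution that meet the support of the cost. -/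
def reduceSupport : Program :=
  .seq (.setNat 9 (.const 0))
    (.loop (.natLT (.var 9) (.var 2))
      (.seq (assign 11 (.natLT (.var 5) (.var 9)) (.const 0) (entry 5))
        (improve 11 3 (.setNat 9 (.add (.var 9) (.const 1))))))

/-- The invariant of `reduceSupport`. -/
structure ReduceInv (P : LP m n) (K : ℕ) (σ τ : State n) : Prop where
  base : Base P K τ
  frame : Frame [3, 7, 8, 9, 11, 12, 15] [3, 5, 9] σ τ
  le : τ.nat 9 ≤ n
  supp : ∀ j, σ.x j = 0 → τ.x j = 0
  mono : σ.vec 5 ⬝ᵥ τ.x ≤ σ.vec 5 ⬝ᵥ σ.x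
  move : ∀ i, |τ.x i - σ.x i| ≤ (2 * n - ((Function.support τ.x).ncard + (n - τ.nat 9) : ℕ)) *
    (circuitImbalance P.A * 2 ^ K * (σ.vec 5 ⬝ᵥ σ.x))
  orth : ∀ p < τ.nat 9, ∀ h : Fin n → ℝ, P.A *ᵥ h = 0 → (∀ j, τ.x j = 0 → h j = 0) →
    tail (σ.vec 5) p ⬝ᵥ h = 0

theorem support_ncard_le (x : Fin n → ℝ) : (Function.support x).ncard ≤ n := by
  have := Set.ncard_le_ncard (Set.subset_univ (Function.support x))
  rwa [Set.ncard_univ, Nat.card_eq_fintype_card, Fintype.card_fin] at this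

/-- Each call either empties a coordinate of `x` or settles one more tail, so the measure drops.
Settled tails remain settled, since a smaller support admits fewer kernel vectors. -/
theorem runs_reduceSupport_body (hR : IsRatioOracle P.A R) {K : ℕ} {σ τ : State n}
    (hσ : Base P K σ) (hc : ∀ j, 0 ≤ σ.vec 5 j)
    (hcq : ∀ j, σ.vec 5 j ≠ 0 → 1 / 2 ^ K ≤ σ.vec 5 j)
    (hτ : ReduceInv P K σ τ) (hlt : τ.nat 9 < n) :
    Runs P R O (.seq (assign 11 (.natLT (.var 5) (.var 9)) (.const 0) (entry 5))
        (improve 11 3 (.setNat 9 (.add (.var 9) (.const 1))))) τ (11 * n + 11) 1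
      fun υ => ReduceInv P K σ υ ∧ (Function.support υ.x).ncard + (n - υ.nat 9) <
        (Function.support τ.x).ncard + (n - τ.nat 9) := by
  have hκ := one_le_circuitImbalance P.A
  have hΦ : 0 ≤ σ.vec 5 ⬝ᵥ σ.x := Finset.sum_nonneg fun j _ => mul_nonneg (hc j) (hσ.feas.2 j)
  have hD : 0 ≤ circuitImbalance P.A * 2 ^ K * (σ.vec 5 ⬝ᵥ σ.x) := by positivity
  set p := τ.nat 9 with hp
  have hcτ : τ.vec 5 = σ.vec 5 := hτ.frame.vec (by decide)
  refine ((runs_assign hτ.base.cols (tail (σ.vec 5) p) ?_).seq (t₂ := 7 * n + 8 + 1)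
    (k₂ := 1 + 0) ?_).mono (by omega) (by omega) fun _ h => h
  · intro j υ hj hfr _
    have e9 : υ.nat 9 = p := hfr.2 9 (by decide)
    simp only [BExpr.Holds, NExpr.eval, RExpr.eval, hj, e9, eval_entry hj,
      hfr.vec (by decide : 5 ∉ [11]), hcτ]
    unfold tail
    refine ⟨fun h => ?_, fun h => ?_⟩
    · rw [if_pos h]
      norm_num
    · rw [if_neg h]
  rintro υ ⟨h1, h2, -, h4⟩
  have hB : Base P K υ := hτ.base.frame h1 h2 (by decide) (by decide)
  have ht0 : ∀ j, 0 ≤ tail (σ.vec 5) p j := by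
    intro j
    unfold tail
    split_ifs
    · exact le_rfl
    · exact hc j
  have e9 : υ.nat 9 = p := h1.2 9 (by decide)
  have hfrυ : Frame [3, 7, 8, 9, 11, 12, 15] [3, 5, 9] σ υ :=
    hτ.frame.trans (h1.mono (by decide) (by decide))
  refine runs_improve hR hB (by decide) (by decide) ?_ (fun j _ => by rw [h4]; exact ht0 j) ?_
  · intro ω z hfr hx hz hopt
    rw [h4] at hz hopt
    rw [hB.sol] at hopt
    have hxω : ω.x = τ.x := hx.trans h2
    refine Runs.setNat ?_
    have hω9 : ω.nat 9 = p := (hfr.2 9 (by decide)).trans e9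
    have hfin : (ω.tick.setNat 9 ((NExpr.add (.var 9) (.const 1)).eval ω)) =
        ω.tick.setNat 9 (p + 1) := by
      simp [NExpr.eval, hω9]
    rw [hfin]
    have hfr' : Frame [7, 8, 9, 12, 15] [3, 5, 9] υ (ω.tick.setNat 9 (p + 1)) :=
      ⟨hfr.1, fun v hv => by
        have hne : v ≠ 9 := fun h => hv (by simp [h])
        rw [← hfr.2 v (fun h => hv (by
          simp only [List.mem_cons, List.not_mem_nil, or_false] at h ⊢
          tauto))]
        simp [State.setNat, State.tick, hne]⟩
    have hn9 : (ω.tick.setNat 9 (p + 1)).nat 9 = p + 1 := by simp [State.setNat]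
    have hxs : (ω.tick.setNat 9 (p + 1)).x = τ.x := hxω
    refine ⟨⟨hB.frame hfr' (hxs.trans h2.symm) (by decide) (by decide),
      hfrυ.trans (hfr'.mono (by decide) (by decide)), by rw [hn9]; exact hlt, ?_, ?_, ?_, ?_⟩, ?_⟩
    · rw [hxs]
      exact hτ.supp
    · rw [hxs]
      exact hτ.mono
    · rw [hxs, hn9]
      intro i
      refine (hτ.move i).trans (mul_le_mul_of_nonneg_right ?_ hD)
      have : (((Function.support τ.x).ncard + (n - (p + 1)) : ℕ) : ℝ) ≤
          ((Function.support τ.x).ncard + (n - τ.nat 9) : ℕ) := by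
        rw [← hp]
        exact_mod_cast (by omega)
      linarith
    · rw [hxs, hn9]
      intro p' hp' h hA hh
      rcases Nat.lt_succ_iff_lt_or_eq.1 hp' with h' | rfl
      · exact hτ.orth p' h' h hA hh
      · refine dotProduct_eq_zero_of_no_improvement P hτ.base.feas hz ?_ h hA hh
        rw [h2] at hopt
        exact hopt
    · rw [hxs, hn9]
      omega
  · intro ω hBω hfr himp
    rw [h4, h2] at himp
    rw [hB.sol, h2] at himp
    have hω9 : ω.nat 9 = p := (hfr.2 9 (by decide)).trans e9
    have htc : ∀ j, 0 < tail (σ.vec 5) p j → σ.vec 5 j ≠ 0 := by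
      intro j hj
      unfold tail at hj
      split_ifs at hj with h
      · exact absurd hj (lt_irrefl _)
      · exact hj.ne'
    have hmove := himp.abs_sub_le (by positivity) hτ.base.feas hc hcq htc
    obtain ⟨⟨z, α, hα, hxz, hz, hF, ⟨i₀, hi₀, hi₀'⟩, -, hneg, -⟩, -⟩ := himp
    have hzs : ∀ j, τ.x j = 0 → z j = 0 := fun j hj => hF j (by simpa using hj)
    have hsub : ∀ j, τ.x j = 0 → ω.x j = 0 := fun j hj => by
      rw [hxz, Pi.add_apply, Pi.smul_apply, hj, hzs j hj, smul_zero, add_zero]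
    -- The tail at `0` is the full cost: either it is the objective being improved, or it is settled
    -- and vanishes on `z`. So improving a later tail never raises the potential.
    have hcz : σ.vec 5 ⬝ᵥ z ≤ 0 := by
      rcases Nat.eq_zero_or_pos p with h0 | h0
      · rw [h0, tail_zero] at hneg
        exact hneg.le
      · have := hτ.orth 0 h0 z hz.1 hzs
        rw [tail_zero] at this
        exact this.le
    have hcx : σ.vec 5 ⬝ᵥ ω.x ≤ σ.vec 5 ⬝ᵥ τ.x := by
      rw [hxz, dotProduct_add, dotProduct_smul, smul_eq_mul]
      nlinarith
    have hcard : (Function.support ω.x).ncard < (Function.support τ.x).ncard := by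
      refine Set.ncard_lt_ncard ⟨fun j hj hj0 => hj (hsub j hj0), fun hsup => ?_⟩ (Set.toFinite _)
      exact hsup (show i₀ ∈ Function.support τ.x from hi₀) hi₀'
    refine ⟨⟨hBω, hfrυ.trans (hfr.mono (by decide) (by decide)), by rw [hω9]; exact hlt.le,
      fun j hj => hsub j (hτ.supp j hj), hcx.trans hτ.mono, fun i => ?_, ?_⟩, by rw [hω9]; omega⟩
    · rw [hω9]
      have h5 := hτ.move i
      have h6 : |ω.x i - τ.x i| ≤ circuitImbalance P.A * 2 ^ K * (σ.vec 5 ⬝ᵥ σ.x) :=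
        (hmove i).trans (mul_le_mul_of_nonneg_left hτ.mono (by positivity))
      have h7 := abs_sub_le (ω.x i) (τ.x i) (σ.x i)
      have h8 : (((Function.support ω.x).ncard + (n - p) : ℕ) : ℝ) + 1 ≤
          ((Function.support τ.x).ncard + (n - τ.nat 9) : ℕ) := by
        rw [← hp]
        exact_mod_cast (by omega)
      nlinarith
    · rw [hω9]
      intro p' hp' h hA hh
      exact hτ.orth p' hp' h hA fun j hj => hh j (hsub j hj)

/-- The initial measure is at most `2 n`, which bounds the calls and, at one unit of displacement
per call, the total movement. -/
theorem runs_reduceSupport (hR : IsRatioOracle P.A R) {K : ℕ} {σ : State n}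
    (hσ : Base P K σ) (hc : ∀ j, 0 ≤ σ.vec 5 j)
    (hcq : ∀ j, σ.vec 5 j ≠ 0 → 1 / 2 ^ K ≤ σ.vec 5 j) :
    Runs P R O reduceSupport σ (2 * n * (11 * n + 12) + 2) (2 * n) fun τ => Base P K τ ∧
      Frame [3, 7, 8, 9, 11, 12, 15] [3, 5, 9] σ τ ∧ (∀ j, σ.x j = 0 → τ.x j = 0) ∧
      σ.vec 5 ⬝ᵥ τ.x ≤ σ.vec 5 ⬝ᵥ σ.x ∧
      (∀ i, |τ.x i - σ.x i| ≤
        2 * n * (circuitImbalance P.A * 2 ^ K * (σ.vec 5 ⬝ᵥ σ.x))) ∧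
      ∀ h : Fin n → ℝ, P.A *ᵥ h = 0 → (∀ j, τ.x j = 0 → h j = 0) →
        ∀ j, σ.vec 5 j ≠ 0 → h j = 0 := by
  have hκ := one_le_circuitImbalance P.A
  have hΦ : 0 ≤ σ.vec 5 ⬝ᵥ σ.x := Finset.sum_nonneg fun j _ => mul_nonneg (hc j) (hσ.feas.2 j)
  have hD : 0 ≤ circuitImbalance P.A * 2 ^ K * (σ.vec 5 ⬝ᵥ σ.x) := by positivity
  have h0 : Runs P R O (.setNat 9 (.const 0)) σ 1 0 fun τ => τ = σ.tick.setNat 9 0 :=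
    Runs.setNat rfl
  refine (h0.seq (t₂ := 2 * n * (11 * n + 12) + 1) (k₂ := 2 * n) ?_).mono (by omega) (by omega)
    fun _ h => h
  rintro τ₀ rfl
  set τ₀ := σ.tick.setNat 9 0 with hτ₀
  have h9 : τ₀.nat 9 = 0 := by simp [hτ₀, State.setNat]
  have hfr : Frame [] [9] σ τ₀ :=
    ⟨fun _ _ => rfl, fun v hv => by
      have hne : v ≠ 9 := by simpa using hv
      simp [hτ₀, State.setNat, State.tick, hne]⟩
  have hx : τ₀.x = σ.x := rfl
  have hμ : (Function.support τ₀.x).ncard + (n - τ₀.nat 9) ≤ 2 * n := by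
    have := support_ncard_le τ₀.x
    omega
  have hI : ReduceInv P K σ τ₀ := by
    refine ⟨hσ.frame hfr rfl (by decide) (by decide), hfr.mono (by decide) (by decide),
      by omega, fun j hj => hj, le_rfl, fun i => ?_, fun p hp => ?_⟩
    · rw [hx, sub_self, abs_zero]
      refine mul_nonneg ?_ hD
      rw [sub_nonneg]
      exact_mod_cast hμ
    · rw [h9] at hp
      exact absurd hp (Nat.not_lt_zero _)
  refine (Runs.loop (I := ReduceInv P K σ)
    (fun τ => (Function.support τ.x).ncard + (n - τ.nat 9)) (t := 11 * n + 11) (k := 1)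
    (fun τ h => ⟨h.base.frame (as := []) (vs := []) ⟨fun _ _ => rfl, fun _ _ => rfl⟩ rfl
      (by decide) (by decide), h.frame, h.le, h.supp, h.mono, h.move, h.orth⟩) (fun _ => rfl)
    (fun τ hτ hb => ?_) hI).mono ?_ ?_ ?_
  · have hb' : τ.nat 9 < τ.nat 2 := hb
    rw [hτ.base.cols] at hb'
    exact runs_reduceSupport_body hR hσ hc hcq hτ hb'
  · exact Nat.add_le_add_right (Nat.mul_le_mul_right (11 * n + 12) hμ) 1
  · omega
  · rintro τ ⟨hτ, hb⟩
    have hb' : ¬ τ.nat 9 < τ.nat 2 := hb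
    rw [hτ.base.cols] at hb'
    have hle := hτ.le
    have hn9 : τ.nat 9 = n := by omega
    refine ⟨hτ.base, hτ.frame, hτ.supp, hτ.mono, fun i => (hτ.move i).trans ?_,
      fun h hA hh => eq_zero_of_tails fun p hp => hτ.orth p (by omega) h hA hh⟩
    refine mul_le_mul_of_nonneg_right ?_ hD
    have : (0 : ℝ) ≤ ((Function.support τ.x).ncard + (n - τ.nat 9) : ℕ) := Nat.cast_nonneg _
    linarith

/-! ### A complete phase. -/

/-- Recompute the truncated cost from the slacks. -/
def truncate : Program :=
  assign 5 (.realLT (.div (.const 1) (scalar 13)) (.mul (entry 6) (entry 4))) (entry 6) (.const 0)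

theorem runs_truncate {K : ℕ} {σ : State n} (hσ : Base P K σ) :
    Runs P R O truncate σ (4 * n + 2) 0 fun τ =>
      Frame [5] [5] σ τ ∧ τ.x = σ.x ∧ τ.vec 5 = truncCost (2 ^ K) (σ.vec 4) (σ.vec 6) := by
  refine (runs_assign hσ.cols (truncCost (2 ^ K) (σ.vec 4) (σ.vec 6)) ?_).mono le_rfl le_rfl
    fun τ h => ⟨h.1, h.2.1, h.2.2.2⟩
  intro j τ hj hfr _
  have e13 : τ.real 13 0 0 = 2 ^ K := by rw [hfr.1 13 (by decide), hσ.pow]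
  simp only [BExpr.Holds, RExpr.eval, eval_entry hj, eval_scalar, e13,
    hfr.vec (by decide : 6 ∉ [5]), hfr.vec (by decide : 4 ∉ [5]), Rat.cast_one, Rat.cast_zero]
  unfold truncCost
  exact ⟨fun h => by rw [if_pos h], fun h => by rw [if_neg h]⟩

/-- Decrease the cost, and compute new slacks. -/
def lowerCost : Program :=
  .seq (.setReal 14 (.const 0) (.const 0) (.div (scalar 12)
      (.mul (.mul (.mul (scalar 13) (scalar 13)) (scalar 13)) (scalar 13))))
    (.seq descend (.seq (assignAll 9 (.div (.const 1) (.add (entry 3) (scalar 14))))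
      (.seq (.ratio 5 9 4 7 8 6 3) truncate)))

/-- One phase: the columns in the array `4` are free, the array `5` holds the current cost and the
array `6` the slacks from which it arises. -/
def phase : Program :=
  .seq reduceSupport (.seq (dot 5 3) (.branch (.realLT (.const 0) (scalar 12)) lowerCost .skip))

theorem runs_lowerCost (hR : IsRatioOracle P.A R) {K : ℕ} {σ : State n} (hn : 1 ≤ n)
    (hσ : Base P K σ) (hc : ∀ j, 0 ≤ σ.vec 5 j)
    (hcq : ∀ j, σ.vec 5 j ≠ 0 → 1 / 2 ^ K ≤ σ.vec 5 j) (hpos : 0 < σ.real 12 0 0) :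
    Runs P R O lowerCost σ (4 * n * K * (7 * n + 11) + (8 * n + 8)) (4 * n * K + 1) fun τ =>
      Base P K τ ∧ Frame [3, 5, 6, 7, 8, 9, 12, 14, 15] [3, 5, 8] σ τ ∧
      ∃ r, R (Function.support (σ.vec 4)) (σ.vec 5)
          (weightsOf fun j => 1 / (τ.x j + σ.real 12 0 0 / (2 ^ K) ^ 4)) = some r ∧
        Descent P (σ.vec 4) (σ.vec 5) (2 ^ K) (4 * n * K) σ.x τ.x ∧ τ.vec 6 = r.s ∧
        τ.vec 5 = truncCost (2 ^ K) (σ.vec 4) r.s := by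
  set η := σ.real 12 0 0 / (2 ^ K) ^ 4 with hη
  have hη0 : 0 < η := by positivity
  have h0 : Runs P R O (.setReal 14 (.const 0) (.const 0) (.div (scalar 12)
      (.mul (.mul (.mul (scalar 13) (scalar 13)) (scalar 13)) (scalar 13)))) σ 1 0
      fun τ => τ = σ.tick.setReal 14 0 0 η := by
    refine Runs.setReal ?_
    simp only [RExpr.eval, NExpr.eval, eval_scalar, hσ.pow, hη]
    congr 2
    ring
  refine (h0.seq (t₂ := (4 * n * K * (7 * n + 11) + 2) + ((4 * n + 2) + (1 + (4 * n + 2))))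
    (k₂ := 4 * n * K + (0 + (1 + 0))) ?_).mono (by omega) (by omega) fun _ h => h
  rintro τ₀ rfl
  set τ₀ := σ.tick.setReal 14 0 0 η with hτ₀
  have hfr₀ : Frame [14] [] σ τ₀ :=
    ⟨fun a ha => by
      have hne : a ≠ 14 := by simpa using ha
      funext i j
      simp [hτ₀, State.setReal, State.tick, hne], fun _ _ => rfl⟩
  have hη14 : τ₀.real 14 0 0 = η := by simp [hτ₀, State.setReal]
  have hB₀ : Base P K τ₀ := hσ.frame hfr₀ rfl (by decide) (by decide)
  have e5 : τ₀.vec 5 = σ.vec 5 := hfr₀.vec (by decide)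
  have e4 : τ₀.vec 4 = σ.vec 4 := hfr₀.vec (by decide)
  refine (runs_descend hR hn hB₀ (by rw [e5]; exact hc) (by rw [e5]; exact hcq)).seq ?_
  rintro τ₁ ⟨hB₁, hfr₁, hdesc⟩
  rw [e4, e5] at hdesc
  refine (runs_assignAll hB₁.cols (fun j => 1 / (τ₁.x j + η)) ?_).seq ?_
  · intro j υ hj hfr _
    simp only [RExpr.eval, eval_entry hj, eval_scalar, hfr.vec (by decide : 3 ∉ [9]),
      hfr.1 14 (by decide), hfr₁.1 14 (by decide), hη14, hB₁.sol, Rat.cast_one]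
  rintro τ₂ ⟨hfr₂, hx₂, -, hw₂⟩
  have hB₂ : Base P K τ₂ := hB₁.frame hfr₂ hx₂ (by decide) (by decide)
  have f5 : τ₂.vec 5 = σ.vec 5 := by
    rw [hfr₂.vec (by decide), hfr₁.vec (by decide), e5]
  have f4 : τ₂.vec 4 = σ.vec 4 := by
    rw [hfr₂.vec (by decide), hfr₁.vec (by decide), e4]
  obtain ⟨r, hr⟩ := hR.exists_eq_some (Function.support (σ.vec 4)) (σ.vec 5)
    (fun j => 1 / (τ₁.x j + η)) (fun j _ => by
      have := hB₁.feas.2 j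
      positivity) 0 (σ.vec 5) (fun j _ => hc j) (fun j _ => by simp)
  refine (runs_ratio (r := r) (by rw [f4, f5, hw₂]; exact hr) (by decide) (by decide)).seq ?_
  rintro τ₃ ⟨hfr₃, hx₃, -, -, hs₃, -⟩
  have hB₃ : Base P K τ₃ := hB₂.frame hfr₃ hx₃ (by decide) (by decide)
  refine (runs_truncate hB₃).mono le_rfl le_rfl ?_
  rintro τ₄ ⟨hfr₄, hx₄, hc₄⟩
  have hx : τ₄.x = τ₁.x := by rw [hx₄, hx₃, hx₂]
  refine ⟨hB₃.frame hfr₄ hx₄ (by decide) (by decide),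
    ((((hfr₀.mono (by decide) (by decide)).trans (hfr₁.mono (by decide) (by decide))).trans
      (hfr₂.mono (by decide) (by decide))).trans (hfr₃.mono (by decide) (by decide))).trans
      (hfr₄.mono (by decide) (by decide)), r, by rw [hx]; exact hr, by rw [hx]; exact hdesc,
    by rw [hfr₄.vec (by decide), hs₃], ?_⟩
  rw [hc₄, hs₃, hfr₃.vec (by decide), f4]

/-- Holds for every guess `K ≥ 1`: running time, feasibility and the relation between the iterates
do not need `q` to be large. -/
theorem runs_phase (hR : IsRatioOracle P.A R) {K : ℕ} {σ : State n} (hn : 1 ≤ n) (hK : 1 ≤ K)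
    (hσ : Base P K σ) (hf : ∀ j, σ.vec 4 j = 0 ∨ σ.vec 4 j = 1)
    (hc : σ.vec 5 = truncCost (2 ^ K) (σ.vec 4) (σ.vec 6)) :
    Runs P R O phase σ (150 * n ^ 2 * K) (7 * n * K) fun τ => Base P K τ ∧
      Frame [3, 5, 6, 7, 8, 9, 11, 12, 14, 15] [3, 5, 8, 9] σ τ ∧
      τ.vec 5 = truncCost (2 ^ K) (σ.vec 4) (τ.vec 6) ∧
      PhaseStep P R (σ.vec 4) (2 ^ K) K σ.x (σ.vec 6) (σ.vec 5) τ.x (τ.vec 6) (τ.vec 5) := by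
  have hnn : n ≤ n ^ 2 := by nlinarith
  have h1n : 1 ≤ n ^ 2 := hn.trans hnn
  have hnK : n ^ 2 ≤ n ^ 2 * K := Nat.le_mul_of_pos_right _ hK
  have hnK1 : n * K ≤ n ^ 2 * K := Nat.mul_le_mul_right _ hnn
  have hnK2 : n ≤ n * K := Nat.le_mul_of_pos_right _ hK
  have hc0 : ∀ j, 0 ≤ σ.vec 5 j := fun j => hc ▸ truncCost_nonneg (by positivity) hf _ j
  have hcq : ∀ j, σ.vec 5 j ≠ 0 → 1 / 2 ^ K ≤ σ.vec 5 j := fun j hj => by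
    rw [hc] at hj ⊢
    exact le_truncCost (by positivity) hf _ j hj
  refine ((runs_reduceSupport hR hσ hc0 hcq).seq
    (t₂ := (3 * n + 3) + (4 * n * K * (7 * n + 11) + (8 * n + 8) + 1))
    (k₂ := 0 + (4 * n * K + 1)) ?_).mono ?_ ?_ fun _ h => h
  rotate_left
  · ring_nf
    ring_nf at hnn h1n hnK hnK1 hnK2
    omega
  · ring_nf
    ring_nf at hnn h1n hnK hnK1 hnK2
    omega
  rintro τ₁ ⟨hB₁, hfr₁, hsupp, hmono, hmove, hco⟩
  have e5 : τ₁.vec 5 = σ.vec 5 := hfr₁.vec (by decide)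
  have e4 : τ₁.vec 4 = σ.vec 4 := hfr₁.vec (by decide)
  have e6 : τ₁.vec 6 = σ.vec 6 := hfr₁.vec (by decide)
  refine (runs_dot hB₁.cols (by decide) (by decide)).seq ?_
  rintro τ₂ ⟨hfr₂, hx₂, -, hΦ⟩
  rw [e5, hB₁.sol] at hΦ
  have hB₂ : Base P K τ₂ := hB₁.frame hfr₂ hx₂ (by decide) (by decide)
  have f5 : τ₂.vec 5 = σ.vec 5 := by rw [hfr₂.vec (by decide), e5]
  have f4 : τ₂.vec 4 = σ.vec 4 := by rw [hfr₂.vec (by decide), e4]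
  have f6 : τ₂.vec 6 = σ.vec 6 := by rw [hfr₂.vec (by decide), e6]
  refine Runs.branch (fun hb => ?_) (fun hb => ?_)
  · have hpos : 0 < τ₂.real 12 0 0 := by
      have : ((0 : ℚ) : ℝ) < τ₂.real 12 0 0 := hb
      rwa [Rat.cast_zero] at this
    have hB₂' : Base P K τ₂.tick :=
      hB₂.frame (as := []) (vs := []) ⟨fun _ _ => rfl, fun _ _ => rfl⟩ rfl (by decide) (by decide)
    refine (runs_lowerCost hR hn hB₂' (σ := τ₂.tick) (by
      show ∀ j, 0 ≤ τ₂.vec 5 j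
      rw [f5]
      exact hc0) (by
      show ∀ j, τ₂.vec 5 j ≠ 0 → 1 / 2 ^ K ≤ τ₂.vec 5 j
      rw [f5]
      exact hcq) hpos).mono le_rfl le_rfl ?_
    rintro τ₃ ⟨hB₃, hfr₃, r, hr, hdesc, hs, hc₃⟩
    have hfr₃' : Frame [3, 5, 6, 7, 8, 9, 12, 14, 15] [3, 5, 8] τ₂ τ₃ := hfr₃
    have g5 : τ₂.tick.vec 5 = σ.vec 5 := f5
    have g4 : τ₂.tick.vec 4 = σ.vec 4 := f4
    have gx : τ₂.tick.x = τ₁.x := hx₂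
    have g12 : τ₂.tick.real 12 0 0 = σ.vec 5 ⬝ᵥ τ₁.x := hΦ
    rw [g4, g5, gx] at hdesc
    rw [g4, g5, g12] at hr
    rw [g4] at hc₃
    refine ⟨hB₃, ((hfr₁.mono (by decide) (by decide)).trans
      (hfr₂.mono (by decide) (by decide))).trans (hfr₃'.mono (by decide) (by decide)),
      by rw [hc₃, hs], ⟨τ₁.x, hB₁.feas, fun j _ hj => hsupp j hj, hmono, hmove, hco,
      Or.inr ⟨hΦ ▸ hpos, hB₃.feas, fun j hj hj' => by rw [hdesc.off j hj, hj'], fun i => ?_,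
      hdesc.gap, r, hr, hs, hc₃⟩⟩⟩
    have := hdesc.move i
    push_cast at this
    exact this
  · refine (Runs.skip (P := P) (R := R) (O := O) (σ := τ₂.tick) (Q := fun τ =>
      τ = τ₂.tick.tick) rfl).mono (by omega) (Nat.zero_le _) ?_
    rintro τ₃ rfl
    have hzero : σ.vec 5 ⬝ᵥ τ₁.x = 0 := by
      have h1 : ¬ ((0 : ℚ) : ℝ) < τ₂.real 12 0 0 := hb
      rw [hΦ, Rat.cast_zero, not_lt] at h1
      exact le_antisymm h1 (Finset.sum_nonneg fun j _ => mul_nonneg (hc0 j) (hB₁.feas.2 j))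
    have hfr₃ : Frame [] [] τ₂ τ₂.tick.tick := ⟨fun _ _ => rfl, fun _ _ => rfl⟩
    have g5 : τ₂.tick.tick.vec 5 = σ.vec 5 := f5
    have g6 : τ₂.tick.tick.vec 6 = σ.vec 6 := f6
    have gx : τ₂.tick.tick.x = τ₁.x := hx₂
    refine ⟨hB₂.frame hfr₃ rfl (by decide) (by decide), ((hfr₁.mono (by decide) (by decide)).trans
      (hfr₂.mono (by decide) (by decide))).trans (hfr₃.mono (by decide) (by decide)),
      by rw [g5, g6, hc], ⟨τ₁.x, hB₁.feas, fun j _ hj => hsupp j hj, hmono, hmove, hco,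
      Or.inl ⟨hzero, gx, g6, g5⟩⟩⟩

/-! ### The algorithm -/

/-- One round: normalize the cost on the free columns, run the phases, and fix variables. -/
def round : Program :=
  .seq (assignAll 9 (.const 1)) (.seq (.ratio 2 9 4 7 8 6 3) (.seq (dot 4 6)
    (.branch (.realLT (.const 0) (scalar 12))
      (.seq (assignAll 6 (.div (entry 6) (scalar 12))) (.seq truncate
        (.seq (forLoop 7 (.add (.var 1) (.const 1)) phase)
          (assign 4 (.realLT (.div (.const 1) (.mul (.const 4) (.ofNat (.var 2)))) (entry 6))
            (.const 0) (entry 4))))) .skip)))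

/-- The phase invariant is carried as an implication from the guess being sufficient, because the
resource bounds must also cover guesses that are too small. -/
theorem runs_phases (hR : IsRatioOracle P.A R) {K : ℕ} {σ : State n} (hm : m ≤ n) (hn : 1 ≤ n)
    (hK : 1 ≤ K) (hσ : Base P K σ) (hf : ∀ j, σ.vec 4 j = 0 ∨ σ.vec 4 j = 1)
    (hc : σ.vec 5 = truncCost (2 ^ K) (σ.vec 4) (σ.vec 6))
    (hs : ∀ j, σ.vec 4 j ≠ 0 → 0 ≤ σ.vec 6 j ∧ σ.vec 6 j ≤ 1) :
    Runs P R O (forLoop 7 (.add (.var 1) (.const 1)) phase) σ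
      ((m + 1) * (150 * n ^ 2 * K + 2) + 2) ((m + 1) * (7 * n * K)) fun τ => Base P K τ ∧
      Frame [3, 5, 6, 7, 8, 9, 11, 12, 14, 15] [3, 5, 7, 8, 9] σ τ ∧
      (64 * (n : ℝ) ^ 5 * circuitImbalance P.A ^ 3 ≤ 2 ^ K →
        (∀ j, σ.vec 4 j = 0 → σ.x j = 0) →
        PhaseInv P (σ.vec 4) (σ.vec 6) (2 ^ K) (m + 1) τ.x (τ.vec 6) (τ.vec 5)) := by
  refine (Runs.forLoop (N := m + 1) (t := 150 * n ^ 2 * K) (k := 7 * n * K)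
    (fun i τ => i ≤ m + 1 ∧ Base P K τ ∧
      Frame [3, 5, 6, 7, 8, 9, 11, 12, 14, 15] [3, 5, 7, 8, 9] σ τ ∧
      τ.vec 5 = truncCost (2 ^ K) (σ.vec 4) (τ.vec 6) ∧
      (64 * (n : ℝ) ^ 5 * circuitImbalance P.A ^ 3 ≤ 2 ^ K →
        (∀ j, σ.vec 4 j = 0 → σ.x j = 0) →
        PhaseInv P (σ.vec 4) (σ.vec 6) (2 ^ K) i τ.x (τ.vec 6) (τ.vec 5))) ?_ ?_ ?_ ?_).mono
      le_rfl le_rfl fun τ h => ⟨h.2.1, h.2.2.1, h.2.2.2.2⟩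
  · rintro i τ ⟨h0, h1, h2, h3, h4⟩
    exact ⟨h0, h1.frame (as := []) (vs := []) ⟨fun _ _ => rfl, fun _ _ => rfl⟩ rfl (by decide)
      (by decide), h2, h3, h4⟩
  · rintro i τ ⟨-, h1, -⟩
    simp only [NExpr.eval, h1.rows]
  · rintro i τ hi hv ⟨-, h1, h2, h3, h4⟩
    have e4 : τ.vec 4 = σ.vec 4 := h2.vec (by decide)
    refine (runs_phase hR hn hK h1 (by rw [e4]; exact hf) (by rw [e4]; exact h3)).mono
      le_rfl le_rfl ?_
    rintro υ ⟨g1, g2, g3, g4⟩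
    rw [e4] at g3 g4
    have hfr : Frame [] [7] υ (υ.setNat 7 (i + 1)) :=
      ⟨fun _ _ => rfl, fun v hv => by
        have hne : v ≠ 7 := by simpa using hv
        simp [State.setNat, hne]⟩
    exact ⟨by rw [g2.2 7 (by decide), hv], hi, g1.frame hfr rfl (by decide) (by decide),
      (h2.trans (g2.mono (by decide) (by decide))).trans (hfr.mono (by decide) (by decide)),
      g3, fun hbig hoff => (h4 hbig hoff).next hR hn hm (by omega) hf hs rfl hbig g4⟩
  · have hfr : Frame [] [7] σ (σ.setNat 7 0) :=
      ⟨fun _ _ => rfl, fun v hv => by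
        have hne : v ≠ 7 := by simpa using hv
        simp [State.setNat, hne]⟩
    refine ⟨Nat.zero_le _, hσ.frame hfr rfl (by decide) (by decide),
      hfr.mono (by decide) (by decide), hc, fun _ hoff => ?_⟩
    show PhaseInv P (σ.vec 4) (σ.vec 6) (2 ^ K) 0 σ.x (σ.vec 6) (σ.vec 5)
    rw [hc]
    exact PhaseInv.init hn hσ.feas hoff hs

/-- Dual feasibility makes the cost equivalent to a nonnegative one, so the system with unit weights
is bounded on every set of columns. -/
theorem runs_round (hR : IsRatioOracle P.A R) {K : ℕ} {σ : State n} (hm1 : 1 ≤ m) (hm : m ≤ n)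
    (hK : 1 ≤ K) (hσ : Base P K σ) (hf : ∀ j, σ.vec 4 j = 0 ∨ σ.vec 4 j = 1)
    (hdual : ∃ y : Fin m → ℝ, ∀ j, 0 ≤ P.c j + (P.Aᵀ *ᵥ y) j) :
    Runs P R O round σ (400 * m * n ^ 2 * K) (15 * m * n * K) fun τ => Base P K τ ∧
      Frame [3, 4, 5, 6, 7, 8, 9, 11, 12, 14, 15] [3, 5, 7, 8, 9] σ τ ∧
      (∀ j, τ.vec 4 j = 0 ∨ τ.vec 4 j = 1) ∧
      (64 * (n : ℝ) ^ 5 * circuitImbalance P.A ^ 3 ≤ 2 ^ K → ∀ i,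
        RoundInv P i (σ.vec 4) σ.x → RoundInv P (i + 1) (τ.vec 4) τ.x) := by
  have hn : 1 ≤ n := hm1.trans hm
  obtain ⟨y, hy⟩ := hdual
  obtain ⟨r, hr⟩ := hR.exists_eq_some (Function.support (σ.vec 4)) P.c (fun _ => 1)
    (fun _ _ => one_ne_zero) (-y) (fun j => P.c j + (P.Aᵀ *ᵥ y) j) (fun j _ => hy j)
    (fun j _ => by rw [Matrix.mulVec_neg, Pi.neg_apply]; ring)
  have hnn : n ≤ n ^ 2 := by nlinarith
  have h1n : 1 ≤ n ^ 2 := hn.trans hnn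
  have hX : n ^ 2 ≤ m * (n ^ 2 * K) := by
    calc n ^ 2 = 1 * (n ^ 2 * 1) := by ring
      _ ≤ m * (n ^ 2 * K) := Nat.mul_le_mul hm1 (Nat.mul_le_mul_left _ hK)
  have hX' : n ^ 2 * K ≤ m * (n ^ 2 * K) := Nat.le_mul_of_pos_left _ hm1
  have hY : n * K ≤ m * (n * K) := Nat.le_mul_of_pos_left _ hm1
  have hY' : 1 ≤ n * K := Nat.mul_pos hn hK
  have hmX : m ≤ m * (n ^ 2 * K) := Nat.le_mul_of_pos_right _ (Nat.mul_pos h1n hK)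
  refine ((runs_assignAll hσ.cols (fun _ => 1) (fun j τ _ _ _ => by
      simp only [RExpr.eval, Rat.cast_one])).seq
    (t₂ := 1 + ((3 * n + 3) + ((4 * n + 2) + ((4 * n + 2) +
      (((m + 1) * (150 * n ^ 2 * K + 2) + 2) + (4 * n + 2))) + 1)))
    (k₂ := 1 + (0 + (0 + (0 + ((m + 1) * (7 * n * K) + 0))))) ?_).mono ?_ ?_ fun _ h => h
  rotate_left
  · have e : (m + 1) * (150 * n ^ 2 * K + 2) =
        150 * (m * (n ^ 2 * K)) + 150 * (n ^ 2 * K) + 2 * m + 2 := by ring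
    have e' : 400 * m * n ^ 2 * K = 400 * (m * (n ^ 2 * K)) := by ring
    rw [e, e']
    omega
  · have e : (m + 1) * (7 * n * K) = 7 * (m * (n * K)) + 7 * (n * K) := by ring
    have e' : 15 * m * n * K = 15 * (m * (n * K)) := by ring
    rw [e, e']
    omega
  rintro τ₁ ⟨hfr₁, hx₁, -, hw₁⟩
  have hB₁ : Base P K τ₁ := hσ.frame hfr₁ hx₁ (by decide) (by decide)
  have e4 : τ₁.vec 4 = σ.vec 4 := hfr₁.vec (by decide)
  refine (runs_ratio (r := r) (by rw [e4, hw₁, hB₁.cost]; exact hr) (by decide) (by decide)).seq ?_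
  rintro τ₂ ⟨hfr₂, hx₂, -, -, hs₂, -⟩
  have hB₂ : Base P K τ₂ := hB₁.frame hfr₂ hx₂ (by decide) (by decide)
  have f4 : τ₂.vec 4 = σ.vec 4 := by rw [hfr₂.vec (by decide), e4]
  refine (runs_dot hB₂.cols (by decide) (by decide)).seq ?_
  rintro τ₃ ⟨hfr₃, hx₃, -, hρ⟩
  rw [f4, hs₂] at hρ
  have hB₃ : Base P K τ₃ := hB₂.frame hfr₃ hx₃ (by decide) (by decide)
  have g4 : τ₃.vec 4 = σ.vec 4 := by rw [hfr₃.vec (by decide), f4]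
  have g6 : τ₃.vec 6 = r.s := by rw [hfr₃.vec (by decide), hs₂]
  have hx₃' : τ₃.x = σ.x := by rw [hx₃, hx₂, hx₁]
  have hfr₃' : Frame [3, 4, 5, 6, 7, 8, 9, 11, 12, 14, 15] [3, 5, 7, 8, 9] σ τ₃ :=
    ((hfr₁.mono (by decide) (by decide)).trans (hfr₂.mono (by decide) (by decide))).trans
      (hfr₃.mono (by decide) (by decide))
  refine Runs.branch (fun hb => ?_) (fun hb => ?_)
  · have hpos : 0 < σ.vec 4 ⬝ᵥ r.s := by
      have : ((0 : ℚ) : ℝ) < τ₃.real 12 0 0 := hb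
      rwa [Rat.cast_zero, hρ] at this
    have hs₀ := normalized_slack hR hf hr hpos
    have hB₃' : Base P K τ₃.tick :=
      hB₃.frame (as := []) (vs := []) ⟨fun _ _ => rfl, fun _ _ => rfl⟩ rfl (by decide) (by decide)
    refine (runs_assignAll (σ := τ₃.tick) hB₃'.cols (fun j => r.s j / (σ.vec 4 ⬝ᵥ r.s)) ?_).seq ?_
    · intro j υ hj hfr h6
      have h6' : υ.vec 6 j = r.s j := h6.trans (congrFun g6 j)
      have h12 : υ.real 12 0 0 = σ.vec 4 ⬝ᵥ r.s := by
        rw [hfr.1 12 (by decide)]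
        exact hρ
      simp only [RExpr.eval, eval_entry hj, eval_scalar, h6', h12]
    rintro τ₄ ⟨hfr₄, hx₄, -, hs₄⟩
    have hfr₄' : Frame [6] [5] τ₃ τ₄ := hfr₄
    have hB₄ : Base P K τ₄ := hB₃.frame hfr₄' hx₄ (by decide) (by decide)
    have k4 : τ₄.vec 4 = σ.vec 4 := by rw [hfr₄'.vec (by decide), g4]
    refine (runs_truncate hB₄).seq ?_
    rintro τ₅ ⟨hfr₅, hx₅, hc₅⟩
    have hB₅ : Base P K τ₅ := hB₄.frame hfr₅ hx₅ (by decide) (by decide)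
    have l4 : τ₅.vec 4 = σ.vec 4 := by rw [hfr₅.vec (by decide), k4]
    have l6 : τ₅.vec 6 = fun j => r.s j / (σ.vec 4 ⬝ᵥ r.s) := by rw [hfr₅.vec (by decide), hs₄]
    have hx₅' : τ₅.x = σ.x := hx₅.trans (hx₄.trans hx₃')
    refine (runs_phases hR hm hn hK hB₅ (by rw [l4]; exact hf)
      (by rw [hc₅, l4, k4, l6, hs₄]) (by rw [l4, l6]; exact hs₀)).seq ?_
    rintro τ₆ ⟨hB₆, hfr₆, hinv⟩
    rw [l4, l6, hx₅'] at hinv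
    have p4 : τ₆.vec 4 = σ.vec 4 := by rw [hfr₆.vec (by decide), l4]
    refine (runs_assign hB₆.cols (fixLarge (σ.vec 4) (τ₆.vec 6)) ?_).mono le_rfl le_rfl ?_
    · intro j υ hj hfr h4
      have hn2 : υ.nat 2 = n := (hfr.2 2 (by decide)).trans hB₆.cols
      simp only [BExpr.Holds, RExpr.eval, NExpr.eval, eval_entry hj, h4, p4,
        hfr.vec (by decide : 6 ∉ [4]), hn2, Rat.cast_one, Rat.cast_zero, Rat.cast_ofNat]
      unfold fixLarge
      exact ⟨fun h => by rw [if_pos h], fun h => by rw [if_neg h]⟩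
    · rintro τ₇ ⟨hfr₇, hx₇, -, hf₇⟩
      refine ⟨hB₆.frame hfr₇ hx₇ (by decide) (by decide),
        (((hfr₃'.trans (hfr₄'.mono (by decide) (by decide))).trans
          (hfr₅.mono (by decide) (by decide))).trans (hfr₆.mono (by decide) (by decide))).trans
          (hfr₇.mono (by decide) (by decide)), fun j => ?_, fun hbig i hri => ?_⟩
      · rw [hf₇]
        unfold fixLarge
        split_ifs
        · exact Or.inl rfl
        · exact hf j
      · rw [hx₇]
        exact hri.next hR hn hm hbig hr
          (Or.inr ⟨hpos, τ₆.vec 6, τ₆.vec 5, hinv hbig hri.off, hf₇⟩)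
  · refine (Runs.skip (P := P) (R := R) (O := O) (σ := τ₃.tick) (Q := fun τ =>
      τ = τ₃.tick.tick) rfl).mono (by omega) (Nat.zero_le _) ?_
    rintro τ₄ rfl
    have hfr₄ : Frame [] [] τ₃ τ₃.tick.tick := ⟨fun _ _ => rfl, fun _ _ => rfl⟩
    have k4 : τ₃.tick.tick.vec 4 = σ.vec 4 := g4
    have kx : τ₃.tick.tick.x = σ.x := hx₃'
    refine ⟨hB₃.frame hfr₄ rfl (by decide) (by decide),
      hfr₃'.trans (hfr₄.mono (by decide) (by decide)), by rw [k4]; exact hf,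
      fun hbig i hri => hri.next hR hn hm hbig hr (Or.inl ⟨?_, k4, kx⟩)⟩
    have h1 : ¬ ((0 : ℚ) : ℝ) < τ₃.real 12 0 0 := hb
    rwa [hρ, Rat.cast_zero] at h1

/-- All rounds for one guess. -/
def rounds : Program := .seq (assignAll 4 (.const 1)) (forLoop 6 (.var 2) round)

theorem runs_rounds (hR : IsRatioOracle P.A R) {K : ℕ} {σ : State n} (hm1 : 1 ≤ m) (hm : m ≤ n)
    (hK : 1 ≤ K) (hσ : Base P K σ)
    (hdual : ∃ y : Fin m → ℝ, ∀ j, 0 ≤ P.c j + (P.Aᵀ *ᵥ y) j) :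
    Runs P R O rounds σ (410 * m * n ^ 3 * K) (15 * m * n ^ 2 * K) fun τ => Base P K τ ∧
      Frame [3, 4, 5, 6, 7, 8, 9, 11, 12, 14, 15] [3, 5, 6, 7, 8, 9] σ τ ∧
      (64 * (n : ℝ) ^ 5 * circuitImbalance P.A ^ 3 ≤ 2 ^ K → P.Optimal τ.x) := by
  have hn : 1 ≤ n := hm1.trans hm
  refine ((runs_assignAll hσ.cols (fun _ => 1) (fun j τ _ _ _ => by
      simp only [RExpr.eval, Rat.cast_one])).seq
    (t₂ := n * (400 * m * n ^ 2 * K + 2) + 2) (k₂ := n * (15 * m * n * K)) ?_).mono ?_ ?_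
      fun _ h => h
  rotate_left
  · have e : n * (400 * m * n ^ 2 * K + 2) = 400 * (m * n ^ 3 * K) + 2 * n := by ring
    have e' : 410 * m * n ^ 3 * K = 410 * (m * n ^ 3 * K) := by ring
    have h1 : n ≤ m * n ^ 3 * K := by
      calc n = 1 * n ^ 1 * 1 := by ring
        _ ≤ m * n ^ 3 * K := Nat.mul_le_mul (Nat.mul_le_mul hm1
            (Nat.pow_le_pow_right hn (by norm_num))) hK
    rw [e, e']
    omega
  · refine le_of_eq ?_
    ring
  rintro τ₁ ⟨hfr₁, hx₁, -, hw₁⟩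
  have hB₁ : Base P K τ₁ := hσ.frame hfr₁ hx₁ (by decide) (by decide)
  refine (Runs.forLoop (N := n) (t := 400 * m * n ^ 2 * K) (k := 15 * m * n * K)
    (fun i τ => Base P K τ ∧
      Frame [3, 4, 5, 6, 7, 8, 9, 11, 12, 14, 15] [3, 5, 6, 7, 8, 9] σ τ ∧
      (∀ j, τ.vec 4 j = 0 ∨ τ.vec 4 j = 1) ∧
      (64 * (n : ℝ) ^ 5 * circuitImbalance P.A ^ 3 ≤ 2 ^ K → RoundInv P i (τ.vec 4) τ.x))
    ?_ ?_ ?_ ?_).mono le_rfl le_rfl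
      fun τ h => ⟨h.1, h.2.1, fun hbig => (h.2.2.2 hbig).optimal⟩
  · rintro i τ ⟨h1, h2, h3, h4⟩
    exact ⟨h1.frame (as := []) (vs := []) ⟨fun _ _ => rfl, fun _ _ => rfl⟩ rfl (by decide)
      (by decide), h2, h3, h4⟩
  · rintro i τ ⟨h1, -⟩
    simp only [NExpr.eval, h1.cols]
  · rintro i τ hi hv ⟨h1, h2, h3, h4⟩
    refine (runs_round hR hm1 hm hK h1 h3 hdual).mono le_rfl le_rfl ?_
    rintro υ ⟨g1, g2, g3, g4⟩
    have hfr : Frame [] [6] υ (υ.setNat 6 (i + 1)) :=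
      ⟨fun _ _ => rfl, fun v hv => by
        have hne : v ≠ 6 := by simpa using hv
        simp [State.setNat, hne]⟩
    exact ⟨by rw [g2.2 6 (by decide), hv], g1.frame hfr rfl (by decide) (by decide),
      (h2.trans (g2.mono (by decide) (by decide))).trans (hfr.mono (by decide) (by decide)),
      g3, fun hbig => g4 hbig i (h4 hbig)⟩
  · have hfr : Frame [] [6] τ₁ (τ₁.setNat 6 0) :=
      ⟨fun _ _ => rfl, fun v hv => by
        have hne : v ≠ 6 := by simpa using hv
        simp [State.setNat, hne]⟩
    refine ⟨hB₁.frame hfr rfl (by decide) (by decide),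
      (hfr₁.mono (by decide) (by decide)).trans (hfr.mono (by decide) (by decide)),
      fun j => Or.inr (congrFun hw₁ j), fun _ => ?_⟩
    show RoundInv P 0 (τ₁.vec 4) τ₁.x
    rw [hw₁]
    exact RoundInv.init hB₁.feas

theorem feasible_add_of_ratioFeasible (P : LP m n) {F : Set (Fin n)} {x z : Fin n → ℝ}
    (hx : P.Feasible x) (hz : RatioFeasible P.A F (weightsOf (invWeights x)) z) :
    P.Feasible (x + z) := by
  refine ⟨by rw [Matrix.mulVec_add, hx.1, hz.1, add_zero], fun j => ?_⟩
  have := neg_le_of_ratioFeasible_inv hx.2 hz j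
  rw [Pi.add_apply]
  linarith

/-! ### The optimality test and the search for a sufficient guess. -/

/-- Test the current solution for optimality, and square the guess if the test fails. -/
def verify : Program :=
  .seq (assignAll 10 (.const 1)) (.seq (consult 2 10)
    (.branch (.realLT (scalar 12) (.const 0))
      (.seq (.setNat 4 (.add (.var 4) (.var 4)))
        (.setReal 13 (.const 0) (.const 0) (.mul (scalar 13) (scalar 13))))
      (.setNat 10 (.const 1))))

/-- The test is exact and independent of the guess: a nonnegative optimal value certifies optimality
by `ratio_gap`, and a negative one makes `x + z` a better feasible point. -/
theorem runs_verify (hR : IsRatioOracle P.A R) {K : ℕ} {σ : State n} (hn : 1 ≤ n)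
    (hσ : Base P K σ) (hdual : ∃ y : Fin m → ℝ, ∀ j, 0 ≤ P.c j + (P.Aᵀ *ᵥ y) j) :
    Runs P R O verify σ (22 * n) 1 fun τ =>
      (τ.nat 0 = 0 ∧ τ.nat 10 = 1 ∧ P.Optimal τ.x) ∨
      (τ.nat 10 = σ.nat 10 ∧ Base P (2 * K) τ ∧ ¬ P.Optimal σ.x) := by
  obtain ⟨y, hy⟩ := hdual
  refine ((runs_assignAll hσ.cols (fun _ => 1) (fun j τ _ _ _ => by
      simp only [RExpr.eval, Rat.cast_one])).seq
    (t₂ := (7 * n + 6) + (2 + 1)) (k₂ := 1 + 0) ?_).mono (by omega) (by omega) fun _ h => h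
  rintro τ₁ ⟨hfr₁, hx₁, -, hw₁⟩
  have hB₁ : Base P K τ₁ := hσ.frame hfr₁ hx₁ (by decide) (by decide)
  obtain ⟨r, hr⟩ := hR.exists_eq_some (Function.support fun _ : Fin n => (1 : ℝ)) P.c
    (invWeights σ.x)
    (fun j _ => invWeights_ne_zero hσ.feas.2 j) (-y) (fun j => P.c j + (P.Aᵀ *ᵥ y) j)
    (fun j _ => hy j) (fun j _ => by rw [Matrix.mulVec_neg, Pi.neg_apply]; ring)
  obtain ⟨⟨hfeas, hopt⟩, -, -⟩ := (hR _ _ _).2 r hr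
  refine (runs_consult (r := r) hB₁.cols (by decide) (by decide)
    (by rw [hw₁, hB₁.cost, hB₁.sol, hx₁]; exact hr)).seq ?_
  rintro τ₂ ⟨hfr₂, hx₂, -, h12⟩
  rw [hB₁.cost] at h12
  have hB₂ : Base P K τ₂ := hB₁.frame hfr₂ hx₂ (by decide) (by decide)
  refine Runs.branch (fun hb => ?_) (fun hb => ?_)
  · have hlt : P.c ⬝ᵥ r.z < 0 := by
      have : τ₂.real 12 0 0 < ((0 : ℚ) : ℝ) := hb
      rwa [h12, Rat.cast_zero] at this
    have h1 : Runs P R O (.setNat 4 (.add (.var 4) (.var 4))) τ₂.tick 1 0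
        fun τ => τ = τ₂.tick.tick.setNat 4 (2 * K) := by
      refine Runs.setNat ?_
      have : (NExpr.add (.var 4) (.var 4)).eval τ₂.tick = 2 * K := by
        show τ₂.nat 4 + τ₂.nat 4 = 2 * K
        rw [hB₂.guess]
        ring
      rw [this]
    refine h1.seq (t₂ := 1) (k₂ := 0) ?_
    rintro τ₃ rfl
    refine Runs.setReal (Or.inr ?_)
    have hval : (RExpr.mul (scalar 13) (scalar 13)).eval (τ₂.tick.tick.setNat 4 (2 * K)) =
        2 ^ (2 * K) := by
      show τ₂.real 13 0 0 * τ₂.real 13 0 0 = _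
      rw [hB₂.pow, two_mul, pow_add]
    rw [hval]
    set τ₄ := (τ₂.tick.tick.setNat 4 (2 * K)).tick.setReal 13 ((NExpr.const 0).eval
      (τ₂.tick.tick.setNat 4 (2 * K))) ((NExpr.const 0).eval (τ₂.tick.tick.setNat 4 (2 * K)))
      (2 ^ (2 * K)) with hτ₄
    have hfr : Frame [13] [4] τ₂ τ₄ :=
      ⟨fun a ha => by
        have hne : a ≠ 13 := by simpa using ha
        funext i j
        simp [hτ₄, State.setNat, State.setReal, State.tick, hne], fun v hv => by
        have hne : v ≠ 4 := by simpa using hv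
        simp [hτ₄, State.setNat, State.setReal, State.tick, hne]⟩
    refine ⟨?_, ⟨?_, ?_, ?_, ?_, ?_, ?_, ?_, hB₂.feas⟩, fun hcon => ?_⟩
    · rw [hfr.2 10 (by decide), hfr₂.2 10 (by decide), hfr₁.2 10 (by decide)]
    · rw [hfr.2 0 (by decide), hB₂.flag]
    · rw [hfr.2 1 (by decide), hB₂.rows]
    · rw [hfr.2 2 (by decide), hB₂.cols]
    · simp [hτ₄, State.setNat, State.setReal, State.tick]
    · simp [hτ₄, State.setReal, NExpr.eval]
    · rw [hfr.vec (by decide), hB₂.cost]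
    · rw [hfr.vec (by decide), hB₂.sol]
      rfl
    · have hmax := feasible_add_of_ratioFeasible P hσ.feas hfeas
      have h2 := hcon.2 _ hmax
      rw [dotProduct_add] at h2
      linarith
  · have hge : 0 ≤ P.c ⬝ᵥ r.z := by
      have h1 : ¬ τ₂.real 12 0 0 < ((0 : ℚ) : ℝ) := hb
      rwa [h12, Rat.cast_zero, not_lt] at h1
    refine (Runs.setNat (P := P) (R := R) (O := O) (Or.inl ⟨?_, ?_, ?_⟩)).mono
      (by omega) le_rfl fun _ h => h
    · show τ₂.nat 0 = 0
      exact hB₂.flag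
    · rfl
    · show P.Optimal τ₂.x
      rw [hx₂, hx₁]
      refine ⟨hσ.feas, fun u hu => ?_⟩
      have h1 := ratio_gap P (x' := u) (d := P.c) (z := r.z) hn hσ.feas hu
        (fun j hj => absurd (show j ∈ Function.support fun _ : Fin n => (1 : ℝ) from one_ne_zero)
          hj) hopt
      have h2 : 0 ≤ n * (P.c ⬝ᵥ r.z) := by positivity
      linarith

/-- Square the guess until the optimality test succeeds. -/
def search : Program := .loop (.natLT (.var 10) (.const 1)) (.seq rounds verify)

/-- `D` is the remaining budget, measured in values of `K`. A failed test implies `K < N`, so the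
doubled guess is at most `2 N`; with `K + D = 4 N` the geometric sum of all guesses stays within the
budget. -/
theorem runs_search (hR : IsRatioOracle P.A R) {N : ℕ} (hm1 : 1 ≤ m) (hm : m ≤ n)
    (hN : 64 * (n : ℝ) ^ 5 * circuitImbalance P.A ^ 3 ≤ 2 ^ N)
    (hdual : ∃ y : Fin m → ℝ, ∀ j, 0 ≤ P.c j + (P.Aᵀ *ᵥ y) j) (D : ℕ) :
    ∀ {K : ℕ} {σ : State n}, K + D = 4 * N → 1 ≤ K → K ≤ 2 * N → Base P K σ → σ.nat 10 = 0 →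
      Runs P R O search σ (500 * m * n ^ 3 * D) (16 * m * n ^ 2 * D)
        fun τ => τ.nat 0 = 0 ∧ P.Optimal τ.x := by
  induction D using Nat.strong_induction_on with
  | _ D ih =>
    intro K σ hKD hK hKN hσ hopen
    have hn : 1 ≤ n := hm1.trans hm
    have hX : n ≤ m * n ^ 3 * K := by
      calc n = 1 * n ^ 1 * 1 := by ring
        _ ≤ m * n ^ 3 * K := Nat.mul_le_mul (Nat.mul_le_mul hm1
            (Nat.pow_le_pow_right hn (by norm_num))) hK
    have hY : 1 ≤ m * n ^ 2 * K := Nat.mul_pos (Nat.mul_pos hm1 (Nat.pow_pos hn)) hK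
    have e1 : 410 * m * n ^ 3 * K = 410 * (m * n ^ 3 * K) := by ring
    have e2 : 15 * m * n ^ 2 * K = 15 * (m * n ^ 2 * K) := by ring
    have e3 : ∀ d, 500 * m * n ^ 3 * d = 500 * (m * n ^ 3 * d) := fun d => by ring
    have e4 : ∀ d, 16 * m * n ^ 2 * d = 16 * (m * n ^ 2 * d) := fun d => by ring
    have hσ' : Base P K σ.tick :=
      hσ.frame (as := []) (vs := []) ⟨fun _ _ => rfl, fun _ _ => rfl⟩ rfl (by decide) (by decide)
    have hbody : Runs P R O (.seq rounds verify) σ.tick (410 * m * n ^ 3 * K + 22 * n)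
        (15 * m * n ^ 2 * K + 1) fun τ => (τ.nat 0 = 0 ∧ τ.nat 10 = 1 ∧ P.Optimal τ.x) ∨
          (τ.nat 10 = 0 ∧ Base P (2 * K) τ ∧ K < N) := by
      refine (runs_rounds hR hm1 hm hK hσ' hdual).seq ?_
      rintro τ ⟨h1, h2, h3⟩
      refine (runs_verify hR hn h1 hdual).mono le_rfl le_rfl ?_
      rintro υ (h4 | ⟨h4, h5, h6⟩)
      · exact Or.inl h4
      · refine Or.inr ⟨by rw [h4, h2.2 10 (by decide)]; exact hopen, h5, ?_⟩
        by_contra hcon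
        refine h6 (h3 (hN.trans ?_))
        exact pow_le_pow_right₀ one_le_two (not_lt.1 hcon)
    have hguard : (BExpr.natLT (.var 10) (.const 1)).Holds σ := by
      show σ.nat 10 < 1
      rw [hopen]
      exact Nat.zero_lt_one
    obtain ⟨τ, h1, h2, h3, h4, ⟨h5, h6, h7⟩ | ⟨h5, h6, h7⟩⟩ := hbody
    · have hdone : ¬ (BExpr.natLT (.var 10) (.const 1)).Holds τ := by
        show ¬ τ.nat 10 < 1
        rw [h6]
        exact lt_irrefl 1
      have hKD' : K ≤ D := by omega
      have f1 : m * n ^ 3 * K ≤ m * n ^ 3 * D := Nat.mul_le_mul_left _ hKD'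
      have f2 : m * n ^ 2 * K ≤ m * n ^ 2 * D := Nat.mul_le_mul_left _ hKD'
      refine ⟨τ.tick, .loopStep _ _ _ _ _ hguard h1 (.loopDone _ _ _ hdone), ?_, ?_, h4, h5, h7⟩
      · have g1 : σ.tick.time = σ.time + 1 := rfl
        have g2 : τ.tick.time = τ.time + 1 := rfl
        rw [e3]
        omega
      · have g1 : σ.tick.ratioCalls = σ.ratioCalls := rfl
        have g2 : τ.tick.ratioCalls = τ.ratioCalls := rfl
        rw [e4]
        omega
    · obtain ⟨D', rfl⟩ : ∃ D', D = K + D' := ⟨D - K, by omega⟩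
      obtain ⟨υ, g1, g2, g3, g4, g5⟩ := ih D' (by omega) (K := 2 * K) (by omega) (by omega)
        (by omega) h6 h5
      refine ⟨υ, .loopStep _ _ _ _ _ hguard h1 g1, ?_, ?_, by rw [g4, h4]; rfl, g5⟩
      · have f1 : σ.tick.time = σ.time + 1 := rfl
        have f2 : m * n ^ 3 * (K + D') = m * n ^ 3 * K + m * n ^ 3 * D' := by ring
        rw [e3] at g2 ⊢
        omega
      · have f1 : σ.tick.ratioCalls = σ.ratioCalls := rfl
        have f2 : m * n ^ 2 * (K + D') = m * n ^ 2 * K + m * n ^ 2 * D' := by ring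
        rw [e4] at g3 ⊢
        omega

/-- The circuit augmentation algorithm: test for unboundedness, then search for an optimal
solution. -/
def solve : Program :=
  .seq (assignAll 9 (.const (-1))) (.seq (assignAll 10 (.const 1))
    (.seq (.ratio 2 9 10 7 8 6 3) (.branch (.natLT (.var 3) (.const 1)) (.setNat 0 (.const 1))
      (.seq (.setNat 4 (.const 1))
        (.seq (.setReal 13 (.const 0) (.const 0) (.const 2)) search)))))

theorem initial_vec_cost (P : LP m n) (x₀ : Fin n → ℝ) : (initial P x₀).vec 2 = P.c := by
  funext j
  simp [initial, State.vec]

theorem initial_vec_sol (P : LP m n) (x₀ : Fin n → ℝ) : (initial P x₀).vec 3 = x₀ := by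
  funext j
  simp [initial, State.vec]

/-- The code `-1` stands for infinite weights, which force `z ≥ 0`: the feasible vectors are the
recession directions of the polyhedron. -/
theorem unbounded_of_ratio_unbounded (P : LP m n) {F : Set (Fin n)} {x₀ : Fin n → ℝ}
    (hx₀ : P.Feasible x₀)
    (h : ∀ B : ℝ, ∃ z, RatioFeasible P.A F (weightsOf fun _ => -1) z ∧ P.c ⬝ᵥ z < B) :
    P.Unbounded := by
  intro B
  obtain ⟨z, hz, hlt⟩ := h (B - P.c ⬝ᵥ x₀)
  rw [ratioFeasible_weightsOf] at hz
  refine ⟨x₀ + z, ⟨by rw [Matrix.mulVec_add, hx₀.1, hz.1, add_zero], fun j =>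
    add_nonneg (hx₀.2 j) (hz.2.2.1 j (by norm_num))⟩, ?_⟩
  rw [dotProduct_add]
  linarith

/-- If the first call reports a bounded system, its answer is a feasible dual solution of the linear
program; every later call relies on it or on a nonnegative cost. The budget `4 * N - 1` leaves room
for this call. -/
theorem runs_solve (hR : IsRatioOracle P.A R) {N : ℕ} (hm1 : 1 ≤ m) (hm : m ≤ n) (hN1 : 1 ≤ N)
    (hN : 64 * (n : ℝ) ^ 5 * circuitImbalance P.A ^ 3 ≤ 2 ^ N) {x₀ : Fin n → ℝ}
    (hx₀ : P.Feasible x₀) :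
    Runs P R O solve (initial P x₀) (2000 * m * n ^ 3 * N + 20 * n) (64 * m * n ^ 2 * N)
      (Solves P) := by
  have hn : 1 ≤ n := hm1.trans hm
  have hY : 1 ≤ m * n ^ 2 := Nat.mul_pos hm1 (Nat.pow_pos hn)
  have hcols : (initial P x₀).nat 2 = n := rfl
  refine ((runs_assignAll hcols (fun _ => -1) (fun j τ _ _ _ => by
      simp [RExpr.eval])).seq
    (t₂ := (4 * n + 2) + (1 + ((1 + (1 + 500 * m * n ^ 3 * (4 * N - 1))) + 1)))
    (k₂ := 0 + (1 + (0 + (0 + 16 * m * n ^ 2 * (4 * N - 1))))) ?_).mono ?_ ?_ fun _ h => h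
  rotate_left
  · have e1 : 500 * m * n ^ 3 * (4 * N - 1) ≤ 500 * m * n ^ 3 * (4 * N) :=
      Nat.mul_le_mul_left _ (Nat.sub_le _ _)
    have e2 : 500 * m * n ^ 3 * (4 * N) = 2000 * m * n ^ 3 * N := by ring
    omega
  · have e1 : 16 * m * n ^ 2 * (4 * N - 1) + 16 * (m * n ^ 2) = 64 * m * n ^ 2 * N := by
      obtain ⟨M, hM⟩ : ∃ M, 4 * N = M + 1 := ⟨4 * N - 1, by omega⟩
      have e2 : 64 * m * n ^ 2 * N = 16 * m * n ^ 2 * (4 * N) := by ring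
      rw [e2, hM, Nat.add_sub_cancel]
      ring
    omega
  rintro τ₁ ⟨hfr₁, hx₁, -, hw₁⟩
  refine (runs_assignAll ((hfr₁.2 2 (by decide)).trans hcols) (fun _ => 1) (fun j τ _ _ _ => by
      simp only [RExpr.eval, Rat.cast_one])).seq ?_
  rintro τ₂ ⟨hfr₂, hx₂, -, hf₂⟩
  have hfr₂' : Frame [9, 10] [5] (initial P x₀) τ₂ :=
    (hfr₁.mono (by decide) (by decide)).trans (hfr₂.mono (by decide) (by decide))
  have hx₂' : τ₂.x = x₀ := hx₂.trans hx₁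
  have hw₂ : τ₂.vec 9 = fun _ => -1 := by rw [hfr₂.vec (by decide), hw₁]
  have hc₂ : τ₂.vec 2 = P.c := by rw [hfr₂'.vec (by decide), initial_vec_cost]
  rcases hr : R (Function.support (τ₂.vec 10)) (τ₂.vec 2) (weightsOf (τ₂.vec 9)) with _ | r
  · have hex := Exec.ratio (P := P) (R := R) (O := O) 2 9 10 7 8 6 3 τ₂
    have hr' : R (τ₂.idx 10) (τ₂.vec 2) (τ₂.weights 9) = none := hr
    rw [hr'] at hex
    have hcall : Runs P R O (.ratio 2 9 10 7 8 6 3) τ₂ 1 1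
        fun τ => τ = τ₂.tick.afterRatio 7 8 6 3 (none : Option (RatioAnswer m n)) :=
      ⟨_, hex, le_rfl, le_rfl, rfl, rfl⟩
    refine hcall.seq ?_
    rintro τ₃ rfl
    refine Runs.branch (fun _ => ?_) (fun hb => absurd ?_ hb)
    · refine (Runs.setNat (Or.inr ⟨rfl, ?_⟩)).mono (by omega) (Nat.zero_le _) fun _ h => h
      have hu := (hR _ _ _).1 hr
      rw [hw₂, hc₂] at hu
      exact unbounded_of_ratio_unbounded P hx₀ hu
    · exact Nat.zero_lt_one
  · refine (runs_ratio hr (by decide) (by decide)).seq ?_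
    rintro τ₃ ⟨hfr₃, hx₃, -, -, -, hv₃⟩
    have hfr₃' : Frame [6, 7, 8, 9, 10] [3, 5] (initial P x₀) τ₃ :=
      (hfr₂'.mono (by decide) (by decide)).trans (hfr₃.mono (by decide) (by decide))
    refine Runs.branch (fun hb => absurd hb ?_) (fun _ => ?_)
    · show ¬ τ₃.nat 3 < 1
      rw [hv₃]
      exact lt_irrefl 1
    obtain ⟨-, -, lam, ⟨-, hd⟩, -⟩ := (hR _ _ _).2 r hr
    have hdual : ∃ y : Fin m → ℝ, ∀ j, 0 ≤ P.c j + (P.Aᵀ *ᵥ y) j := by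
      refine ⟨r.y, fun j => ?_⟩
      obtain ⟨h1, h2, -⟩ := hd j (by rw [hf₂]; exact one_ne_zero)
      rwa [h1, hc₂] at h2
    have h4 : Runs P R O (.setNat 4 (.const 1)) τ₃.tick 1 0
        fun τ => τ = τ₃.tick.tick.setNat 4 1 := Runs.setNat rfl
    refine h4.seq ?_
    rintro τ₄ rfl
    have h5 : Runs P R O (.setReal 13 (.const 0) (.const 0) (.const 2))
        (τ₃.tick.tick.setNat 4 1) 1 0
        fun τ => τ = (τ₃.tick.tick.setNat 4 1).tick.setReal 13 0 0 2 :=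
      Runs.setReal (by simp [RExpr.eval, NExpr.eval])
    refine h5.seq ?_
    rintro τ₅ rfl
    set τ₅ := (τ₃.tick.tick.setNat 4 1).tick.setReal 13 0 0 2 with hτ₅
    have hfr₅ : Frame [6, 7, 8, 9, 10, 13] [3, 4, 5] (initial P x₀) τ₅ := by
      refine Frame.trans (hfr₃'.mono (by decide) (by decide)) ⟨fun a ha => ?_, fun v hv => ?_⟩
      · have hne : a ≠ 13 := fun h => ha (by simp [h])
        funext i j
        simp [hτ₅, State.setNat, State.setReal, State.tick, hne]
      · have hne : v ≠ 4 := fun h => hv (by simp [h])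
        simp [hτ₅, State.setNat, State.setReal, State.tick, hne]
    have hx₅ : τ₅.x = x₀ := hx₃.trans hx₂'
    have hbase : Base P 1 τ₅ := by
      refine ⟨hfr₅.2 0 (by decide), hfr₅.2 1 (by decide), hfr₅.2 2 (by decide), ?_, ?_, ?_, ?_, ?_⟩
      · simp [hτ₅, State.setNat, State.setReal, State.tick]
      · simp [hτ₅, State.setReal]
      · rw [hfr₅.vec (by decide), initial_vec_cost]
      · rw [hfr₅.vec (by decide), initial_vec_sol, hx₅]
      · rw [hx₅]
        exact hx₀
    exact (runs_search hR hm1 hm hN hdual (4 * N - 1) (by omega) le_rfl (by omega) hbase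
      (hfr₅.2 10 (by decide))).mono le_rfl le_rfl fun τ h => Or.inl h

end

/-- A sufficient guess of logarithmic size. -/
theorem exists_guess {n : ℕ} {κ : ℝ} (hn : 1 ≤ n) (hκ : 1 ≤ κ) :
    ∃ N : ℕ, 1 ≤ N ∧ 64 * (n : ℝ) ^ 5 * κ ^ 3 ≤ 2 ^ N ∧ (N : ℝ) ≤ 30 * Real.log (n + κ) := by
  have hn' : (1 : ℝ) ≤ n := by exact_mod_cast hn
  have h2 : 2 ≤ n + κ := by linarith
  have hlog2 : 0.69 < Real.log 2 := lt_trans (by norm_num) Real.log_two_gt_d9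
  have hL : Real.log 2 ≤ Real.log (n + κ) := Real.log_le_log (by norm_num) h2
  have hq : 0 < 14 * Real.log (n + κ) / Real.log 2 := by
    have : 0 < Real.log (n + κ) := by linarith
    positivity
  -- Since `n + κ ≥ 2`, the three factors are at most the powers `6`, `5` and `3` of `n + κ`, and
  -- `14` is their sum.
  refine ⟨⌈14 * Real.log (n + κ) / Real.log 2⌉₊, Nat.ceil_pos.2 hq, ?_, ?_⟩
  · have h64 : (64 : ℝ) ≤ (n + κ) ^ 6 := by
      calc (64 : ℝ) = 2 ^ 6 := by norm_num
        _ ≤ (n + κ) ^ 6 := by gcongr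
    have h5 : (n : ℝ) ^ 5 ≤ (n + κ) ^ 5 := by
      gcongr
      linarith
    have h3 : κ ^ 3 ≤ (n + κ) ^ 3 := by
      gcongr
      linarith
    calc 64 * (n : ℝ) ^ 5 * κ ^ 3 ≤ (n + κ) ^ 6 * (n + κ) ^ 5 * (n + κ) ^ 3 := by gcongr
      _ = (n + κ) ^ 14 := by ring
      _ ≤ 2 ^ ⌈14 * Real.log (n + κ) / Real.log 2⌉₊ := by
        rw [← Real.log_le_log_iff (by positivity) (by positivity), Real.log_pow, Real.log_pow]
        have h := Nat.le_ceil (14 * Real.log (n + κ) / Real.log 2)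
        rw [div_le_iff₀ (by linarith)] at h
        exact_mod_cast h
  · have h := Nat.ceil_lt_add_one hq.le
    have h1 : 14 * Real.log (n + κ) / Real.log 2 ≤ 21 * Real.log (n + κ) := by
      rw [div_le_iff₀ (by linarith)]
      nlinarith
    linarith

end CircuitAug

theorem theorem4 :
    ∃ (prog : CircuitAug.Program) (C : ℝ) (d : ℕ),
      ∀ (m n : ℕ) (P : CircuitAug.LP m n) (x₀ : Fin n → ℝ)
        (R : CircuitAug.RatioOracle m n) (O : CircuitAug.SupportOracle n),
        1 ≤ m → P.A.rank = m → P.Feasible x₀ →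
        CircuitAug.IsRatioOracle P.A R → CircuitAug.IsSupportOracle P.A O →
        ∃ τ : CircuitAug.State n,
          CircuitAug.Exec P R O prog (CircuitAug.initial P x₀) τ ∧
          CircuitAug.Solves P τ ∧
          (τ.ratioCalls : ℝ) ≤
            C * (m : ℝ) * (n : ℝ) ^ 2 *
              Real.log ((n : ℝ) + CircuitAug.circuitImbalance P.A) ∧
          τ.supportSteps ≤ (m + 1) * n ^ 2 ∧
          (τ.time : ℝ) ≤
            C * (n : ℝ) ^ d * Real.log ((n : ℝ) + CircuitAug.circuitImbalance P.A) := by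
  -- With `N ≤ 30 L` the calls need `64 * 30 = 1920` and the instructions `2000 * 30 + 20 * 30 =
  -- 60600`; bounding `m` by `n`, which holds by the rank condition, gives the exponent `4`.
  refine ⟨CircuitAug.solve, 70000, 4, ?_⟩
  intro m n P x₀ R O hm1 hrank hx₀ hR _
  have hm : m ≤ n := by
    have h := P.A.rank_le_width
    rwa [hrank] at h
  have hn : 1 ≤ n := hm1.trans hm
  have hκ := CircuitAug.one_le_circuitImbalance P.A
  obtain ⟨N, hN1, hN, hNL⟩ := CircuitAug.exists_guess hn hκ
  obtain ⟨τ, h1, h2, h3, h4, h5⟩ :=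
    CircuitAug.runs_solve (P := P) (R := R) (O := O) hR hm1 hm hN1 hN hx₀
  set L := Real.log ((n : ℝ) + CircuitAug.circuitImbalance P.A) with hLdef
  have hL1 : 0 < L := by
    have : (1 : ℝ) ≤ N := by exact_mod_cast hN1
    linarith
  have hL : 1 ≤ 30 * L := by
    have : (1 : ℝ) ≤ N := by exact_mod_cast hN1
    linarith
  have hm' : (m : ℝ) ≤ n := by exact_mod_cast hm
  have hn' : (1 : ℝ) ≤ n := by exact_mod_cast hn
  refine ⟨τ, h1, h5, ?_, ?_, ?_⟩
  · have h6 : τ.ratioCalls ≤ 64 * m * n ^ 2 * N := by simpa [CircuitAug.initial] using h3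
    calc (τ.ratioCalls : ℝ) ≤ 64 * m * n ^ 2 * N := by exact_mod_cast h6
      _ ≤ 64 * m * n ^ 2 * (30 * L) := by gcongr
      _ = 1920 * (m * n ^ 2 * L) := by ring
      _ ≤ 70000 * (m * n ^ 2 * L) := by
        gcongr
        norm_num
      _ = _ := by ring
  · rw [h4]
    exact Nat.zero_le _
  · have h6 : τ.time ≤ 2000 * m * n ^ 3 * N + 20 * n := by simpa [CircuitAug.initial] using h2
    have h7 : (n : ℝ) ≤ n ^ 4 := le_self_pow₀ hn' (by norm_num)
    calc (τ.time : ℝ) ≤ 2000 * m * n ^ 3 * N + 20 * n := by exact_mod_cast h6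
      _ ≤ 2000 * n * n ^ 3 * (30 * L) + 20 * n ^ 4 * (30 * L) := by
        refine add_le_add (by gcongr) ?_
        calc 20 * (n : ℝ) ≤ 20 * n ^ 4 * 1 := by linarith
          _ ≤ 20 * n ^ 4 * (30 * L) := by gcongr
      _ = 60600 * (n ^ 4 * L) := by ring
      _ ≤ 70000 * (n ^ 4 * L) := by
        gcongr
        norm_num
      _ = _ := by ring
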